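/- **Notation.** $\log$ is the binary logarithm, $\mathcal S^{d-1}$ the unit sphere of $\mathbb R^d$, $\varepsilon=1/\log^2 d$, and $a\approx_\varepsilon b$ means $|a-b|\le\varepsilon$. Let $p_\alpha=\Pr[\langle \mathbf x,\mathbf y\rangle\approx_\varepsilon\cos\alpha]$ for independent uniform $\mathbf x,\mathbf y\in\mathcal S^{d-1}$. Let $\mathcal W_d(\alpha,\beta\mid\theta)$ be the probability that a uniform $\mathbf z\in\mathcal S^{d-1}$ satisfies $\langle\mathbf v,\mathbf z\rangle\ge\cos\alpha$ and $\langle\mathbf w,\mathbf z\rangle\ge\cos\beta$, where $\mathbf v,\mathbf w$ are unit vectors with $\langle\mathbf v,\mathbf w\rangle=\cos\theta$. Put $\gamma^2(\alpha,\beta\mid\theta)=\frac{\cos^2\alpha+\cos^2\beta-2\cos\alpha\cos\beta\cos\theta}{\sin^2\theta}$. For $\kappa'>0$, call $\mathcal W_d(\alpha,\beta\mid\theta)$ well-defined with constant $\kappa'$ if either $\theta\ne0$ and $\kappa'\le\gamma^2(\alpha,\beta\mid\theta)\le1-\kappa'$, or $\alpha=\beta$ and $\frac{2\cos^2\alpha}{1+\cos\theta}\le1-\kappa'$.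 **Random product codes.** Split the $d$ coordinates into $b=\lfloor\log d\rfloor$ consecutive blocks of sizes $\lfloor d/b\rfloor$ or $\lceil d/b\rceil$. For each block $i$ let $\mathcal C^{(i)}$ consist of $\lceil M^{1/b}\rceil$ independent uniform vectors of norm $1/\sqrt b$ in the coordinate space of that block, and let $\mathbf Q_1,\dots,\mathbf Q_N$ be independent uniform (Haar) elements of $\mathrm{SO}(d)$, independent of the $\mathcal C^{(i)}$. A random product code of size parameter $M$ with $N$ rotations is $\mathcal C=\bigcup_{n\le N}\mathbf Q_n(\mathcal C^{(1)}\times\dots\times\mathcal C^{(b)})$. **The sets.** For $L,\mathcal C\subseteq\mathcal S^{d-1}$ let $R(\mathbf x)=\{\mathbf c\in\mathcal C:\langle\mathbf x,\mathbf c\rangle\approx_\varepsilon\cos\alpha\}$, $$M_1(R)=\{(\mathbf x,\mathbf y)\in L^2:\langle\mathbf x,\mathbf y\rangle\approx_\varepsilon\cos\theta,\ R(\mathbf x)\cap R(\mathbf y)\neq\emptyset\},\qquad M_1^*(R)=\{(\mathbf x,\mathbf y)\in M_1(R):|R(\mathbf x)|\le2^{d/\log d}\}.$$ **Statement.** Let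 $\kappa\in(0,\pi/4)$, $C_1\in\mathbb R$ and $\kappa',c_1,c_2,\eta>0$ be constants. There are a constant $c>0$ and a function $f(d)=o(d)$, depending only on these constants, such that for all sufficiently large $d$ the following holds for all $\theta,\alpha\in[\kappa,\pi/2-\kappa]$ such that $\mathcal W_d(\theta,\alpha\mid\alpha)$ and $\mathcal W_d(\alpha,\alpha\mid\theta)$ are well-defined with constant $\kappa'$, all integers $m$ with $2^{c_1d}\le m\le2^{C_1d}$, and all integers $N$ with $1\le N\le2^{(1-\eta)d/\log d}$. Let $L$ consist of $m$ independent uniform elements of $\mathcal S^{d-1}$ and, independently, let $\mathcal C$ be a random product code of size parameter $M=1/p_\alpha$ with $N$ rotations. 1. If $\cos^2\alpha\le\cos\theta$ and $m\,\mathcal W_d(\theta,\alpha\mid\alpha)\ge2^{c_2d}$, then with probability at least $1-2^{-cd}$ both $|M_1(R)|$ and $|M_1^*(R)|$ lie between $2^{-f(d)}V$ and $2^{f(d)}V$, where $V=m^2\,\mathcal W_d(\theta,\alpha\mid\alpha)$. 2. Without the condition $\cos^2\alpha\le\cos\theta$, the same holds with $\mathcal W_d(\theta,\alpha\mid\alpha)$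 replaced by $(1-\gamma^2(\theta,\alpha\mid\alpha))^{d/2}$ both in the hypothesis on $m$ and in $V$. -/

import Mathlib

open MeasureTheory Filter Asymptotics
open scoped Matrix

noncomputable section

namespace Sieving

/-- The unit sphere of the Euclidean space with coordinates indexed by `ι`. -/
abbrev USphere (ι : Type) [Fintype ι] : Type :=
  Metric.sphere (0 : EuclideanSpace ℝ ι) 1

/-- The uniform probability measure on the unit sphere: normalised surface measure. -/
def unifSphere (ι : Type) [Fintype ι] : Measure (USphere ι) :=
  ((volume : Measure (EuclideanSpace ℝ ι)).toSphere Set.univ)⁻¹ •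
    (volume : Measure (EuclideanSpace ℝ ι)).toSphere

/-- The globally fixed tolerance `1 / log² d` (binary logarithm). -/
def eps (d : ℕ) : ℝ := 1 / (Real.logb 2 d) ^ 2

/-- `a` and `b` are equal up to an additive error `ε`. -/
def ApproxEq (ε a b : ℝ) : Prop := |a - b| ≤ ε

/-- `a` and `b` are equal up to a multiplicative factor `2 ^ t`. -/
def EqUpTo (t a b : ℝ) : Prop := (2 : ℝ) ^ (-t) * b ≤ a ∧ a ≤ (2 : ℝ) ^ t * b

/-- The probability `p_α` that two independent uniformly random unit vectors have inner product
`cos α` up to the tolerance. -/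
def pCap (d : ℕ) (α : ℝ) : ℝ :=
  ((unifSphere (Fin d)).prod (unifSphere (Fin d))).real
    {p | ApproxEq (eps d) (inner ℝ (p.1 : EuclideanSpace ℝ (Fin d)) p.2) (Real.cos α)}

/-- The vector `(cos θ, sin θ, 0, …, 0)`. -/
def planeVec (d : ℕ) (θ : ℝ) : EuclideanSpace ℝ (Fin d) :=
  WithLp.toLp 2 fun j => if (j : ℕ) = 0 then Real.cos θ else if (j : ℕ) = 1 then Real.sin θ else 0

/-- The normalised volume `W_d(α, β | θ)` of the spherical wedge
`{z : ⟨v, z⟩ ≥ cos α, ⟨w, z⟩ ≥ cos β}` for unit vectors `v`, `w` with `⟨v, w⟩ = cos θ`. By rotation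
invariance it depends only on the angle, so `v = (1, 0, 0, …)` and `w = (cos θ, sin θ, 0, …)` are
used. -/
def wedgeVol (d : ℕ) (α β θ : ℝ) : ℝ :=
  (unifSphere (Fin d)).real
    {z | Real.cos α ≤ inner ℝ (planeVec d 0) (z : EuclideanSpace ℝ (Fin d)) ∧
      Real.cos β ≤ inner ℝ (planeVec d θ) (z : EuclideanSpace ℝ (Fin d))}

/-- `γ² = (cos² α + cos² β - 2 cos α cos β cos θ) / sin² θ`. -/
def gammaSq (α β θ : ℝ) : ℝ :=
  (Real.cos α ^ 2 + Real.cos β ^ 2 - 2 * Real.cos α * Real.cos β * Real.cos θ) / Real.sin θ ^ 2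

/-- The wedge ratio `W_d(α, β | θ)` is well-defined, with constant `κ'`. -/
def WedgeWellDefined (κ' α β θ : ℝ) : Prop :=
  (θ ≠ 0 ∧ κ' ≤ gammaSq α β θ ∧ gammaSq α β θ ≤ 1 - κ') ∨
    (α = β ∧ 2 * Real.cos α ^ 2 / (1 + Real.cos θ) ≤ 1 - κ')

/-- The rotation group `SO(d)`. -/
abbrev SO (d : ℕ) : Type := Matrix.specialOrthogonalGroup (Fin d) ℝ

instance (d : ℕ) : MeasurableSpace (SO d) := borel _

instance (d : ℕ) : BorelSpace (SO d) := ⟨rfl⟩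

instance (d : ℕ) : IsTopologicalGroup (SO d) where
  continuous_mul := continuous_mul
  continuous_inv :=
    continuous_induced_rng.mpr (continuous_star.comp continuous_subtype_val)

instance (d : ℕ) : CompactSpace (SO d) := by
  apply isCompact_iff_compactSpace.mp
  have hb : IsCompact (Set.pi Set.univ fun _ : Fin d => Set.pi Set.univ fun _ : Fin d =>
      Set.Icc (-1 : ℝ) 1) :=
    isCompact_univ_pi fun _ => isCompact_univ_pi fun _ => isCompact_Icc
  refine IsCompact.of_isClosed_subset (t := (Matrix.specialOrthogonalGroup (Fin d) ℝ :
      Set (Matrix (Fin d) (Fin d) ℝ))) hb ?_ ?_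
  · have h : (Matrix.specialOrthogonalGroup (Fin d) ℝ : Set (Matrix (Fin d) (Fin d) ℝ)) =
        {A | A * star A = 1} ∩ {A | A.det = 1} := by
      ext A
      rw [SetLike.mem_coe, Matrix.mem_specialOrthogonalGroup_iff, Matrix.mem_orthogonalGroup_iff]
      rfl
    rw [h]
    exact (isClosed_eq (by fun_prop) continuous_const).inter
      (isClosed_eq (by fun_prop) continuous_const)
  · intro A hA i _ j _
    have hA' : A ∈ Matrix.unitaryGroup (Fin d) ℝ :=
      (Matrix.mem_specialOrthogonalGroup_iff.mp hA).1
    exact abs_le.mp (by simpa using entry_norm_bound_of_unitary hA' i j)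

/-- The uniform distribution on `SO(d)`: Haar probability measure. -/
def unifSO (d : ℕ) : Measure (SO d) := Measure.haarMeasure ⊤

/-- The coordinates in the `i`-th of `b` consecutive blocks of coordinates. The blocks have
`⌊d / b⌋` or `⌈d / b⌉` elements, hence exactly `d / b` elements if `b` divides `d`. -/
abbrev Block (d b : ℕ) (i : Fin b) : Type := {j : Fin d // (j : ℕ) * b / d = (i : ℕ)}

/-- Number of code vectors per block: `M ^ (1 / b)`, rounded up to an integer. -/
def blockSize (b : ℕ) (M : ℝ) : ℕ := ⌈M ^ (1 / (b : ℝ))⌉₊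

/-- The random choices behind a random product code with `b` blocks, size parameter `M` and `N`
rotations: the rotations, and for each block a list of unit vectors in the space of this block
(they are scaled by `1 / √b` in `blockVec`). -/
abbrev RPCDesc (d b : ℕ) (M : ℝ) (N : ℕ) : Type :=
  (Fin N → SO d) × ((i : Fin b) → Fin (blockSize b M) → USphere (Block d b i))

/-- The law of these choices: everything independent and uniform. -/
def rpcLaw (d b : ℕ) (M : ℝ) (N : ℕ) : Measure (RPCDesc d b M N) :=
  (Measure.pi fun _ => unifSO d).prod
    (Measure.pi fun i => Measure.pi fun _ => unifSphere (Block d b i))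

/-- The concatenation of the vectors `s i / √b`, one for each block. -/
def blockVec {d b : ℕ} (s : (i : Fin b) → USphere (Block d b i)) : EuclideanSpace ℝ (Fin d) :=
  WithLp.toLp 2 fun j => ∑ i : Fin b,
    if h : (j : ℕ) * b / d = (i : ℕ) then (1 / Real.sqrt b) * (s i).1 ⟨j, h⟩ else 0

/-- The random product code `⋃_Q Q (C⁽¹⁾ × ⋯ × C⁽ᵇ⁾)`. -/
def rpcCode {d b : ℕ} {M : ℝ} {N : ℕ} (D : RPCDesc d b M N) : Set (EuclideanSpace ℝ (Fin d)) :=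
  {c | ∃ (n : Fin N) (k : Fin b → Fin (blockSize b M)),
    c = Matrix.toEuclideanLin (D.1 n : Matrix (Fin d) (Fin d) ℝ)
      (blockVec fun i => D.2 i (k i))}

/-- `R(x) = {c ∈ C : ⟨x, c⟩ ≈ cos α}`. -/
def relR {d : ℕ} (C : Set (EuclideanSpace ℝ (Fin d))) (α : ℝ) (x : EuclideanSpace ℝ (Fin d)) :
    Set (EuclideanSpace ℝ (Fin d)) :=
  {c | c ∈ C ∧ ApproxEq (eps d) (inner ℝ x c) (Real.cos α)}

/-- `M₁(R)`: the pairs `(x, y) ∈ L²` with `⟨x, y⟩ ≈ cos θ` and `R(x) ∩ R(y) ≠ ∅`. -/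
def M₁ {d : ℕ} (L C : Set (EuclideanSpace ℝ (Fin d))) (θ α : ℝ) :
    Set (EuclideanSpace ℝ (Fin d) × EuclideanSpace ℝ (Fin d)) :=
  {p | p.1 ∈ L ∧ p.2 ∈ L ∧ ApproxEq (eps d) (inner ℝ p.1 p.2) (Real.cos θ) ∧
    (relR C α p.1 ∩ relR C α p.2).Nonempty}

/-- `M₁*(R)`: the pairs in `M₁(R)` with `|R(x)| ≤ 2 ^ (d / log d)`. -/
def M₁star {d : ℕ} (L C : Set (EuclideanSpace ℝ (Fin d))) (θ α : ℝ) :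
    Set (EuclideanSpace ℝ (Fin d) × EuclideanSpace ℝ (Fin d)) :=
  {p | p ∈ M₁ L C θ α ∧ ((relR C α p.1).ncard : ℝ) ≤ (2 : ℝ) ^ ((d : ℝ) / Real.logb 2 d)}

/-- The list of the `m` sampled unit vectors, as a set. -/
def listSet {d m : ℕ} (x : Fin m → USphere (Fin d)) : Set (EuclideanSpace ℝ (Fin d)) :=
  Set.range fun i => (x i : EuclideanSpace ℝ (Fin d))

/-- The joint law of a list of `m` independent uniform unit vectors and, independently, a random
product code with `⌊log d⌋` blocks, size parameter `1 / p_α` and `N` rotations. -/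
def jointLaw (d m N : ℕ) (α : ℝ) :
    Measure ((Fin m → USphere (Fin d)) × RPCDesc d (Nat.log 2 d) (1 / pCap d α) N) :=
  (Measure.pi fun _ => unifSphere (Fin d)).prod (rpcLaw d (Nat.log 2 d) (1 / pCap d α) N)

/-- The event that both `|M₁(R)|` and `|M₁*(R)|` equal `m² V` up to a factor `2 ^ t`. -/
def sizeEvent (d m N : ℕ) (θ α t V : ℝ) :
    Set ((Fin m → USphere (Fin d)) × RPCDesc d (Nat.log 2 d) (1 / pCap d α) N) :=
  {ω | EqUpTo t ((M₁ (listSet ω.1) (rpcCode ω.2) θ α).ncard : ℝ) ((m : ℝ) ^ 2 * V) ∧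
    EqUpTo t ((M₁star (listSet ω.1) (rpcCode ω.2) θ α).ncard : ℝ) ((m : ℝ) ^ 2 * V)}

end Sieving

end

open Sieving

/-!
The proof computes the sizes of `M₁` and `M₁star` up to factors `2 ^ O(d / log d)`; such factors are
`2 ^ o(d)`.

*Volumes.* A set of unit vectors described by its inner products with two given vectors is a set
described by its projection to a plane. Its uniform measure is the share of the unit ball filled by
the cone over it, and this cone is compared with products of planar sets and balls of codimension
two: the measure is `(1 - r²) ^ (d / 2)`, where `r` is the least norm of a point of the plane that
satisfies the conditions (`prob_plane_norm_ge_le`, `prob_plane_near_ge`). So a cap has measure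
`p ≈ sin α ^ d` (`eventually_cap_bounds`). If `x` lies in the cap of a code vector `c`, a random
vector lies in this cap and at angle `≈ θ` from `x` with probability
`V₀ ≈ (1 - γ²) ^ (d / 2)` (`eventually_nearBoth_bounds`). If `cos² α ≤ cos θ`, then the point of the
wedge closest to the origin of the plane is its corner, so the wedge has the same measure
(`eventually_wedgeVol_bounds`), and the first claim follows from the second.

*The code.* Independent random sets of measure `q` cover a constant share of `min 1 (K q)` unless
an event of probability exponentially small in their number `K` occurs (`prob_cover_lt_le`). Applied
to the caps in each block, this gives a share `τ` of the sphere of the block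
(`eventually_block_cover`, `prob_block_bad_le`); since `K` grows faster than any multiple of `d`,
the failure probability is negligible. A vector whose blocks have nearly equal norms and covered
directions is matched by the product code, and such vectors form a share `τ ^ b` of the sphere up to
a quasi-polynomial factor (`prob_code_match_ge`), which is `2 ^ (- O(d / log d))`. The code has `J`
vectors with `J p ≤ 3 N`, so by Markov's inequality the vectors with more than `2 ^ (d / log d)`
matches are a smaller share (`prob_fewMatches_ge`). This is where the bound on `N` enters.

*The list.* For such a code, Chernoff bounds and a union bound show that a random list is typical,
`NiceList`, with overwhelming probability (`prob_not_niceList_le`): it has `2 ^ (- O(d / log d)) m`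
entries with at least one and at most `2 ^ (d / log d)` matches, `O(m p)` entries in each cap around
a code vector, and for each entry in such a cap about `m V₀` related entries in the same cap. The
hypothesis that `m V₀` is exponentially large makes all these expectations large. Counting, for a
typical list, gives at most `J * O(m p) * O(m V₀) = 2 ^ O(d / log d) m² V₀` pairs in `M₁`
(`NiceList.ncard_linkedPairs_le`), and at least `2 ^ (- O(d / log d)) m * Ω(m V₀)` pairs in `M₁star`
(`NiceList.le_ncard_linkedPairs`).
-/

namespace Sieving

/-! ### The uniform measure of a set and the volume of the cone over it -/

section uniformMeasure

open scoped Pointwise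

variable {ι : Type} [Fintype ι]

/-- The part of the cone over a subset `A` of the unit sphere with norms in `I`. -/
def conePart (I : Set ℝ) (A : Set (USphere ι)) : Set (EuclideanSpace ℝ ι) :=
  I • ((↑) '' A : Set (EuclideanSpace ℝ ι))

lemma mem_conePart {I : Set ℝ} {A : Set (USphere ι)} {y : EuclideanSpace ℝ ι} :
    y ∈ conePart I A ↔ ∃ t ∈ I, ∃ u ∈ A, t • (u : EuclideanSpace ℝ ι) = y := by
  simp [conePart, Set.mem_smul]

lemma conePart_mono {I J : Set ℝ} {A B : Set (USphere ι)} (hI : I ⊆ J) (hA : A ⊆ B) :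
    conePart I A ⊆ conePart J B :=
  Set.smul_subset_smul hI (Set.image_mono hA)

lemma norm_usphere (u : USphere ι) : ‖(u : EuclideanSpace ℝ ι)‖ = 1 := by
  simp

/-- Volume of the unit ball of the Euclidean space with coordinates indexed by `ι`. -/
noncomputable def ballVol (ι : Type) [Fintype ι] : ℝ :=
  (volume : Measure (EuclideanSpace ℝ ι)).real (Metric.ball 0 1)

lemma ballVol_pos : 0 < ballVol ι := by
  rw [ballVol, Measure.real, ENNReal.toReal_pos_iff]
  exact ⟨Metric.measure_ball_pos _ _ one_pos, measure_ball_lt_top⟩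

instance instIsProbabilityMeasureUnifSphere [Nonempty ι] : IsProbabilityMeasure (unifSphere ι) := by
  constructor
  rw [unifSphere, Measure.smul_apply, smul_eq_mul]
  apply ENNReal.inv_mul_cancel
  · rw [Ne, Measure.measure_univ_eq_zero]
    exact Measure.toSphere_ne_zero _
  · exact measure_ne_top _ _

/-- The uniform measure of `A` is the share of the unit ball filled by the cone over `A`. -/
lemma unifSphere_real_eq [Nonempty ι] {A : Set (USphere ι)} (hA : MeasurableSet A) :
    (unifSphere ι).real A = volume.real (conePart (Set.Ioo 0 1) A) / ballVol ι := by
  have hn : (Fintype.card ι : ℝ) ≠ 0 := by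
    exact_mod_cast Fintype.card_ne_zero
  have h2 := (ballVol_pos (ι := ι)).ne'
  rw [unifSphere, measureReal_ennreal_smul_apply, Measure.real, Measure.toSphere_apply' _ hA,
    Measure.toSphere_apply_univ]
  simp only [finrank_euclideanSpace, ENNReal.toReal_inv, ENNReal.toReal_mul,
    ENNReal.toReal_natCast]
  change ((Fintype.card ι : ℝ) * ballVol ι)⁻¹ *
    ((Fintype.card ι : ℝ) * volume.real (conePart (Set.Ioo 0 1) A)) = _
  field_simp

lemma conePart_Ioo_subset_ball (A : Set (USphere ι)) :
    conePart (Set.Ioo 0 1) A ⊆ Metric.ball 0 1 := by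
  intro y hy
  obtain ⟨t, ht, u, -, rfl⟩ := mem_conePart.mp hy
  simp [norm_smul, abs_of_pos ht.1, ht.2]

lemma conePart_Ioo_scale {r : ℝ} (hr : 0 < r) (A : Set (USphere ι)) :
    conePart (Set.Ioo 0 r) A = r • conePart (Set.Ioo 0 1) A := by
  ext y
  simp only [mem_conePart, Set.mem_smul_set]
  constructor
  · rintro ⟨t, ht, u, hu, rfl⟩
    refine ⟨(t / r) • (u : EuclideanSpace ℝ ι), ⟨t / r, ⟨div_pos ht.1 hr, ?_⟩, u, hu, rfl⟩, ?_⟩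
    · rw [div_lt_one hr]; exact ht.2
    · rw [smul_smul, mul_div_cancel₀ _ hr.ne']
  · rintro ⟨y, ⟨t, ht, u, hu, rfl⟩, rfl⟩
    refine ⟨r * t, ⟨mul_pos hr ht.1, ?_⟩, u, hu, by rw [smul_smul]⟩
    nlinarith [ht.2]

lemma volume_conePart_Ioo [Nonempty ι] {A : Set (USphere ι)} (hA : MeasurableSet A) {r : ℝ}
    (hr : 0 < r) :
    volume.real (conePart (Set.Ioo 0 r) A)
      = r ^ Fintype.card ι * ((unifSphere ι).real A * ballVol ι) := by
  rw [unifSphere_real_eq hA, div_mul_cancel₀ _ ballVol_pos.ne', conePart_Ioo_scale hr,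
    Measure.real, Measure.addHaar_smul, ENNReal.toReal_mul, ENNReal.toReal_ofReal (abs_nonneg _),
    finrank_euclideanSpace, abs_of_pos (pow_pos hr _)]
  rfl

lemma volume_conePart_Ioo_ne_top (A : Set (USphere ι)) (r : ℝ) :
    volume (conePart (Set.Ioo 0 r) A) ≠ ⊤ := by
  refine ne_top_of_le_ne_top (measure_ball_lt_top (μ := volume)
    (x := (0 : EuclideanSpace ℝ ι)) (r := max r 0)).ne (measure_mono ?_)
  intro y hy
  obtain ⟨t, ht, u, -, rfl⟩ := mem_conePart.mp hy
  simp [norm_smul, abs_of_pos ht.1, ht.2]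

/-- A lower bound for the volume of the part of a cone in a shell; it is an equality, of which only
this direction is needed. -/
lemma volume_conePart_Ico_ge [Nonempty ι] {A : Set (USphere ι)} (hA : MeasurableSet A) {r s : ℝ}
    (hr : 0 < r) (hrs : r < s) :
    (s ^ Fintype.card ι - r ^ Fintype.card ι) * ((unifSphere ι).real A * ballVol ι)
      ≤ volume.real (conePart (Set.Ico r s) A) := by
  have h1 : conePart (Set.Ioo 0 s) A ⊆ conePart (Set.Ioo 0 r) A ∪ conePart (Set.Ico r s) A := by
    rw [conePart, conePart, conePart, ← Set.union_smul]
    apply Set.smul_subset_smul_right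
    intro t ht
    rcases lt_or_ge t r with h | h
    · exact Or.inl ⟨ht.1, h⟩
    · exact Or.inr ⟨h, ht.2⟩
  have hfin : volume (conePart (Set.Ico r s) A) ≠ ⊤ := by
    refine ne_top_of_le_ne_top (volume_conePart_Ioo_ne_top A s) (measure_mono ?_)
    exact conePart_mono (fun t ht => ⟨hr.trans_le ht.1, ht.2⟩) le_rfl
  have h2 : volume.real (conePart (Set.Ioo 0 s) A)
      ≤ volume.real (conePart (Set.Ioo 0 r) A) + volume.real (conePart (Set.Ico r s) A) :=
    (measureReal_mono h1 (measure_union_ne_top (volume_conePart_Ioo_ne_top A r) hfin)).trans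
      (measureReal_union_le _ _)
  rw [volume_conePart_Ioo hA hr, volume_conePart_Ioo hA (hr.trans hrs)] at h2
  linarith

lemma ballVol_eq [Nonempty ι] :
    ballVol ι = Real.sqrt Real.pi ^ Fintype.card ι / Real.Gamma (Fintype.card ι / 2 + 1) := by
  have h : (0 : ℝ) < Fintype.card ι / 2 + 1 := by positivity
  rw [ballVol, Measure.real, EuclideanSpace.volume_ball, ENNReal.toReal_mul, ENNReal.toReal_ofReal
    (div_nonneg (by positivity) (Real.Gamma_pos_of_pos h).le)]
  simp

/-- The unit balls of dimensions `k` and `k + 2`: this ratio converts the volume of a product of a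
disc and a `k`-dimensional ball into a share of the `(k + 2)`-dimensional ball. -/
lemma ballVol_ratio {ι' : Type} [Fintype ι'] [Nonempty ι] [Nonempty ι']
    (h : Fintype.card ι = Fintype.card ι' + 2) :
    ballVol ι' / ballVol ι = (Fintype.card ι' + 2) / (2 * Real.pi) := by
  obtain ⟨k, hk'⟩ : ∃ k, Fintype.card ι' = k := ⟨_, rfl⟩
  rw [hk'] at h ⊢
  have hk : (0 : ℝ) < (k : ℝ) / 2 + 1 := by positivity
  have hG := (Real.Gamma_pos_of_pos hk).ne'
  have h2 : ((k + 2 : ℕ) : ℝ) / 2 + 1 = ((k : ℝ) / 2 + 1) + 1 := by push_cast; ring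
  rw [ballVol_eq, ballVol_eq, h, hk', h2, Real.Gamma_add_one hk.ne', pow_add,
    Real.sq_sqrt Real.pi_pos.le]
  have hs : Real.sqrt Real.pi ^ k ≠ 0 := by positivity
  have hp := Real.pi_pos.ne'
  have h3 : (k : ℝ) + 2 = 2 * ((k : ℝ) / 2 + 1) := by ring
  rw [h3]
  generalize (k : ℝ) / 2 + 1 = z at *
  have hz := hk.ne'
  field_simp

/-- A Stirling type upper bound for the Gamma function at positive integers and half-integers. -/
lemma Gamma_le_stirling (n : ℕ) (hn : 1 ≤ n) :
    Real.Gamma ((n : ℝ) / 2 + 1) ≤ 8 * (n : ℝ) * ((n : ℝ) / 2) ^ ((n : ℝ) / 2)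
      * Real.exp (-((n : ℝ) / 2)) := by
  induction n using Nat.strong_induction_on with
  | _ n ih =>
    rcases Nat.lt_or_ge 2 n with h | h
    · obtain ⟨k, rfl⟩ : ∃ k, n = k + 2 := ⟨n - 2, by omega⟩
      have hk : 1 ≤ k := by omega
      have ihk := ih k (by omega) hk
      set x : ℝ := (k : ℝ) / 2 with hx
      have hk' : (1 : ℝ) ≤ k := by exact_mod_cast hk
      have hx0 : 0 < x := by positivity
      have e1 : ((k + 2 : ℕ) : ℝ) / 2 = x + 1 := by push_cast; rw [hx]; ring
      have e2 : ((k + 2 : ℕ) : ℝ) = 2 * (x + 1) := by push_cast; rw [hx]; ring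
      have e3 : (k : ℝ) = 2 * x := by rw [hx]; ring
      rw [e1, e2, Real.Gamma_add_one (by positivity)]
      rw [e3] at ihk
      -- `e ≤ (1 + 1 / x) ^ (x + 1)`
      have key : Real.exp 1 * x ^ (x + 1) ≤ (x + 1) ^ (x + 1) := by
        have h1 : 1 ≤ (x + 1) * Real.log ((x + 1) / x) := by
          have h2 := Real.one_sub_inv_le_log_of_pos (show 0 < (x + 1) / x by positivity)
          have h3 : 1 - ((x + 1) / x)⁻¹ = 1 / (x + 1) := by field_simp; ring
          rw [h3, div_le_iff₀ (by positivity)] at h2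
          linarith
        rw [Real.log_div (by positivity) (by positivity)] at h1
        rw [Real.rpow_def_of_pos hx0, Real.rpow_def_of_pos (by positivity), ← Real.exp_add]
        apply Real.exp_le_exp.mpr
        linarith
      have e4 : x ^ (x + 1) = x * x ^ x := by rw [Real.rpow_add_one hx0.ne']; ring
      rw [e4] at key
      have e5 : Real.exp (-(x + 1)) * Real.exp 1 = Real.exp (-x) := by
        rw [← Real.exp_add]; congr 1; ring
      calc (x + 1) * Real.Gamma (x + 1)
          ≤ (x + 1) * (8 * (2 * x) * x ^ x * Real.exp (-x)) := by gcongr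
        _ = 8 * (2 * (x + 1)) * (Real.exp 1 * (x * x ^ x)) * Real.exp (-(x + 1)) := by
          rw [← e5]; ring
        _ ≤ _ := by gcongr
    · have hhalf : Real.Gamma (1 / 2 + 1) ≤ 1 := by
        rw [Real.Gamma_add_one (by norm_num), Real.Gamma_one_half_eq]
        have : Real.sqrt Real.pi ≤ 2 := by
          rw [Real.sqrt_le_left (by norm_num)]
          linarith [Real.pi_le_four]
        linarith
      have he : Real.exp (1 / 2) ≤ 2 := by
        have h1 : Real.exp (1 / 2) ≤ Real.exp (1 / 2) ^ 2 / 2 + 1 / 2 := by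
          nlinarith [sq_nonneg (Real.exp (1 / 2) - 1)]
        rw [← Real.exp_nat_mul] at h1
        norm_num at h1
        linarith [Real.exp_one_lt_d9]
      have he2 : (1 / 2 : ℝ) ≤ Real.exp (-(1 / 2)) := by
        rw [Real.exp_neg, ← one_div]
        exact one_div_le_one_div_of_le (Real.exp_pos _) he
      have he3 : (1 / 4 : ℝ) ≤ Real.exp (-1) := by
        rw [Real.exp_neg, ← one_div]
        exact one_div_le_one_div_of_le (Real.exp_pos _) (by linarith [Real.exp_one_lt_d9])
      interval_cases n
      · have hs : (1 / 2 : ℝ) ≤ (1 / 2 : ℝ) ^ (1 / 2 : ℝ) := by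
          conv_lhs => rw [← Real.rpow_one (1 / 2 : ℝ)]
          exact Real.rpow_le_rpow_of_exponent_ge (by norm_num) (by norm_num) (by norm_num)
        push_cast
        nlinarith [hhalf, he2, hs]
      · norm_num
        norm_num [Real.Gamma_two] at *
        linarith

/-- Stirling type lower bound for the volume of the unit ball, sharp up to the factor `8 n`. -/
lemma ballVol_ge [Nonempty ι] :
    (2 * Real.pi * Real.exp 1 / Fintype.card ι) ^ ((Fintype.card ι : ℝ) / 2)
      / (8 * Fintype.card ι) ≤ ballVol ι := by
  have hn : 1 ≤ Fintype.card ι := Fintype.card_pos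
  set n := Fintype.card ι with hn'
  have hn0 : (0 : ℝ) < n := by exact_mod_cast hn
  have hG := Gamma_le_stirling n hn
  have hG0 : 0 < Real.Gamma ((n : ℝ) / 2 + 1) := Real.Gamma_pos_of_pos (by positivity)
  rw [ballVol_eq, ← hn', div_le_div_iff₀ (by positivity) hG0]
  have e1 : Real.sqrt Real.pi ^ n = Real.pi ^ ((n : ℝ) / 2) := by
    rw [Real.sqrt_eq_rpow, ← Real.rpow_natCast, ← Real.rpow_mul Real.pi_pos.le]
    congr 1; ring
  have e2 : (2 * Real.pi * Real.exp 1 / (n : ℝ)) ^ ((n : ℝ) / 2) * (((n : ℝ) / 2) ^ ((n : ℝ) / 2)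
      * Real.exp (-((n : ℝ) / 2))) = Real.pi ^ ((n : ℝ) / 2) := by
    have : Real.exp (-((n : ℝ) / 2)) = (Real.exp (-1)) ^ ((n : ℝ) / 2) := by
      rw [← Real.exp_mul]; congr 1; ring
    rw [this, ← Real.mul_rpow (by positivity) (by positivity),
      ← Real.mul_rpow (by positivity) (by positivity)]
    congr 1
    rw [Real.exp_neg]
    have := (Real.exp_pos 1).ne'
    field_simp
  calc _ ≤ (2 * Real.pi * Real.exp 1 / (n : ℝ)) ^ ((n : ℝ) / 2) * (8 * (n : ℝ) *
        ((n : ℝ) / 2) ^ ((n : ℝ) / 2) * Real.exp (-((n : ℝ) / 2))) := by gcongr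
    _ = (8 * n) * ((2 * Real.pi * Real.exp 1 / (n : ℝ)) ^ ((n : ℝ) / 2) *
        (((n : ℝ) / 2) ^ ((n : ℝ) / 2) * Real.exp (-((n : ℝ) / 2)))) := by ring
    _ = _ := by rw [e2, e1]; ring

/-- A Stirling type lower bound for the Gamma function at positive integers and half-integers. -/
lemma stirling_le_Gamma (n : ℕ) (hn : 1 ≤ n) :
    ((n : ℝ) / 2) ^ ((n : ℝ) / 2) * Real.exp (-((n : ℝ) / 2)) ≤ Real.Gamma ((n : ℝ) / 2 + 1) := by
  induction n using Nat.strong_induction_on with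
  | _ n ih =>
    rcases Nat.lt_or_ge 2 n with h | h
    · obtain ⟨k, rfl⟩ : ∃ k, n = k + 2 := ⟨n - 2, by omega⟩
      have hk : 1 ≤ k := by omega
      have ihk := ih k (by omega) hk
      set x : ℝ := (k : ℝ) / 2 with hx
      have hk' : (1 : ℝ) ≤ k := by exact_mod_cast hk
      have hx0 : 0 < x := by positivity
      have e1 : ((k + 2 : ℕ) : ℝ) / 2 = x + 1 := by push_cast; rw [hx]; ring
      rw [e1, Real.Gamma_add_one (by positivity)]
      -- `(1 + 1 / x) ^ x ≤ e`
      have key : (x + 1) ^ x ≤ Real.exp 1 * x ^ x := by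
        have h1 : x * Real.log ((x + 1) / x) ≤ 1 := by
          have h2 := Real.log_le_sub_one_of_pos (show 0 < (x + 1) / x by positivity)
          have h3 : (x + 1) / x - 1 = 1 / x := by field_simp; ring
          rw [h3, le_div_iff₀ hx0] at h2
          linarith
        rw [Real.log_div (by positivity) (by positivity)] at h1
        rw [Real.rpow_def_of_pos hx0, Real.rpow_def_of_pos (by positivity), ← Real.exp_add]
        apply Real.exp_le_exp.mpr
        linarith
      have e4 : (x + 1) ^ (x + 1) = (x + 1) * (x + 1) ^ x := by
        rw [Real.rpow_add_one (by positivity)]; ring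
      have e5 : Real.exp (-(x + 1)) * Real.exp 1 = Real.exp (-x) := by
        rw [← Real.exp_add]; congr 1; ring
      rw [e4]
      calc (x + 1) * (x + 1) ^ x * Real.exp (-(x + 1))
          ≤ (x + 1) * (Real.exp 1 * x ^ x) * Real.exp (-(x + 1)) := by gcongr
        _ = (x + 1) * (x ^ x * Real.exp (-x)) := by rw [← e5]; ring
        _ ≤ _ := by gcongr
    · have hhalf : (1 / 2 : ℝ) ≤ Real.Gamma (1 / 2 + 1) := by
        rw [Real.Gamma_add_one (by norm_num), Real.Gamma_one_half_eq]
        have : 1 ≤ Real.sqrt Real.pi := by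
          rw [Real.one_le_sqrt]
          linarith [Real.pi_gt_three]
        linarith
      -- `√(1/2) * exp (-1/2) ≤ 1/2` since `1 / (2 e) ≤ 1 / 4`
      have h3 : (1 / 2 : ℝ) ^ (1 / 2 : ℝ) * Real.exp (-(1 / 2)) ≤ 1 / 2 := by
        have e1 : Real.exp (-(1 / 2)) = (Real.exp (-1)) ^ (1 / 2 : ℝ) := by
          rw [← Real.exp_mul]; congr 1; ring
        rw [e1, ← Real.mul_rpow (by norm_num) (by positivity), ← Real.sqrt_eq_rpow,
          Real.sqrt_le_left (by norm_num), Real.exp_neg]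
        have : (Real.exp 1)⁻¹ ≤ 1 / 2 := by
          rw [← one_div]
          exact one_div_le_one_div_of_le (by norm_num) (by linarith [Real.exp_one_gt_d9])
        linarith
      interval_cases n
      · push_cast
        exact h3.trans hhalf
      · norm_num [Real.Gamma_two]

/-- Stirling type upper bound for the volume of the unit ball. -/
lemma ballVol_le [Nonempty ι] :
    ballVol ι ≤ (2 * Real.pi * Real.exp 1 / Fintype.card ι) ^ ((Fintype.card ι : ℝ) / 2) := by
  have hn : 1 ≤ Fintype.card ι := Fintype.card_pos
  obtain ⟨n, hn'⟩ : ∃ n, Fintype.card ι = n := ⟨_, rfl⟩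
  rw [ballVol_eq]
  rw [hn'] at hn ⊢
  have hn0 : (0 : ℝ) < n := by exact_mod_cast hn
  have hG := stirling_le_Gamma n hn
  have hG0 : 0 < Real.Gamma ((n : ℝ) / 2 + 1) := Real.Gamma_pos_of_pos (by positivity)
  rw [div_le_iff₀ hG0]
  have e1 : Real.sqrt Real.pi ^ n = Real.pi ^ ((n : ℝ) / 2) := by
    rw [Real.sqrt_eq_rpow, ← Real.rpow_natCast, ← Real.rpow_mul Real.pi_pos.le]
    congr 1; ring
  have e2 : (2 * Real.pi * Real.exp 1 / (n : ℝ)) ^ ((n : ℝ) / 2) * (((n : ℝ) / 2) ^ ((n : ℝ) / 2)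
      * Real.exp (-((n : ℝ) / 2))) = Real.pi ^ ((n : ℝ) / 2) := by
    have : Real.exp (-((n : ℝ) / 2)) = (Real.exp (-1)) ^ ((n : ℝ) / 2) := by
      rw [← Real.exp_mul]; congr 1; ring
    rw [this, ← Real.mul_rpow (by positivity) (by positivity),
      ← Real.mul_rpow (by positivity) (by positivity)]
    congr 1
    rw [Real.exp_neg]
    have := (Real.exp_pos 1).ne'
    field_simp
  rw [e1, ← e2]
  gcongr

end uniformMeasure

/-! ### Invariance under isometries -/

section isometry

variable {ι : Type} [Fintype ι]

/-- Membership in the cone over the trace of `A` on the sphere, tested on the normalised vector. -/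
lemma mem_conePart_Ioo_of_norm {A : Set (EuclideanSpace ℝ ι)} {y : EuclideanSpace ℝ ι} (h0 : y ≠ 0)
    (h1 : ‖y‖ < 1) (hA : ‖y‖⁻¹ • y ∈ A) :
    y ∈ conePart (Set.Ioo 0 1) {u : USphere ι | (u : EuclideanSpace ℝ ι) ∈ A} := by
  have hy : ‖y‖ ≠ 0 := norm_ne_zero_iff.mpr h0
  refine mem_conePart.mpr ⟨‖y‖, ⟨norm_pos_iff.mpr h0, h1⟩, ⟨‖y‖⁻¹ • y, ?_⟩, hA, ?_⟩
  · simp [norm_smul, hy]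
  · simp [smul_smul, hy]

/-- Linear isometries preserve the uniform measures on spheres. -/
lemma unifSphere_real_isometry {ι' : Type} [Fintype ι'] [Nonempty ι] [Nonempty ι']
    (g : EuclideanSpace ℝ ι ≃ₗᵢ[ℝ] EuclideanSpace ℝ ι') {A : Set (EuclideanSpace ℝ ι')}
    (hA : MeasurableSet A) :
    (unifSphere ι).real {u | g (u : EuclideanSpace ℝ ι) ∈ A}
      = (unifSphere ι').real {u | (u : EuclideanSpace ℝ ι') ∈ A} := by
  have hg : Measurable g := g.continuous.measurable
  have hmp : MeasurePreserving (g : EuclideanSpace ℝ ι → EuclideanSpace ℝ ι') :=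
    g.measurePreserving
  have hm' : MeasurableSet {u : USphere ι' | (u : EuclideanSpace ℝ ι') ∈ A} :=
    measurable_subtype_coe hA
  have hm'' : MeasurableSet {u : USphere ι | g (u : EuclideanSpace ℝ ι) ∈ A} :=
    (hg.comp measurable_subtype_coe) hA
  rw [unifSphere_real_eq hm',
    unifSphere_real_eq hm'']
  have hb : ballVol ι = ballVol ι' := by
    rw [ballVol, ballVol, Measure.real, Measure.real,
      ← hmp.measure_preimage Metric.isOpen_ball.measurableSet.nullMeasurableSet]
    congr 2
    ext y
    simp
  have hme : MeasurableEmbedding (g : EuclideanSpace ℝ ι → EuclideanSpace ℝ ι') :=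
    g.toHomeomorph.measurableEmbedding
  rw [hb, Measure.real, Measure.real, ← hmp.measure_preimage_emb hme]
  congr 3
  ext y
  simp only [Set.mem_preimage, mem_conePart]
  constructor
  · rintro ⟨t, ht, u, hu, rfl⟩
    exact ⟨t, ht, ⟨g u, by simp⟩, hu, by simp⟩
  · rintro ⟨t, ht, u, hu, h⟩
    refine ⟨t, ht, ⟨g.symm u, by simp⟩, by simpa using hu, ?_⟩
    rw [← map_smul, h, LinearIsometryEquiv.symm_apply_apply]

lemma exists_isometry_map_unit [Nonempty ι] (e e' : USphere ι) :
    ∃ g : EuclideanSpace ℝ ι ≃ₗᵢ[ℝ] EuclideanSpace ℝ ι,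
      g (e : EuclideanSpace ℝ ι) = e' := by
  classical
  obtain ⟨i⟩ := ‹Nonempty ι›
  have key : ∀ e : USphere ι, ∃ b : OrthonormalBasis ι ℝ (EuclideanSpace ℝ ι), b i = e := by
    intro e
    have hv : Orthonormal ℝ (({i} : Set ι).domRestrict fun _ => (e : EuclideanSpace ℝ ι)) := by
      constructor
      · intro j; exact norm_usphere e
      · intro j k hjk
        exact absurd (Subsingleton.elim j k) hjk
    obtain ⟨b, hb⟩ := hv.exists_orthonormalBasis_extension_of_card_eq (by simp)
    exact ⟨b, hb i rfl⟩
  obtain ⟨b, hb⟩ := key e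
  obtain ⟨b', hb'⟩ := key e'
  refine ⟨b.equiv b' (Equiv.refl ι), ?_⟩
  rw [← hb, OrthonormalBasis.equiv_apply_basis, Equiv.refl_apply, hb']

/-- The distribution of the inner product with a unit vector does not depend on that vector. -/
lemma unifSphere_real_inner_eq [Nonempty ι] (e e' : USphere ι) {T : Set ℝ} (hT : MeasurableSet T) :
    (unifSphere ι).real {u | inner ℝ (e : EuclideanSpace ℝ ι) (u : EuclideanSpace ℝ ι) ∈ T}
      = (unifSphere ι).real
        {u | inner ℝ (e' : EuclideanSpace ℝ ι) (u : EuclideanSpace ℝ ι) ∈ T} := by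
  obtain ⟨g, hg⟩ := exists_isometry_map_unit e e'
  have hm : MeasurableSet {y : EuclideanSpace ℝ ι | inner ℝ (e' : EuclideanSpace ℝ ι) y ∈ T} :=
    (by fun_prop : Measurable fun y : EuclideanSpace ℝ ι =>
      inner ℝ (e' : EuclideanSpace ℝ ι) y) hT
  have h := unifSphere_real_isometry g hm
  simp only [Set.mem_ofPred_eq] at h
  rw [← h]
  congr 1
  ext u
  rw [Set.mem_ofPred_eq, Set.mem_ofPred_eq, ← hg, LinearIsometryEquiv.inner_map_map]

end isometry

/-! ### Projections of a random unit vector to a plane -/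

section plane

open scoped Pointwise

variable {ι : Type} [Fintype ι] {k : ℕ}

/-- Splitting off the plane spanned by an orthonormal pair. -/
lemma exists_plane_splitting (hk : Fintype.card ι = k + 2) {e₀ e₁ : EuclideanSpace ℝ ι}
    (h0 : ‖e₀‖ = 1) (h1 : ‖e₁‖ = 1) (h01 : inner ℝ e₀ e₁ = 0) :
    ∃ Φ : EuclideanSpace ℝ ι ≃ₗᵢ[ℝ]
        WithLp 2 (EuclideanSpace ℝ (Fin 2) × EuclideanSpace ℝ (Fin k)),
      ∀ y, (Φ y).fst 0 = inner ℝ e₀ y ∧ (Φ y).fst 1 = inner ℝ e₁ y := by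
  classical
  let v : Fin 2 ⊕ Fin k → EuclideanSpace ℝ ι := Sum.elim ![e₀, e₁] fun _ => 0
  have hv : Orthonormal ℝ ((Set.range Sum.inl : Set (Fin 2 ⊕ Fin k)).domRestrict v) := by
    constructor
    · rintro ⟨_, i, rfl⟩
      fin_cases i
      · exact h0
      · exact h1
    · rintro ⟨_, i, rfl⟩ ⟨_, j, rfl⟩ hij
      have h10 : inner ℝ e₁ e₀ = 0 := by rw [real_inner_comm]; exact h01
      fin_cases i <;> fin_cases j
      · exact absurd rfl hij
      · exact h01
      · exact h10
      · exact absurd rfl hij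
  obtain ⟨b, hb⟩ := hv.exists_orthonormalBasis_extension_of_card_eq
    (by simp [hk, add_comm])
  let B := (EuclideanSpace.basisFun (Fin 2) ℝ).prod (EuclideanSpace.basisFun (Fin k) ℝ)
  refine ⟨b.equiv B (Equiv.refl _), fun y => ?_⟩
  have key : ∀ i : Fin 2, (b.equiv B (Equiv.refl _) y).fst i = inner ℝ (v (Sum.inl i)) y := by
    intro i
    rw [← hb (Sum.inl i) ⟨i, rfl⟩,
      ← LinearIsometryEquiv.inner_map_map (b.equiv B (Equiv.refl _)),
      OrthonormalBasis.equiv_apply_basis, Equiv.refl_apply]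
    simp [B, OrthonormalBasis.prod_apply, WithLp.prod_inner_apply, EuclideanSpace.inner_single_left]
  exact ⟨key 0, key 1⟩

/-- The splitting `Φ` turns volume into the product of the volumes of the two factors. -/
lemma volume_preimage_splitting (Φ : EuclideanSpace ℝ ι ≃ₗᵢ[ℝ]
        WithLp 2 (EuclideanSpace ℝ (Fin 2) × EuclideanSpace ℝ (Fin k)))
    {S : Set (EuclideanSpace ℝ (Fin 2))} {T : Set (EuclideanSpace ℝ (Fin k))}
    (hS : MeasurableSet S) (hT : MeasurableSet T) :
    volume.real {y | (Φ y).fst ∈ S ∧ (Φ y).snd ∈ T} = volume.real S * volume.real T := by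
  have h1 : MeasurePreserving (fun y => WithLp.ofLp (Φ y)) :=
    (WithLp.volume_preserving_ofLp _ _).comp Φ.measurePreserving
  have h2 := h1.measure_preimage (hS.prod hT).nullMeasurableSet
  rw [Measure.volume_eq_prod, Measure.prod_prod] at h2
  rw [Measure.real, Measure.real, Measure.real, ← ENNReal.toReal_mul, ← h2]
  rfl

lemma norm_sq_splitting (Φ : EuclideanSpace ℝ ι ≃ₗᵢ[ℝ]
        WithLp 2 (EuclideanSpace ℝ (Fin 2) × EuclideanSpace ℝ (Fin k)))
    (y : EuclideanSpace ℝ ι) : ‖y‖ ^ 2 = ‖(Φ y).fst‖ ^ 2 + ‖(Φ y).snd‖ ^ 2 := by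
  rw [← Φ.norm_map y, WithLp.prod_norm_sq_eq_of_L2]

lemma norm_sq_fin_two (z : EuclideanSpace ℝ (Fin 2)) : ‖z‖ ^ 2 = z 0 ^ 2 + z 1 ^ 2 := by
  rw [EuclideanSpace.norm_sq_eq, Fin.sum_univ_two]
  simp

/-- The projection of a uniform unit vector to a plane is rarely long: the cone over the vectors
with long projection is contained in the product of a disc and a ball of radius `√(1 - s)`. -/
lemma prob_plane_norm_ge_le (hk : Fintype.card ι = k + 2) (hk0 : 0 < k) {e₀ e₁ : EuclideanSpace ℝ ι}
    (h0 : ‖e₀‖ = 1) (h1 : ‖e₁‖ = 1) (h01 : inner ℝ e₀ e₁ = 0) (s : ℝ) :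
    (unifSphere ι).real {u | s ≤ inner ℝ e₀ (u : EuclideanSpace ℝ ι) ^ 2
        + inner ℝ e₁ (u : EuclideanSpace ℝ ι) ^ 2}
      ≤ (k + 2) / 2 * Real.sqrt (1 - s) ^ k := by
  have : Nonempty ι := Fintype.card_pos_iff.mp (by omega)
  have : Nonempty (Fin k) := ⟨⟨0, hk0⟩⟩
  obtain ⟨Φ, hΦ⟩ := exists_plane_splitting hk h0 h1 h01
  have hm : MeasurableSet {u : USphere ι | s ≤ inner ℝ e₀ (u : EuclideanSpace ℝ ι) ^ 2
        + inner ℝ e₁ (u : EuclideanSpace ℝ ι) ^ 2} :=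
    measurableSet_le measurable_const (by fun_prop)
  rw [unifSphere_real_eq hm]
  set A := {u : USphere ι | s ≤ inner ℝ e₀ (u : EuclideanSpace ℝ ι) ^ 2
        + inner ℝ e₁ (u : EuclideanSpace ℝ ι) ^ 2}
  -- the norm of `y` is below `1` and at least a share `s` of `‖y‖²` lies in the plane
  have hsub : conePart (Set.Ioo 0 1) A ⊆ {y | (Φ y).fst ∈ Metric.ball 0 1 ∧
      (Φ y).snd ∈ Metric.closedBall 0 (Real.sqrt (1 - s))} := by
    intro y hy
    obtain ⟨t, ht, u, hu, rfl⟩ := mem_conePart.mp hy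
    have hsq := norm_sq_splitting Φ (u : EuclideanSpace ℝ ι)
    rw [norm_usphere, one_pow] at hsq
    have hf : s ≤ ‖(Φ u).fst‖ ^ 2 := by
      rw [norm_sq_fin_two, (hΦ _).1, (hΦ _).2]; exact hu
    have hf1 : ‖(Φ u).fst‖ ≤ 1 := by
      rw [← sq_le_one_iff₀ (norm_nonneg _)]; nlinarith [sq_nonneg ‖(Φ u).snd‖]
    have hs1 : ‖(Φ u).snd‖ ≤ Real.sqrt (1 - s) := by
      apply Real.le_sqrt_of_sq_le; linarith
    constructor
    · rw [map_smul, mem_ball_zero_iff, WithLp.smul_fst, norm_smul, Real.norm_eq_abs,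
        abs_of_pos ht.1]
      nlinarith [ht.1, ht.2, norm_nonneg (Φ u).fst]
    · rw [map_smul, mem_closedBall_zero_iff, WithLp.smul_snd, norm_smul, Real.norm_eq_abs,
        abs_of_pos ht.1]
      nlinarith [ht.1, ht.2, norm_nonneg (Φ u).snd]
  have hvol := volume_preimage_splitting Φ (S := Metric.ball 0 1)
    (T := Metric.closedBall 0 (Real.sqrt (1 - s))) Metric.isOpen_ball.measurableSet
    Metric.isClosed_closedBall.measurableSet
  have hB : volume.real (Metric.closedBall (0 : EuclideanSpace ℝ (Fin k)) (Real.sqrt (1 - s)))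
      = Real.sqrt (1 - s) ^ k * ballVol (Fin k) := by
    rw [Measure.real, Measure.addHaar_closedBall _ _ (Real.sqrt_nonneg _), ENNReal.toReal_mul,
      ENNReal.toReal_ofReal (by positivity), finrank_euclideanSpace, Fintype.card_fin]
    rfl
  have hD : volume.real (Metric.ball (0 : EuclideanSpace ℝ (Fin 2)) 1) = Real.pi := by
    rw [Measure.real, EuclideanSpace.volume_ball_fin_two]
    simp [Real.pi_pos.le]
  rw [hB, hD] at hvol
  have hfin : volume {y | (Φ y).fst ∈ Metric.ball 0 1 ∧
      (Φ y).snd ∈ Metric.closedBall 0 (Real.sqrt (1 - s))} ≠ ⊤ := by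
    refine ne_top_of_le_ne_top (measure_ball_lt_top (μ := volume)
      (x := (0 : EuclideanSpace ℝ ι)) (r := 1 + Real.sqrt (1 - s) + 1)).ne (measure_mono ?_)
    rintro y ⟨hy1, hy2⟩
    rw [mem_ball_zero_iff] at hy1 ⊢
    rw [mem_closedBall_zero_iff] at hy2
    have := norm_sq_splitting Φ y
    nlinarith [norm_nonneg (Φ y).fst, norm_nonneg (Φ y).snd, norm_nonneg y]
  have hle := measureReal_mono hsub hfin
  rw [hvol] at hle
  have hr := ballVol_ratio (ι := ι) (ι' := Fin k) (by simpa using hk)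
  rw [Fintype.card_fin] at hr
  calc _ ≤ Real.pi * (Real.sqrt (1 - s) ^ k * ballVol (Fin k)) / ballVol ι := by
        gcongr; exact ballVol_pos.le
    _ = Real.pi * Real.sqrt (1 - s) ^ k * (ballVol (Fin k) / ballVol ι) := by ring
    _ = _ := by rw [hr]; have := Real.pi_pos.ne'; field_simp

/-- Normalising a vector of norm close to one hardly changes its inner products. -/
lemma abs_inner_normalize_sub_le {e y : EuclideanSpace ℝ ι} (he : ‖e‖ = 1) (hy0 : 0 < ‖y‖)
    (hy1 : ‖y‖ ≤ 1) : |inner ℝ e (‖y‖⁻¹ • y) - inner ℝ e y| ≤ 1 - ‖y‖ := by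
  have hw : |inner ℝ e (‖y‖⁻¹ • y)| ≤ 1 := by
    have h1 := abs_real_inner_le_norm e (‖y‖⁻¹ • y)
    rwa [he, one_mul, norm_smul, norm_inv, norm_norm, inv_mul_cancel₀ hy0.ne'] at h1
  have hi : inner ℝ e y = ‖y‖ * inner ℝ e (‖y‖⁻¹ • y) := by
    rw [inner_smul_right, ← mul_assoc, mul_inv_cancel₀ hy0.ne', one_mul]
  have e1 : inner ℝ e (‖y‖⁻¹ • y) - inner ℝ e y = (1 - ‖y‖) * inner ℝ e (‖y‖⁻¹ • y) := by
    rw [hi]; ring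
  rw [e1, abs_mul, abs_of_nonneg (by linarith)]
  exact mul_le_of_le_one_right (by linarith) hw

lemma measurableSet_planeBox (e₀ e₁ : EuclideanSpace ℝ ι) (a b δ : ℝ) :
    MeasurableSet {u : USphere ι | |inner ℝ e₀ (u : EuclideanSpace ℝ ι) - a| ≤ δ ∧
        |inner ℝ e₁ (u : EuclideanSpace ℝ ι) - b| ≤ δ} := by
  apply MeasurableSet.inter
  · exact measurableSet_le (f := fun u : USphere ι =>
      |inner ℝ e₀ (u : EuclideanSpace ℝ ι) - a|) (by fun_prop) measurable_const
  · exact measurableSet_le (f := fun u : USphere ι =>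
      |inner ℝ e₁ (u : EuclideanSpace ℝ ι) - b|) (by fun_prop) measurable_const

/-- The geometric inclusion behind the lower bound: a vector whose plane part is close to `ρ z₀` and
whose orthogonal part has norm close to `ρ s₀`, where `‖z₀‖² + s₀² = 1`, has norm just below `1`,
and its normalisation projects to a point near `z₀ = (a, b)`. -/
lemma product_subset_conePart (Φ : EuclideanSpace ℝ ι ≃ₗᵢ[ℝ]
        WithLp 2 (EuclideanSpace ℝ (Fin 2) × EuclideanSpace ℝ (Fin k)))
    {e₀ e₁ : EuclideanSpace ℝ ι} (h0 : ‖e₀‖ = 1) (h1 : ‖e₁‖ = 1)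
    (hΦ : ∀ y, (Φ y).fst 0 = inner ℝ e₀ y ∧ (Φ y).fst 1 = inner ℝ e₁ y)
    {a b s₀ δ' ρ : ℝ} {z₀ : EuclideanSpace ℝ (Fin 2)} (hza : z₀ 0 = a) (hzb : z₀ 1 = b)
    (hs0 : 0 ≤ s₀) (hz0 : ‖z₀‖ ^ 2 + s₀ ^ 2 = 1) (hδ'0 : 0 < δ') (hδ'1 : δ' ≤ 1 / 8)
    (hρ : ρ = 1 - 2 * δ') :
    {y | (Φ y).fst ∈ Metric.ball (ρ • z₀) δ' ∧
      (Φ y).snd ∈ Metric.ball 0 (ρ * s₀) \ Metric.ball 0 ((1 - δ') * (ρ * s₀))} ⊆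
    conePart (Set.Ioo 0 1) {u : USphere ι | |inner ℝ e₀ (u : EuclideanSpace ℝ ι) - a| ≤ 8 * δ' ∧
        |inner ℝ e₁ (u : EuclideanSpace ℝ ι) - b| ≤ 8 * δ'} := by
  have hρ0 : 0 < ρ := by linarith
  rintro y ⟨hyS, hyT, hyT'⟩
  rw [mem_ball_zero_iff] at hyT
  rw [mem_ball_zero_iff, not_lt] at hyT'
  rw [mem_ball_iff_norm] at hyS
  have hsq := norm_sq_splitting Φ y
  have hz1 : ‖(Φ y).fst‖ < ρ * ‖z₀‖ + δ' := by
    have := norm_sub_norm_le (Φ y).fst (ρ • z₀)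
    rw [norm_smul, Real.norm_eq_abs, abs_of_pos hρ0] at this
    linarith
  have hz2 : ρ * ‖z₀‖ - δ' < ‖(Φ y).fst‖ := by
    have := norm_sub_norm_le (ρ • z₀) (Φ y).fst
    rw [norm_smul, Real.norm_eq_abs, abs_of_pos hρ0, norm_sub_rev] at this
    linarith
  have hn0 : ‖z₀‖ ≤ 1 := by
    rw [← sq_le_one_iff₀ (norm_nonneg _)]; nlinarith
  have hs1 : s₀ ≤ 1 := by
    rw [← sq_le_one_iff₀ hs0]; nlinarith [norm_nonneg z₀]
  have hy1 : ‖y‖ < 1 := by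
    have : ‖y‖ ^ 2 < (ρ + δ') ^ 2 := by
      rw [hsq]
      have i1 : ‖(Φ y).fst‖ ^ 2 ≤ (ρ * ‖z₀‖ + δ') ^ 2 :=
        pow_le_pow_left₀ (norm_nonneg _) hz1.le 2
      have i2 : ‖(Φ y).snd‖ ^ 2 < (ρ * s₀) ^ 2 :=
        pow_lt_pow_left₀ hyT (norm_nonneg _) two_ne_zero
      have i3 : ρ * δ' * ‖z₀‖ ≤ ρ * δ' := mul_le_of_le_one_right (by positivity) hn0
      have i4 : ρ ^ 2 * ‖z₀‖ ^ 2 + ρ ^ 2 * s₀ ^ 2 = ρ ^ 2 := by rw [← mul_add, hz0, mul_one]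
      nlinarith
    have := lt_of_pow_lt_pow_left₀ 2 (by positivity) this
    linarith
  have hy2 : 1 - 4 * δ' ≤ ‖y‖ := by
    -- Cauchy-Schwarz with the unit vector `(‖z₀‖, s₀)`
    have i1 : ‖z₀‖ * ‖(Φ y).fst‖ + s₀ * ‖(Φ y).snd‖ ≤ ‖y‖ := by
      rw [← sq_le_sq₀ (by positivity) (norm_nonneg _)]
      rw [hsq]
      have i0 : (‖z₀‖ * ‖(Φ y).fst‖ + s₀ * ‖(Φ y).snd‖) ^ 2
          + (‖z₀‖ * ‖(Φ y).snd‖ - s₀ * ‖(Φ y).fst‖) ^ 2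
          = (‖z₀‖ ^ 2 + s₀ ^ 2) * (‖(Φ y).fst‖ ^ 2 + ‖(Φ y).snd‖ ^ 2) := by ring
      rw [hz0, one_mul] at i0
      nlinarith [sq_nonneg (‖z₀‖ * ‖(Φ y).snd‖ - s₀ * ‖(Φ y).fst‖)]
    have i2 : ‖z₀‖ * (ρ * ‖z₀‖ - δ') ≤ ‖z₀‖ * ‖(Φ y).fst‖ := by gcongr
    have i3 : s₀ * ((1 - δ') * (ρ * s₀)) ≤ s₀ * ‖(Φ y).snd‖ := by gcongr
    have i4 : ρ * ‖z₀‖ ^ 2 + ρ * s₀ ^ 2 = ρ := by rw [← mul_add, hz0, mul_one]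
    have i5 : δ' * ‖z₀‖ ≤ δ' := mul_le_of_le_one_right hδ'0.le hn0
    have i6 : δ' * ρ * s₀ ^ 2 ≤ δ' * 1 := by
      rw [mul_assoc]
      apply mul_le_mul_of_nonneg_left _ hδ'0.le
      have : s₀ ^ 2 ≤ 1 := pow_le_one₀ hs0 hs1
      nlinarith
    nlinarith
  have hy0 : 0 < ‖y‖ := by linarith
  have hcoord : ∀ i : Fin 2, |(Φ y).fst i - ρ * z₀ i| ≤ δ' := fun i =>
    (PiLp.norm_apply_le ((Φ y).fst - ρ • z₀) i).trans hyS.le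
  -- normalising `y` moves the projection by at most `7 δ'`
  have key : ∀ (e : EuclideanSpace ℝ ι) (i : Fin 2), ‖e‖ = 1 →
      |inner ℝ e y - ρ * z₀ i| ≤ δ' → |inner ℝ e (‖y‖⁻¹ • y) - z₀ i| ≤ 8 * δ' := by
    intro e i he h
    have j0 := abs_inner_normalize_sub_le he hy0 hy1.le
    have j2 : |(ρ - 1) * z₀ i| ≤ 2 * δ' := by
      have hx : |z₀ i| ≤ 1 := (PiLp.norm_apply_le z₀ i).trans hn0
      rw [abs_mul, hρ, abs_of_neg (by linarith)]
      nlinarith [abs_nonneg (z₀ i)]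
    have e1 : inner ℝ e (‖y‖⁻¹ • y) - z₀ i = (inner ℝ e (‖y‖⁻¹ • y) - inner ℝ e y)
        + (inner ℝ e y - ρ * z₀ i) + (ρ - 1) * z₀ i := by ring
    rw [e1]
    exact (abs_add_three _ _ _).trans (by linarith)
  have hc0 := hcoord 0
  have hc1 := hcoord 1
  rw [(hΦ y).1] at hc0
  rw [(hΦ y).2] at hc1
  rw [← hza, ← hzb]
  exact mem_conePart_Ioo_of_norm
    (A := {y | |inner ℝ e₀ y - z₀ 0| ≤ 8 * δ' ∧ |inner ℝ e₁ y - z₀ 1| ≤ 8 * δ'})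
    (norm_pos_iff.mp hy0) hy1 ⟨key e₀ 0 h0 hc0, key e₁ 1 h1 hc1⟩

/-- A lower bound for the probability that the projection of a uniform unit vector to a plane lies
near `(a, b)`. The cone over this event contains the product of a small disc around a multiple of
`(a, b)` and a thin shell. -/
lemma prob_plane_near_ge (hk : Fintype.card ι = k + 2) {e₀ e₁ : EuclideanSpace ℝ ι}
    (h0 : ‖e₀‖ = 1) (h1 : ‖e₁‖ = 1) (h01 : inner ℝ e₀ e₁ = 0) {a b δ : ℝ}
    (hab : a ^ 2 + b ^ 2 ≤ 1) (hδ0 : 0 < δ) (hδ1 : δ ≤ 1) (hkδ : 8 ≤ k * δ) :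
    δ ^ 2 / 64 * ((1 - δ / 4) * Real.sqrt (1 - a ^ 2 - b ^ 2)) ^ k
      ≤ (unifSphere ι).real {u | |inner ℝ e₀ (u : EuclideanSpace ℝ ι) - a| ≤ δ ∧
        |inner ℝ e₁ (u : EuclideanSpace ℝ ι) - b| ≤ δ} := by
  have hk8 : (8 : ℝ) ≤ k := by nlinarith [(Nat.cast_nonneg k : (0 : ℝ) ≤ k)]
  have hk0 : 0 < k := by
    have : (0 : ℝ) < k := by linarith
    exact_mod_cast this
  have : Nonempty ι := Fintype.card_pos_iff.mp (by omega)
  have : Nonempty (Fin k) := ⟨⟨0, hk0⟩⟩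
  obtain ⟨Φ, hΦ⟩ := exists_plane_splitting hk h0 h1 h01
  set A := {u : USphere ι | |inner ℝ e₀ (u : EuclideanSpace ℝ ι) - a| ≤ δ ∧
        |inner ℝ e₁ (u : EuclideanSpace ℝ ι) - b| ≤ δ} with hA
  have hm : MeasurableSet A := measurableSet_planeBox e₀ e₁ a b δ
  rw [unifSphere_real_eq hm]
  set s₀ := Real.sqrt (1 - a ^ 2 - b ^ 2) with hs₀
  have hs0 : 0 ≤ s₀ := Real.sqrt_nonneg _
  have hs2 : s₀ ^ 2 = 1 - a ^ 2 - b ^ 2 := Real.sq_sqrt (by linarith)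
  -- if `(a, b)` has norm `1`, the claimed lower bound is zero
  rcases hs0.eq_or_lt with hz | hspos
  · rw [← hz, mul_zero, zero_pow hk0.ne', mul_zero]
    exact div_nonneg measureReal_nonneg ballVol_pos.le
  obtain ⟨δ', hδ'⟩ : ∃ δ' : ℝ, δ = 8 * δ' := ⟨δ / 8, by ring⟩
  obtain ⟨ρ, hρ⟩ : ∃ ρ : ℝ, ρ = 1 - 2 * δ' := ⟨_, rfl⟩
  have hδ'0 : 0 < δ' := by linarith
  have hδ'1 : δ' ≤ 1 / 8 := by linarith
  have hρ0 : 0 < ρ := by linarith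
  let z₀ : EuclideanSpace ℝ (Fin 2) := !₂[a, b]
  have hz0 : ‖z₀‖ ^ 2 + s₀ ^ 2 = 1 := by rw [norm_sq_fin_two, hs2]; simp [z₀]
  set S := Metric.ball (ρ • z₀) δ'
  set T := Metric.ball (0 : EuclideanSpace ℝ (Fin k)) (ρ * s₀) \ Metric.ball 0 ((1 - δ') * (ρ * s₀))
  have hsub : {y | (Φ y).fst ∈ S ∧ (Φ y).snd ∈ T} ⊆ conePart (Set.Ioo 0 1) A := by
    rw [hA, hδ']
    exact product_subset_conePart Φ h0 h1 hΦ (by simp [z₀]) (by simp [z₀]) hs0 hz0 hδ'0 hδ'1 hρ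
  have hvol := volume_preimage_splitting Φ (S := S) (T := T) Metric.isOpen_ball.measurableSet
    (Metric.isOpen_ball.measurableSet.diff Metric.isOpen_ball.measurableSet)
  have hBr : ∀ r : ℝ, 0 ≤ r → volume.real (Metric.ball (0 : EuclideanSpace ℝ (Fin k)) r)
      = r ^ k * ballVol (Fin k) := by
    intro r hr
    rw [Measure.real, Measure.addHaar_ball _ _ hr, ENNReal.toReal_mul,
      ENNReal.toReal_ofReal (by positivity), finrank_euclideanSpace, Fintype.card_fin]
    rfl
  have hSv : volume.real S = Real.pi * δ' ^ 2 := by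
    rw [Measure.real, EuclideanSpace.volume_ball_fin_two]
    simp [Real.pi_pos.le, hδ'0.le]; ring
  have hTv : volume.real T = (ρ * s₀) ^ k * (1 - (1 - δ') ^ k) * ballVol (Fin k) := by
    have hss : Metric.ball (0 : EuclideanSpace ℝ (Fin k)) ((1 - δ') * (ρ * s₀)) ⊆
        Metric.ball 0 (ρ * s₀) := by
      apply Metric.ball_subset_ball
      have : 0 < ρ * s₀ := by positivity
      nlinarith
    rw [measureReal_sdiff hss Metric.isOpen_ball.measurableSet measure_ball_lt_top.ne,
      hBr _ (by positivity), hBr _ (mul_nonneg (by linarith) (by positivity)), mul_pow (1 - δ')]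
    ring
  have hhalf : (1 - δ') ^ k ≤ 1 / 2 := by
    have i1 : (1 - δ') ^ k ≤ Real.exp (-δ') ^ k :=
      pow_le_pow_left₀ (by linarith) (Real.one_sub_le_exp_neg _) k
    rw [← Real.exp_nat_mul] at i1
    have i2 : Real.exp (k * -δ') ≤ Real.exp (-1) := Real.exp_le_exp.mpr (by nlinarith)
    have i3 : Real.exp (-1) ≤ 1 / 2 := by
      rw [Real.exp_neg, ← one_div]
      exact one_div_le_one_div_of_le (by norm_num) (by linarith [Real.exp_one_gt_d9])
    linarith
  have hle := measureReal_mono hsub (ne_top_of_le_ne_top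
    (measure_ball_lt_top (μ := volume) (x := (0 : EuclideanSpace ℝ ι)) (r := 1)).ne
    (measure_mono (conePart_Ioo_subset_ball A)))
  rw [hvol, hSv, hTv] at hle
  have hr := ballVol_ratio (ι := ι) (ι' := Fin k) (by simpa using hk)
  rw [Fintype.card_fin] at hr
  have hp := Real.pi_pos.ne'
  have hρ4 : 1 - δ / 4 = ρ := by linarith
  rw [hρ4]
  have hP : 0 ≤ δ' ^ 2 * (ρ * s₀) ^ k := by positivity
  calc δ ^ 2 / 64 * (ρ * s₀) ^ k = δ' ^ 2 * (ρ * s₀) ^ k * 1 := by rw [hδ']; ring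
    _ ≤ δ' ^ 2 * (ρ * s₀) ^ k * ((1 - (1 - δ') ^ k) * ((k + 2) / 2)) := by
      apply mul_le_mul_of_nonneg_left _ hP
      nlinarith
    _ = Real.pi * δ' ^ 2 * ((ρ * s₀) ^ k * (1 - (1 - δ') ^ k))
        * (ballVol (Fin k) / ballVol ι) := by rw [hr]; field_simp
    _ = Real.pi * δ' ^ 2 * ((ρ * s₀) ^ k * (1 - (1 - δ') ^ k) * ballVol (Fin k)) / ballVol ι := by
      ring
    _ ≤ _ := by gcongr; exact ballVol_pos.le

end plane

/-! ### Counting the entries of a random list in a set -/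

section hits

variable {X : Type*}

/-- The number of entries of the list `x` in `S`, as a real number. -/
noncomputable def hits {n : ℕ} (S : Set X) (x : Fin n → X) : ℝ :=
  ∑ i, S.indicator (fun _ => (1 : ℝ)) (x i)

lemma hits_mem_Icc {n : ℕ} (S : Set X) (x : Fin n → X) : hits S x ∈ Set.Icc 0 (n : ℝ) := by
  constructor
  · exact Finset.sum_nonneg fun i _ => Set.indicator_nonneg (fun _ _ => zero_le_one) _
  · have : hits S x ≤ ∑ _i : Fin n, (1 : ℝ) :=
      Finset.sum_le_sum fun i _ => Set.indicator_le_self' (fun _ _ => zero_le_one) _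
    simpa using this

/-- An entry outside `S` may be removed from the list. Applied to a relation without loops, this
makes the entries related to a given entry independent of that entry. -/
lemma hits_succAbove {n : ℕ} (i : Fin (n + 1)) {S : Set X} {x : Fin (n + 1) → X} (h : x i ∉ S) :
    hits S x = hits S fun j => x (i.succAbove j) := by
  rw [hits, Fin.sum_univ_succAbove _ i, Set.indicator_of_notMem h, zero_add, hits]

end hits

section prob

variable {X Y : Type*} [MeasurableSpace X] [MeasurableSpace Y]

lemma prod_real_eq_integral (μ : Measure X) (ν : Measure Y) [IsFiniteMeasure μ] [IsFiniteMeasure ν]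
    {T : Set (X × Y)} (hT : MeasurableSet T) :
    (μ.prod ν).real T = ∫ a, ν.real (Prod.mk a ⁻¹' T) ∂μ := by
  rw [Measure.real, Measure.prod_apply hT,
    ← integral_toReal (measurable_measure_prodMk_left hT).aemeasurable
      (ae_of_all _ fun a => measure_lt_top _ _)]
  rfl

lemma prod_real_eq_integral_symm (μ : Measure X) (ν : Measure Y) [IsFiniteMeasure μ]
    [IsFiniteMeasure ν] {T : Set (X × Y)} (hT : MeasurableSet T) :
    (μ.prod ν).real T = ∫ b, μ.real ((fun a => (a, b)) ⁻¹' T) ∂ν := by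
  rw [Measure.real, Measure.prod_apply_symm hT,
    ← integral_toReal (measurable_measure_prodMk_right hT).aemeasurable
      (ae_of_all _ fun a => measure_lt_top _ _)]
  rfl

lemma prod_real_le_integral (μ : Measure X) (ν : Measure Y) [IsFiniteMeasure μ] [IsFiniteMeasure ν]
    {T : Set (X × Y)} (hT : MeasurableSet T) {f : X → ℝ} (hf : Integrable f μ)
    (h : ∀ a, ν.real (Prod.mk a ⁻¹' T) ≤ f a) : (μ.prod ν).real T ≤ ∫ a, f a ∂μ := by
  rw [prod_real_eq_integral μ ν hT]
  exact integral_mono_of_nonneg (ae_of_all _ fun a => measureReal_nonneg) hf (ae_of_all _ h)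

lemma prod_real_le_of_section (μ : Measure X) (ν : Measure Y) [IsProbabilityMeasure μ]
    [IsFiniteMeasure ν] {T : Set (X × Y)} (hT : MeasurableSet T) {δ : ℝ}
    (h : ∀ a, ν.real (Prod.mk a ⁻¹' T) ≤ δ) : (μ.prod ν).real T ≤ δ := by
  have := prod_real_le_integral μ ν hT (integrable_const δ) h
  simpa using this

lemma prod_real_le_of_section_symm (μ : Measure X) (ν : Measure Y) [IsFiniteMeasure μ]
    [IsProbabilityMeasure ν] {T : Set (X × Y)} (hT : MeasurableSet T) {δ : ℝ}
    (h : ∀ b, μ.real ((fun a => (a, b)) ⁻¹' T) ≤ δ) : (μ.prod ν).real T ≤ δ := by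
  rw [prod_real_eq_integral_symm μ ν hT]
  have := integral_mono_of_nonneg (ae_of_all ν fun a => measureReal_nonneg) (integrable_const δ)
    (ae_of_all ν h)
  simpa using this

lemma measurable_hits {n : ℕ} {S : Set X} (hS : MeasurableSet S) :
    Measurable (hits S : (Fin n → X) → ℝ) := by
  unfold hits
  exact Finset.measurable_fun_sum _ fun i _ =>
    (measurable_const.indicator hS).comp (measurable_pi_apply i)

/-- The moment generating function of the number of hits. -/
lemma integral_exp_hits_le (μ : Measure X) [IsProbabilityMeasure μ] (n : ℕ) {S : Set X}
    (hS : MeasurableSet S) (l : ℝ) :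
    ∫ x : Fin n → X, Real.exp (l * hits S x) ∂(Measure.pi fun _ => μ)
      ≤ Real.exp (n * ((Real.exp l - 1) * μ.real S)) := by
  have h1 : ∀ x : Fin n → X, Real.exp (l * hits S x)
      = ∏ i, (1 + (Real.exp l - 1) * S.indicator (fun _ => (1 : ℝ)) (x i)) := by
    intro x
    rw [hits, Finset.mul_sum, Real.exp_sum]
    refine Finset.prod_congr rfl fun i _ => ?_
    by_cases h : x i ∈ S <;> simp [h]
  simp_rw [h1]
  rw [integral_fintype_prod_eq_pow (fun y : X => 1 + (Real.exp l - 1) *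
    S.indicator (fun _ => (1 : ℝ)) y), Fintype.card_fin]
  have hint : Integrable (S.indicator fun _ => (1 : ℝ)) μ := (integrable_const 1).indicator hS
  rw [integral_add (integrable_const _) (hint.const_mul _), integral_const_mul,
    integral_indicator_const _ hS]
  simp only [integral_const, probReal_univ, smul_eq_mul, mul_one]
  rw [Real.exp_nat_mul]
  refine pow_le_pow_left₀ ?_ ?_ n
  · have : μ.real S ≤ 1 := measureReal_le_one
    nlinarith [Real.exp_pos l, (measureReal_nonneg : 0 ≤ μ.real S)]
  · linarith [Real.add_one_le_exp ((Real.exp l - 1) * μ.real S)]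

lemma integrable_exp_hits (μ : Measure X) [IsProbabilityMeasure μ] (n : ℕ) {S : Set X}
    (hS : MeasurableSet S) (l : ℝ) :
    Integrable (fun x : Fin n → X => Real.exp (l * hits S x)) (Measure.pi fun _ => μ) := by
  refine Integrable.of_bound (C := Real.exp (|l| * n))
    (Real.measurable_exp.comp ((measurable_hits hS).const_mul l)).aestronglyMeasurable
    (ae_of_all _ fun x => ?_)
  rw [Real.norm_eq_abs, Real.abs_exp, Real.exp_le_exp]
  have h := hits_mem_Icc S x
  calc l * hits S x ≤ |l| * hits S x := mul_le_mul_of_nonneg_right (le_abs_self l) h.1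
    _ ≤ _ := mul_le_mul_of_nonneg_left h.2 (abs_nonneg l)

/-- Chernoff bound for the upper tail. -/
lemma prob_hits_ge_le (μ : Measure X) [IsProbabilityMeasure μ] (n : ℕ) {S : Set X}
    (hS : MeasurableSet S) {t : ℝ} (ht : n * μ.real S ≤ t) :
    (Measure.pi fun _ : Fin n => μ).real {x | 4 * t ≤ hits S x} ≤ Real.exp (-t) := by
  have h0 : 0 ≤ n * μ.real S := by positivity
  have h1 := mul_meas_ge_le_integral_of_nonneg (μ := Measure.pi fun _ : Fin n => μ)
    (ae_of_all _ fun x => (Real.exp_pos (1 * hits S x)).le) (integrable_exp_hits μ n hS 1)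
    (Real.exp (4 * t))
  have h2 := h1.trans (integral_exp_hits_le μ n hS 1)
  simp only [Real.exp_le_exp, one_mul] at h2
  rw [mul_comm, ← le_div_iff₀ (Real.exp_pos _), ← Real.exp_sub] at h2
  refine h2.trans (Real.exp_le_exp.mpr ?_)
  have : Real.exp 1 - 1 ≤ 2 := by linarith [Real.exp_one_lt_d9]
  nlinarith

/-- Chernoff bound for the lower tail. -/
lemma prob_hits_le_le (μ : Measure X) [IsProbabilityMeasure μ] (n : ℕ) {S : Set X}
    (hS : MeasurableSet S) {t : ℝ} (ht0 : 0 ≤ t) (ht : t ≤ n * μ.real S) :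
    (Measure.pi fun _ : Fin n => μ).real {x | hits S x ≤ t / 4} ≤ Real.exp (-(t / 4)) := by
  have h1 := mul_meas_ge_le_integral_of_nonneg (μ := Measure.pi fun _ : Fin n => μ)
    (ae_of_all _ fun x => (Real.exp_pos (-1 * hits S x)).le) (integrable_exp_hits μ n hS (-1))
    (Real.exp (-(t / 4)))
  have h2 := h1.trans (integral_exp_hits_le μ n hS (-1))
  simp only [Real.exp_le_exp, neg_mul, one_mul, neg_le_neg_iff] at h2
  rw [mul_comm, ← le_div_iff₀ (Real.exp_pos _), ← Real.exp_sub] at h2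
  refine h2.trans (Real.exp_le_exp.mpr ?_)
  have : Real.exp (-1) ≤ 1 / 2 := by
    rw [Real.exp_neg, ← one_div]
    exact one_div_le_one_div_of_le (by norm_num) (by linarith [Real.exp_one_gt_d9])
  nlinarith

/-- A bound for an event about a list of independent samples may be proved after fixing one of the
samples. -/
lemma pi_real_le_of_fix (μ : Measure X) [IsProbabilityMeasure μ] {n : ℕ} (i : Fin (n + 1))
    {T : Set (X × (Fin n → X))} (hT : MeasurableSet T) {δ : ℝ}
    (h : ∀ a, (Measure.pi fun _ : Fin n => μ).real {x | (a, x) ∈ T} ≤ δ) :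
    (Measure.pi fun _ : Fin (n + 1) => μ).real
      {x | (x i, fun j => x (i.succAbove j)) ∈ T} ≤ δ := by
  have hmp := measurePreserving_piFinSuccAbove (fun _ : Fin (n + 1) => μ) i
  have := hmp.measure_preimage hT.nullMeasurableSet
  rw [Measure.real]
  have e : {x : Fin (n + 1) → X | (x i, fun j => x (i.succAbove j)) ∈ T}
      = (MeasurableEquiv.piFinSuccAbove (fun _ : Fin (n + 1) => X) i) ⁻¹' T := rfl
  rw [e, this]
  exact prod_real_le_of_section μ _ hT h

lemma measurable_hits_prod {n : ℕ} {R : Set (X × Y)} (hR : MeasurableSet R) :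
    Measurable fun p : X × (Fin n → Y) => hits {y | (p.1, y) ∈ R} p.2 := by
  unfold hits
  refine Finset.measurable_fun_sum _ fun i _ => ?_
  exact (measurable_const (a := (1 : ℝ)).indicator hR).comp
    (measurable_fst.prodMk ((measurable_pi_apply i).comp measurable_snd))

/-- Upper tail for the number of entries related to the `i`-th entry. Once that entry is fixed, the
others are independent of it, and it is not related to itself. -/
lemma prob_hits_related_ge_le (μ : Measure X) [IsProbabilityMeasure μ] {n : ℕ} (i : Fin (n + 1))
    {R : Set (X × X)} (hR : MeasurableSet R) (hirr : ∀ a, (a, a) ∉ R) {A : Set X}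
    (hA : MeasurableSet A) {t : ℝ} (ht : ∀ a ∈ A, n * μ.real {y | (a, y) ∈ R} ≤ t) :
    (Measure.pi fun _ : Fin (n + 1) => μ).real
      {x | x i ∈ A ∧ 4 * t ≤ hits {y | (x i, y) ∈ R} x} ≤ Real.exp (-t) := by
  have hT : MeasurableSet {p : X × (Fin n → X) | p.1 ∈ A ∧ 4 * t ≤ hits {y | (p.1, y) ∈ R} p.2} :=
    (measurable_fst hA).inter (measurableSet_le measurable_const (measurable_hits_prod hR))
  have h := pi_real_le_of_fix μ i hT (δ := Real.exp (-t)) fun a => by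
    by_cases ha : a ∈ A
    · simpa [ha] using prob_hits_ge_le μ n (S := {y | (a, y) ∈ R}) (measurable_prodMk_left hR)
        (ht a ha)
    · simpa [ha] using (Real.exp_pos _).le
  refine le_trans (le_of_eq ?_) h
  congr 1
  ext x
  simp only [Set.mem_ofPred_eq, hits_succAbove i (S := {y | (x i, y) ∈ R}) (hirr (x i))]

/-- Lower tail for the number of entries related to the `i`-th entry. -/
lemma prob_hits_related_le_le (μ : Measure X) [IsProbabilityMeasure μ] {n : ℕ} (i : Fin (n + 1))
    {R : Set (X × X)} (hR : MeasurableSet R) (hirr : ∀ a, (a, a) ∉ R) {A : Set X}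
    (hA : MeasurableSet A) {t : ℝ} (ht0 : 0 ≤ t) (ht : ∀ a ∈ A, t ≤ n * μ.real {y | (a, y) ∈ R}) :
    (Measure.pi fun _ : Fin (n + 1) => μ).real
      {x | x i ∈ A ∧ hits {y | (x i, y) ∈ R} x ≤ t / 4} ≤ Real.exp (-(t / 4)) := by
  have hT : MeasurableSet {p : X × (Fin n → X) | p.1 ∈ A ∧ hits {y | (p.1, y) ∈ R} p.2 ≤ t / 4} :=
    (measurable_fst hA).inter (measurableSet_le (measurable_hits_prod hR) measurable_const)
  have h := pi_real_le_of_fix μ i hT (δ := Real.exp (-(t / 4))) fun a => by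
    by_cases ha : a ∈ A
    · simpa [ha] using prob_hits_le_le μ n (S := {y | (a, y) ∈ R}) (measurable_prodMk_left hR) ht0
        (ht a ha)
    · simpa [ha] using (Real.exp_pos _).le
  refine le_trans (le_of_eq ?_) h
  congr 1
  ext x
  simp only [Set.mem_ofPred_eq, hits_succAbove i (S := {y | (x i, y) ∈ R}) (hirr (x i))]

end prob

/-! ### Unions of random sets -/

section coverage

variable {X : Type*} [MeasurableSpace X]

/-- One random set of measure `q` is expected to enlarge a set of measure at most one half by a
constant share of `q`. -/
lemma integral_exp_neg_cover_le (μ : Measure X) [IsProbabilityMeasure μ] {R : Set (X × X)}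
    (hR : MeasurableSet R) {q : ℝ} (hq : 0 < q) (h1 : ∀ x, μ.real {c | (x, c) ∈ R} = q)
    (h2 : ∀ c, μ.real {x | (x, c) ∈ R} = q) {A : Set X} (hA : MeasurableSet A)
    (hA2 : μ.real A ≤ 1 / 2) :
    ∫ c, Real.exp (-(μ.real (A ∪ {x | (x, c) ∈ R}) / q)) ∂μ
      ≤ 7 / 10 * Real.exp (-(μ.real A / q)) := by
  have hD : MeasurableSet {p : X × X | p ∈ R ∧ p.1 ∉ A} := hR.inter (measurable_fst hA.compl)
  set g : X → ℝ := fun c => μ.real {x | (x, c) ∈ R ∧ x ∉ A} with hg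
  have hgm : Measurable g := (measurable_measure_prodMk_right hD).ennreal_toReal
  have hg0 : ∀ c, 0 ≤ g c := fun c => measureReal_nonneg
  have hgq : ∀ c, g c ≤ q := fun c => by
    rw [← h2 c]; exact measureReal_mono fun x hx => hx.1
  have hgint : Integrable g μ := Integrable.of_bound hgm.aestronglyMeasurable (C := q)
    (ae_of_all _ fun c => by rw [Real.norm_eq_abs, abs_of_nonneg (hg0 c)]; exact hgq c)
  have hunion : ∀ c, μ.real (A ∪ {x | (x, c) ∈ R}) = μ.real A + g c := by
    intro c
    have e : A ∪ {x | (x, c) ∈ R} = A ∪ {x | (x, c) ∈ R ∧ x ∉ A} := by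
      ext x; simp only [Set.mem_union, Set.mem_ofPred_eq]; tauto
    have hDc : MeasurableSet {x | (x, c) ∈ R ∧ x ∉ A} := measurable_prodMk_right hD
    rw [e, measureReal_union _ hDc]
    exact Set.disjoint_left.mpr fun x hx hx' => hx'.2 hx
  -- double counting gives the expected gain
  have hmean : q * (1 - μ.real A) = ∫ c, g c ∂μ := by
    have e1 := prod_real_eq_integral_symm μ μ hD
    have e2 := prod_real_eq_integral μ μ hD
    have e3 : ∀ x, μ.real (Prod.mk x ⁻¹' {p : X × X | p ∈ R ∧ p.1 ∉ A})
        = Aᶜ.indicator (fun _ => q) x := by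
      intro x
      by_cases hx : x ∈ A
      · simp [hx]
      · rw [Set.indicator_of_mem (by simpa using hx), ← h1 x]
        congr 1
        ext c; simp [hx]
    simp_rw [e3] at e2
    rw [integral_indicator_const _ hA.compl, probReal_compl_eq_one_sub hA, smul_eq_mul] at e2
    rw [mul_comm, ← e2, e1]
    rfl
  have hconv : ∀ c, Real.exp (-(μ.real (A ∪ {x | (x, c) ∈ R}) / q))
      ≤ Real.exp (-(μ.real A / q)) * (1 - (6 / 10 / q) * g c) := by
    intro c
    rw [hunion, add_div, neg_add, Real.exp_add]
    refine mul_le_mul_of_nonneg_left ?_ (Real.exp_pos _).le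
    set s := g c / q with hs
    have hs0 : 0 ≤ s := div_nonneg (hg0 c) hq.le
    have hs1 : s ≤ 1 := (div_le_one hq).mpr (hgq c)
    have e : 6 / 10 / q * g c = 6 / 10 * s := by rw [hs]; ring
    rw [e]
    -- convexity of the exponential function on `[0, 1]`
    have hc := convexOn_exp.2 (Set.mem_univ (0 : ℝ)) (Set.mem_univ (-1 : ℝ))
      (sub_nonneg.mpr hs1) hs0 (by ring)
    simp only [smul_eq_mul, mul_zero, zero_add, Real.exp_zero, mul_one, mul_neg] at hc
    have he : Real.exp (-1) ≤ 4 / 10 := by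
      rw [Real.exp_neg, inv_le_comm₀ (Real.exp_pos _) (by norm_num)]
      linarith [Real.exp_one_gt_d9]
    nlinarith
  have hle := integral_mono_of_nonneg (μ := μ) (ae_of_all _ fun c => (Real.exp_pos _).le)
    (((integrable_const (1 : ℝ)).sub (hgint.const_mul (6 / 10 / q))).const_mul
      (Real.exp (-(μ.real A / q)))) (ae_of_all _ hconv)
  refine hle.trans ?_
  rw [integral_const_mul]
  simp only [Pi.sub_apply]
  rw [integral_sub (integrable_const _) (hgint.const_mul _),
    integral_const_mul, ← hmean]
  simp only [integral_const, probReal_univ, smul_eq_mul, mul_one]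
  have e : 6 / 10 / q * (q * (1 - μ.real A)) = 6 / 10 * (1 - μ.real A) := by
    field_simp
  rw [e, mul_comm]
  exact mul_le_mul_of_nonneg_right (by linarith) (Real.exp_pos _).le

/-- The bound for random sets added to a given set `A`. The potential `exp (- measure / q)` shrinks
in expectation by a factor `7 / 10` with every set, as long as the measure of the union is below `τ
≤ 1 / 2`; when it reaches `τ`, the event has become impossible. -/
lemma prob_cover_lt_le_aux (μ : Measure X) [IsProbabilityMeasure μ] {R : Set (X × X)}
    (hR : MeasurableSet R) {q : ℝ} (hq : 0 < q) (h1 : ∀ x, μ.real {c | (x, c) ∈ R} = q)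
    (h2 : ∀ c, μ.real {x | (x, c) ∈ R} = q) {τ : ℝ} (hτ : τ ≤ 1 / 2) (K : ℕ) (A : Set X)
    (hA : MeasurableSet A) :
    (Measure.pi fun _ : Fin K => μ).real
        {c | μ.real {x | x ∈ A ∨ ∃ k, (x, c k) ∈ R} < τ}
      ≤ (7 / 10) ^ K * Real.exp ((τ - μ.real A) / q) := by
  induction K generalizing A with
  | zero =>
    by_cases h : μ.real A < τ
    · refine measureReal_le_one.trans ?_
      rw [pow_zero, one_mul]
      exact Real.one_le_exp (div_nonneg (by linarith) hq.le)
    · simp only [IsEmpty.exists_iff, or_false, Set.ofPred_mem_eq, h]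
      simpa using (Real.exp_pos _).le
  | succ K ih =>
    by_cases h : μ.real A < τ
    · have hT : MeasurableSet {p : X × (Fin K → X) |
          μ.real {x | (x ∈ A ∨ (x, p.1) ∈ R) ∨ ∃ k, (x, p.2 k) ∈ R} < τ} := by
        refine measurableSet_lt (Measurable.ennreal_toReal ?_) measurable_const
        have hm : MeasurableSet {z : X × (X × (Fin K → X)) |
            (z.1 ∈ A ∨ (z.1, z.2.1) ∈ R) ∨ ∃ k, (z.1, z.2.2 k) ∈ R} := by
          have : {z : X × (X × (Fin K → X)) | (z.1 ∈ A ∨ (z.1, z.2.1) ∈ R) ∨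
              ∃ k, (z.1, z.2.2 k) ∈ R} = (Prod.fst ⁻¹' A ∪
                (fun z : X × (X × (Fin K → X)) => (z.1, z.2.1)) ⁻¹' R) ∪
              ⋃ k, (fun z : X × (X × (Fin K → X)) => (z.1, z.2.2 k)) ⁻¹' R := by
            ext; simp
          rw [this]
          refine MeasurableSet.union ((measurable_fst hA).union ?_)
            (MeasurableSet.iUnion fun k => ?_)
          · exact (measurable_fst.prodMk (measurable_fst.comp measurable_snd)) hR
          · exact (measurable_fst.prodMk
              ((measurable_pi_apply k).comp (measurable_snd.comp measurable_snd))) hR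
        exact measurable_measure_prodMk_right hm
      have hmp := measurePreserving_piFinSuccAbove (fun _ : Fin (K + 1) => μ) 0
      have e : {c : Fin (K + 1) → X | μ.real {x | x ∈ A ∨ ∃ k, (x, c k) ∈ R} < τ}
          = (MeasurableEquiv.piFinSuccAbove (fun _ : Fin (K + 1) => X) 0) ⁻¹'
            {p : X × (Fin K → X) |
              μ.real {x | (x ∈ A ∨ (x, p.1) ∈ R) ∨ ∃ k, (x, p.2 k) ∈ R} < τ} := by
        ext c
        simp only [Set.mem_ofPred_eq, Set.mem_preimage, Fin.exists_fin_succ, ← or_assoc]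
        rfl
      rw [e, Measure.real, hmp.measure_preimage hT.nullMeasurableSet]
      change (μ.prod (Measure.pi fun _ : Fin K => μ)).real _ ≤ _
      have hcm : Measurable fun c => μ.real (A ∪ {x | (x, c) ∈ R}) := by
        have hm : MeasurableSet {z : X × X | z.1 ∈ A ∨ z ∈ R} := (measurable_fst hA).union hR
        exact (measurable_measure_prodMk_right hm).ennreal_toReal
      have hint : Integrable
          (fun c => (7 / 10) ^ K * (Real.exp (τ / q) *
            Real.exp (-(μ.real (A ∪ {x | (x, c) ∈ R}) / q)))) μ := by
        refine Integrable.const_mul (Integrable.const_mul ?_ _) _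
        refine Integrable.of_bound (C := 1)
          (Real.measurable_exp.comp (hcm.div_const q).neg).aestronglyMeasurable
          (ae_of_all _ fun c => ?_)
        rw [Real.norm_eq_abs, Real.abs_exp, Real.exp_le_one_iff]
        exact neg_nonpos.mpr (div_nonneg measureReal_nonneg hq.le)
      refine (prod_real_le_integral μ _ hT hint fun c => ?_).trans ?_
      · have := ih (A ∪ {x | (x, c) ∈ R}) (hA.union (measurable_prodMk_right hR))
        rw [sub_div, sub_eq_add_neg, Real.exp_add] at this
        exact this
      · rw [integral_const_mul, integral_const_mul]
        have := integral_exp_neg_cover_le μ hR hq h1 h2 hA (h.le.trans hτ)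
        calc _ ≤ (7 / 10) ^ K * (Real.exp (τ / q) * (7 / 10 * Real.exp (-(μ.real A / q)))) := by
              gcongr
          _ = _ := by rw [sub_div, sub_eq_add_neg, Real.exp_add]; ring
    · have : {c : Fin (K + 1) → X | μ.real {x | x ∈ A ∨ ∃ k, (x, c k) ∈ R} < τ} = ∅ := by
        ext c
        simp only [Set.mem_ofPred_eq, Set.mem_empty_iff_false, iff_false, not_lt]
        exact (not_lt.mp h).trans (measureReal_mono fun x hx => Or.inl hx)
      rw [this, measureReal_empty]
      positivity

/-- The union of `K` independent random sets of measure `q` has measure at least a constant share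
of `min 1 (K * q)`, except with probability exponentially small in `K`. -/
lemma prob_cover_lt_le (μ : Measure X) [IsProbabilityMeasure μ] {R : Set (X × X)}
    (hR : MeasurableSet R) {q : ℝ} (hq : 0 < q) (h1 : ∀ x, μ.real {c | (x, c) ∈ R} = q)
    (h2 : ∀ c, μ.real {x | (x, c) ∈ R} = q) (K : ℕ) :
    (Measure.pi fun _ : Fin K => μ).real
        {c | μ.real {x | ∃ k, (x, c k) ∈ R} < min (1 / 2) (K * q / 4)} ≤ (9 / 10) ^ K := by
  have h := prob_cover_lt_le_aux μ hR hq h1 h2 (min_le_left (1 / 2) (K * q / 4)) K ∅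
    MeasurableSet.empty
  simp only [Set.mem_empty_iff_false, false_or, measureReal_empty, sub_zero] at h
  refine h.trans ?_
  -- the factor `exp (τ / q)` is at most `exp (1 / 4) ^ K`, and `7 / 10 * exp (1 / 4) ≤ 9 / 10`
  have e1 : min (1 / 2) (K * q / 4) / q ≤ K * (1 / 4) := by
    rw [div_le_iff₀ hq]
    exact (min_le_right _ _).trans (by linarith)
  have e2 : Real.exp (1 / 4) ≤ 9 / 7 := by
    have h4 : Real.exp (1 / 4) ^ 4 = Real.exp 1 := by
      rw [← Real.exp_nat_mul]; norm_num
    by_contra hcon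
    push Not at hcon
    have := pow_lt_pow_left₀ hcon (by norm_num) (four_ne_zero)
    rw [h4] at this
    norm_num at this
    linarith [Real.exp_one_lt_d9]
  calc _ ≤ (7 / 10 : ℝ) ^ K * Real.exp (K * (1 / 4)) := by gcongr
    _ = (7 / 10 * Real.exp (1 / 4)) ^ K := by rw [mul_pow, Real.exp_nat_mul]
    _ ≤ _ := by gcongr; linarith

end coverage

/-! ### Perturbation of powers -/

section scalar

/-- A perturbation `x` of `σ` changes the `k`-th power of `√σ` by a factor `exp (O (x k))` only, as
long as `σ` is bounded below. Passing from the exponent `k` to `k + 2` costs another constant. -/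
lemma sqrt_add_pow_le {σ σ₀ x : ℝ} (h0 : 0 < σ₀) (h1 : σ₀ ≤ σ) (hx : 0 ≤ x) (k : ℕ) :
    Real.sqrt (σ + x) ^ k ≤ Real.sqrt σ ^ (k + 2) * (σ₀⁻¹ * Real.exp (x * k / (2 * σ₀))) := by
  have hσ0 : 0 < σ := h0.trans_le h1
  have e1 : Real.sqrt (σ + x) ≤ Real.sqrt σ * Real.exp (x / (2 * σ₀)) := by
    rw [Real.sqrt_le_left (by positivity), mul_pow, Real.sq_sqrt hσ0.le, ← Real.exp_nat_mul]
    have e2 : ((2 : ℕ) : ℝ) * (x / (2 * σ₀)) = x / σ₀ := by push_cast; field_simp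
    rw [e2]
    have e3 : 1 + x / σ ≤ Real.exp (x / σ₀) := by
      have : x / σ ≤ x / σ₀ := by gcongr
      linarith [Real.add_one_le_exp (x / σ₀)]
    calc σ + x = σ * (1 + x / σ) := by field_simp
      _ ≤ _ := by gcongr
  have e4 : 1 ≤ Real.sqrt σ ^ 2 * σ₀⁻¹ := by
    rw [Real.sq_sqrt hσ0.le, ← div_eq_mul_inv, one_le_div h0]; exact h1
  calc Real.sqrt (σ + x) ^ k ≤ (Real.sqrt σ * Real.exp (x / (2 * σ₀))) ^ k := by gcongr
    _ = Real.sqrt σ ^ k * Real.exp (x * k / (2 * σ₀)) * 1 := by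
      rw [mul_pow, ← Real.exp_nat_mul, mul_one]; congr 2; ring
    _ ≤ Real.sqrt σ ^ k * Real.exp (x * k / (2 * σ₀)) * (Real.sqrt σ ^ 2 * σ₀⁻¹) := by gcongr
    _ = _ := by rw [pow_add]; ring

lemma exp_neg_two_mul_le {y : ℝ} (h0 : 0 ≤ y) (h1 : y ≤ 1 / 2) : Real.exp (-(2 * y)) ≤ 1 - y := by
  have h2 : 0 < 1 - y := by linarith
  rw [Real.exp_neg, inv_le_comm₀ (Real.exp_pos _) h2]
  have h3 := Real.add_one_le_exp (2 * y)
  refine le_trans ?_ h3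
  rw [inv_le_iff_one_le_mul₀ h2]
  nlinarith

/-- The counterpart of `sqrt_add_pow_le` for a negative perturbation. -/
lemma sqrt_sub_pow_ge {σ σ₀ x : ℝ} (h0 : 0 < σ₀) (h1 : σ₀ ≤ σ) (hσ : σ ≤ 1) (hx : 0 ≤ x)
    (hx1 : x ≤ σ₀ / 2) (k : ℕ) :
    Real.sqrt σ ^ (k + 2) * Real.exp (-(x * k / σ₀)) ≤ Real.sqrt (σ - x) ^ k := by
  have hσ0 : 0 < σ := h0.trans_le h1
  have e1 : Real.sqrt σ * Real.exp (-(x / σ₀)) ≤ Real.sqrt (σ - x) := by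
    apply Real.le_sqrt_of_sq_le
    rw [mul_pow, Real.sq_sqrt hσ0.le, ← Real.exp_nat_mul]
    have e2 : ((2 : ℕ) : ℝ) * -(x / σ₀) = -(2 * (x / σ₀)) := by push_cast; ring
    rw [e2]
    have e3 := exp_neg_two_mul_le (y := x / σ₀) (by positivity)
      (by rw [div_le_iff₀ h0]; linarith)
    have e4 : x / σ ≤ x / σ₀ := by gcongr
    calc σ * Real.exp (-(2 * (x / σ₀))) ≤ σ * (1 - x / σ) := by gcongr; linarith
      _ = σ - x := by field_simp
  calc Real.sqrt σ ^ (k + 2) * Real.exp (-(x * k / σ₀))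
      ≤ Real.sqrt σ ^ k * Real.exp (-(x * k / σ₀)) := by
        refine mul_le_mul_of_nonneg_right ?_ (Real.exp_pos _).le
        exact pow_le_pow_of_le_one (Real.sqrt_nonneg _) (Real.sqrt_le_one.mpr hσ) (by omega)
    _ = (Real.sqrt σ * Real.exp (-(x / σ₀))) ^ k := by
        rw [mul_pow, ← Real.exp_nat_mul]; congr 2; ring
    _ ≤ _ := by gcongr

end scalar

/-! ### Caps and intersections of two caps -/

section geometry

variable {ι : Type} [Fintype ι] {k : ℕ}

lemma exists_orthogonal_unit (hk : Fintype.card ι = k + 2) (e : USphere ι) :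
    ∃ e' : EuclideanSpace ℝ ι, ‖e'‖ = 1 ∧ inner ℝ (e : EuclideanSpace ℝ ι) e' = 0 := by
  classical
  have : Nontrivial ι := Fintype.one_lt_card_iff_nontrivial.mp (by omega)
  obtain ⟨i, j, hij⟩ := exists_pair_ne ι
  obtain ⟨g, hg⟩ := exists_isometry_map_unit (⟨EuclideanSpace.single i 1, by simp⟩ : USphere ι) e
  refine ⟨g (EuclideanSpace.single j 1), by simp, ?_⟩
  rw [← hg, LinearIsometryEquiv.inner_map_map]
  simp [EuclideanSpace.inner_single_left, hij]

/-- The band of vectors with inner product `≈ a` with `c` has measure at most about `(1 - a²) ^ (k /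
2)`: project to any plane that contains `c`. -/
lemma prob_cap_le (hk : Fintype.card ι = k + 2) (hk0 : 0 < k) (c : USphere ι) {a ε : ℝ}
    (ha0 : 0 ≤ a) (ha1 : a ≤ 1) (hε : 0 ≤ ε) :
    (unifSphere ι).real {u | ApproxEq ε (inner ℝ (c : EuclideanSpace ℝ ι) u) a}
      ≤ (k + 2) / 2 * Real.sqrt (1 - a ^ 2 + 2 * ε) ^ k := by
  obtain ⟨e', h1, h2⟩ := exists_orthogonal_unit hk c
  have : Nonempty ι := Fintype.card_pos_iff.mp (by omega)
  have h := prob_plane_norm_ge_le hk hk0 (norm_usphere c) h1 h2 (a ^ 2 - 2 * ε)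
  rw [show 1 - (a ^ 2 - 2 * ε) = 1 - a ^ 2 + 2 * ε by ring] at h
  refine (measureReal_mono ?_).trans h
  intro u hu
  have hu' := abs_le.mp (show |inner ℝ (c : EuclideanSpace ℝ ι) u - a| ≤ ε from hu)
  simp only [Set.mem_ofPred_eq]
  nlinarith [sq_nonneg (inner ℝ e' (u : EuclideanSpace ℝ ι)),
    sq_nonneg (inner ℝ (c : EuclideanSpace ℝ ι) u - a)]

/-- The band of vectors with inner product `≈ a` with `c` has measure at least about `(1 - a²) ^ (k
/ 2)`. -/
lemma prob_cap_ge (hk : Fintype.card ι = k + 2) (c : USphere ι) {a δ : ℝ}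
    (ha : a ^ 2 ≤ 1) (hδ0 : 0 < δ) (hδ1 : δ ≤ 1) (hkδ : 8 ≤ k * δ) :
    δ ^ 2 / 64 * ((1 - δ / 4) * Real.sqrt (1 - a ^ 2)) ^ k
      ≤ (unifSphere ι).real {u | ApproxEq δ (inner ℝ (c : EuclideanSpace ℝ ι) u) a} := by
  obtain ⟨e', h1, h2⟩ := exists_orthogonal_unit hk c
  have : Nonempty ι := Fintype.card_pos_iff.mp (by omega)
  have h := prob_plane_near_ge hk (norm_usphere c) h1 h2 (a := a) (b := 0) (by simpa using ha)
    hδ0 hδ1 hkδ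
  rw [zero_pow two_ne_zero, sub_zero] at h
  exact h.trans (measureReal_mono fun u hu => hu.1)

/-- Numerical stability of `γ²` when the cosine `a` of the angle between the two centres of the
wedge is replaced by `a' ≈ a`. -/
lemma abs_gamma_perturb_le {a a' t ε s : ℝ} (ha0 : 0 ≤ a) (ha1 : a ≤ 1) (ht0 : 0 ≤ t) (ht1 : t ≤ 1)
    (hs : 0 < s) (hsa : s ^ 2 ≤ 1 - a ^ 2) (hε : 0 ≤ ε) (hεs : 3 * ε ≤ s ^ 2 / 2)
    (h : |a' - a| ≤ ε) :
    s ^ 2 / 2 ≤ 1 - a' ^ 2 ∧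
    |(t - a * a') ^ 2 / (1 - a' ^ 2) - (t - a ^ 2) ^ 2 / (1 - a ^ 2)| ≤ 14 / s ^ 4 * ε := by
  have hs1 : s ^ 2 ≤ 1 := by nlinarith
  have hε1 : ε ≤ 1 := by linarith
  obtain ⟨h1, h2⟩ := abs_le.mp h
  have hd : |a' ^ 2 - a ^ 2| ≤ 3 * ε := by
    rw [show a' ^ 2 - a ^ 2 = (a' - a) * (a' + a) by ring, abs_mul, mul_comm (3 : ℝ)]
    exact mul_le_mul h (abs_le.mpr ⟨by linarith, by linarith⟩) (abs_nonneg _) hε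
  have hP' : s ^ 2 / 2 ≤ 1 - a' ^ 2 := by linarith [(abs_le.mp hd).2]
  refine ⟨hP', ?_⟩
  have hp0 : 0 < 1 - a ^ 2 := by nlinarith
  have hp1 : 0 < 1 - a' ^ 2 := by nlinarith
  -- change first the numerator, then the denominator
  have e : (t - a * a') ^ 2 / (1 - a' ^ 2) - (t - a ^ 2) ^ 2 / (1 - a ^ 2)
      = (a * (a - a') * (2 * t - a * a' - a ^ 2)) / (1 - a' ^ 2)
        + (t - a ^ 2) ^ 2 * (a' ^ 2 - a ^ 2) / ((1 - a' ^ 2) * (1 - a ^ 2)) := by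
    field_simp
    ring
  rw [e]
  have b1 : |(a * (a - a') * (2 * t - a * a' - a ^ 2)) / (1 - a' ^ 2)| ≤ 4 * ε / (s ^ 2 / 2) := by
    rw [abs_div, abs_of_pos hp1]
    have : |2 * t - a * a' - a ^ 2| ≤ 4 := abs_le.mpr ⟨by nlinarith, by nlinarith⟩
    have : |a * (a - a') * (2 * t - a * a' - a ^ 2)| ≤ 4 * ε := by
      rw [abs_mul, abs_mul, abs_of_nonneg ha0, abs_sub_comm, mul_comm (4 : ℝ)]
      refine mul_le_mul ?_ this (abs_nonneg _) hε
      nlinarith [abs_nonneg (a' - a)]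
    gcongr
  have b2 : |(t - a ^ 2) ^ 2 * (a' ^ 2 - a ^ 2) / ((1 - a' ^ 2) * (1 - a ^ 2))|
      ≤ 3 * ε / (s ^ 2 / 2 * s ^ 2) := by
    rw [abs_div, abs_of_pos (mul_pos hp1 hp0)]
    have : |(t - a ^ 2) ^ 2 * (a' ^ 2 - a ^ 2)| ≤ 3 * ε := by
      rw [abs_mul, abs_of_nonneg (sq_nonneg _)]
      have : (t - a ^ 2) ^ 2 ≤ 1 := by
        rw [sq_le_one_iff_abs_le_one, abs_le]
        constructor <;> nlinarith
      nlinarith [abs_nonneg (a' ^ 2 - a ^ 2)]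
    gcongr
  have e2 : 4 * ε / (s ^ 2 / 2) ≤ 8 / s ^ 4 * ε := by
    have : 4 * ε / (s ^ 2 / 2) = 8 * ε * s ^ 2 / s ^ 4 := by field_simp; ring
    rw [this, show 8 / s ^ 4 * ε = 8 * ε * 1 / s ^ 4 by ring]
    gcongr
  have e3 : 3 * ε / (s ^ 2 / 2 * s ^ 2) = 6 / s ^ 4 * ε := by field_simp; ring
  calc _ ≤ _ := abs_add_le _ _
    _ ≤ 8 / s ^ 4 * ε + 6 / s ^ 4 * ε := by rw [e3] at b2; linarith
    _ = _ := by ring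

/-- The plane spanned by two non-parallel unit vectors, in coordinates. -/
lemma exists_orthogonal_decomposition {x c : EuclideanSpace ℝ ι} (hx : ‖x‖ = 1) (hc : ‖c‖ = 1)
    (h : 0 < 1 - inner ℝ x c ^ 2) :
    ∃ e : EuclideanSpace ℝ ι, ‖e‖ = 1 ∧ inner ℝ c e = 0 ∧
      x = (inner ℝ x c : ℝ) • c + Real.sqrt (1 - inner ℝ x c ^ 2) • e := by
  have hs : 0 < Real.sqrt (1 - inner ℝ x c ^ 2) := Real.sqrt_pos.mpr h
  have hn : ‖x - (inner ℝ x c : ℝ) • c‖ = Real.sqrt (1 - inner ℝ x c ^ 2) := by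
    rw [eq_comm, Real.sqrt_eq_iff_eq_sq h.le (norm_nonneg _), norm_sub_sq_real, inner_smul_right,
      norm_smul, hx, hc, Real.norm_eq_abs, mul_one, sq_abs]
    ring
  refine ⟨(Real.sqrt (1 - inner ℝ x c ^ 2))⁻¹ • (x - (inner ℝ x c : ℝ) • c), ?_, ?_, ?_⟩
  · rw [norm_smul, hn, norm_inv, Real.norm_eq_abs, abs_of_pos hs, inv_mul_cancel₀ hs.ne']
  · rw [inner_smul_right, inner_sub_right, inner_smul_right, real_inner_self_eq_norm_sq, hc,
      real_inner_comm]
    ring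
  · rw [smul_smul, mul_inv_cancel₀ hs.ne', one_smul]
    abel

lemma abs_mul_le_of_abs_le_one {a b B : ℝ} (ha : |a| ≤ 1) (hb : |b| ≤ B) : |a * b| ≤ B := by
  rw [abs_mul]
  exact (mul_le_of_le_one_left (abs_nonneg b) ha).trans hb

/-- A point of the plane that lies at inner products `≈ a` and `≈ t` from the unit vectors
`(1, 0)` and `(a', √(1 - a'²))` with `a' ≈ a` has squared norm at least about `γ²`. -/
lemma gamma_sub_le_norm_sq {a a' t ε s y₀ y₁ : ℝ} (ha0 : 0 ≤ a) (ha1 : a ≤ 1) (ht0 : 0 ≤ t)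
    (ht1 : t ≤ 1) (hs : 0 < s) (hsa : s ^ 2 ≤ 1 - a ^ 2) (hε : 0 ≤ ε) (hεs : 3 * ε ≤ s ^ 2 / 2)
    (h : |a' - a| ≤ ε) (ha'1 : |a'| ≤ 1) (hy1 : |y₁| ≤ 1) (hu1 : |y₀ - a| ≤ ε)
    (hu2 : |a' * y₀ + Real.sqrt (1 - a' ^ 2) * y₁ - t| ≤ ε) :
    a ^ 2 + (t - a ^ 2) ^ 2 / (1 - a ^ 2) - 28 / s ^ 4 * ε ≤ y₀ ^ 2 + y₁ ^ 2 := by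
  obtain ⟨hs', hγ⟩ := abs_gamma_perturb_le ha0 ha1 ht0 ht1 hs hsa hε hεs h
  have hpos : 0 < 1 - a' ^ 2 := lt_of_lt_of_le (by positivity) hs'
  obtain ⟨s', hs'd⟩ : ∃ s', s' = Real.sqrt (1 - a' ^ 2) := ⟨_, rfl⟩
  rw [← hs'd] at hu2
  have hs'2 : s' ^ 2 = 1 - a' ^ 2 := hs'd ▸ Real.sq_sqrt hpos.le
  have hs'1 : |s'| ≤ 1 := by
    rw [← sq_le_one_iff_abs_le_one, hs'2]; linarith [sq_nonneg a']
  have i1 : a ^ 2 - 2 * ε ≤ y₀ ^ 2 := by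
    have j := (abs_le.mp hu1).1
    have j2 : a * (y₀ - a) ≥ -ε := by nlinarith
    nlinarith [sq_nonneg (y₀ - a)]
  have i2 : |y₁ * s' - (t - a * a')| ≤ 2 * ε := by
    have e1 : y₁ * s' - (t - a * a') = (a' * y₀ + s' * y₁ - t) - a' * (y₀ - a) := by ring
    rw [e1]
    exact (abs_sub _ _).trans (by linarith [abs_mul_le_of_abs_le_one ha'1 hu1])
  have i3 : |y₁ * s' + (t - a * a')| ≤ 3 := by
    have j1 : |y₁ * s'| ≤ 1 := abs_mul_le_of_abs_le_one hy1 hs'1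
    have j2 : |a * a'| ≤ 1 := abs_mul_le_of_abs_le_one (by rwa [abs_of_nonneg ha0]) ha'1
    rw [abs_le] at j1 j2 ⊢
    constructor <;> linarith [j1.1, j1.2, j2.1, j2.2]
  have i4 : (t - a * a') ^ 2 - 6 * ε ≤ y₁ ^ 2 * (1 - a' ^ 2) := by
    have e1 : y₁ ^ 2 * (1 - a' ^ 2) - (t - a * a') ^ 2
        = (y₁ * s' - (t - a * a')) * (y₁ * s' + (t - a * a')) := by rw [← hs'2]; ring
    have e2 := abs_mul (y₁ * s' - (t - a * a')) (y₁ * s' + (t - a * a'))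
    have j : |y₁ * s' - (t - a * a')| * |y₁ * s' + (t - a * a')| ≤ 2 * ε * 3 :=
      mul_le_mul i2 i3 (abs_nonneg _) (by linarith)
    rw [← e2, ← e1] at j
    linarith [(abs_le.mp j).1]
  have i5 : (t - a * a') ^ 2 / (1 - a' ^ 2) - 12 / s ^ 2 * ε ≤ y₁ ^ 2 := by
    have j1 : ((t - a * a') ^ 2 - 6 * ε) / (1 - a' ^ 2) ≤ y₁ ^ 2 := by
      rw [div_le_iff₀ hpos]; exact i4
    have j2 : 6 * ε / (1 - a' ^ 2) ≤ 6 * ε / (s ^ 2 / 2) := by gcongr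
    have j3 : 6 * ε / (s ^ 2 / 2) = 12 / s ^ 2 * ε := by field_simp; ring
    rw [sub_div] at j1
    linarith
  have hss : s ^ 2 ≤ 1 := by linarith [sq_nonneg a]
  have hs4 : s ^ 4 ≤ s ^ 2 := by
    rw [show s ^ 4 = s ^ 2 * s ^ 2 by ring]
    exact mul_le_of_le_one_left (sq_nonneg s) hss
  have i6 : 12 / s ^ 2 * ε ≤ 12 / s ^ 4 * ε := by gcongr
  have i7 : 2 * ε ≤ 2 / s ^ 4 * ε := by
    gcongr
    rw [le_div_iff₀ (by positivity)]
    linarith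
  have i8 := (abs_le.mp hγ).1
  have i9 : 28 / s ^ 4 * ε = 14 / s ^ 4 * ε + 12 / s ^ 4 * ε + 2 / s ^ 4 * ε := by ring
  linarith

/-- The event that a point lies, up to the tolerance, at prescribed inner products from two given
unit vectors. -/
def nearBoth (ε a t : ℝ) (c x : EuclideanSpace ℝ ι) : Set (USphere ι) :=
  {u | ApproxEq ε (inner ℝ c (u : EuclideanSpace ℝ ι)) a ∧
    ApproxEq ε (inner ℝ x (u : EuclideanSpace ℝ ι)) t}

/-- For `⟨x, c⟩ ≈ a`, the set `nearBoth` has measure at most about `(1 - γ²) ^ (k / 2)`, where `γ² =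
a² + (t - a²)² / (1 - a²)`: the projections of its points to the plane spanned by `c` and `x` have
squared norm at least about `γ²`. -/
lemma prob_nearBoth_le (hk : Fintype.card ι = k + 2) (hk0 : 0 < k) {c x : EuclideanSpace ℝ ι}
    (hc : ‖c‖ = 1) (hx : ‖x‖ = 1) {a t ε s : ℝ} (ha0 : 0 ≤ a) (ha1 : a ≤ 1) (ht0 : 0 ≤ t)
    (ht1 : t ≤ 1) (hs : 0 < s) (hsa : s ^ 2 ≤ 1 - a ^ 2) (hε : 0 ≤ ε) (hεs : 3 * ε ≤ s ^ 2 / 2)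
    (h : |inner ℝ x c - a| ≤ ε) :
    (unifSphere ι).real (nearBoth ε a t c x)
      ≤ (k + 2) / 2 * Real.sqrt (1 - (a ^ 2 + (t - a ^ 2) ^ 2 / (1 - a ^ 2))
        + 28 / s ^ 4 * ε) ^ k := by
  obtain ⟨hs', hγ⟩ := abs_gamma_perturb_le ha0 ha1 ht0 ht1 hs hsa hε hεs h
  have hpos : 0 < 1 - inner ℝ x c ^ 2 := lt_of_lt_of_le (by positivity) hs'
  obtain ⟨e, he, hce, hxe⟩ := exists_orthogonal_decomposition hx hc hpos
  have : Nonempty ι := Fintype.card_pos_iff.mp (by omega)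
  set γ := a ^ 2 + (t - a ^ 2) ^ 2 / (1 - a ^ 2) with hγ'
  have hU := prob_plane_norm_ge_le hk hk0 hc he hce (γ - 28 / s ^ 4 * ε)
  rw [show 1 - (γ - 28 / s ^ 4 * ε) = 1 - γ + 28 / s ^ 4 * ε by ring] at hU
  refine (measureReal_mono ?_).trans hU
  rintro u ⟨hu1, hu2⟩
  set a' := inner ℝ x c
  have hxu : inner ℝ x (u : EuclideanSpace ℝ ι) = a' * inner ℝ c (u : EuclideanSpace ℝ ι)
      + Real.sqrt (1 - a' ^ 2) * inner ℝ e (u : EuclideanSpace ℝ ι) := by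
    conv_lhs => rw [hxe]
    rw [inner_add_left, real_inner_smul_left, real_inner_smul_left]
  have hy1 : |inner ℝ e (u : EuclideanSpace ℝ ι)| ≤ 1 := by
    have := abs_real_inner_le_norm e (u : EuclideanSpace ℝ ι)
    rwa [he, norm_usphere, mul_one] at this
  have ha'1 : |a'| ≤ 1 := by
    have := abs_real_inner_le_norm x c
    rwa [hx, hc, mul_one] at this
  rw [ApproxEq, hxu] at hu2
  exact gamma_sub_le_norm_sq ha0 ha1 ht0 ht1 hs hsa hε hεs h ha'1 hy1 hu1 hu2

/-- For `⟨x, c⟩ ≈ a`, the set `nearBoth` has measure at least about `(1 - γ²) ^ (k / 2)`. It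
contains the vectors whose projection to the plane spanned by `c` and `x` is close to the point that
satisfies both conditions exactly, and this point has squared norm `≈ γ²`. -/
lemma prob_nearBoth_ge (hk : Fintype.card ι = k + 2) {c x : EuclideanSpace ℝ ι}
    (hc : ‖c‖ = 1) (hx : ‖x‖ = 1) {a t ε s : ℝ} (ha0 : 0 ≤ a) (ha1 : a ≤ 1) (ht0 : 0 ≤ t)
    (ht1 : t ≤ 1) (hs : 0 < s) (hsa : s ^ 2 ≤ 1 - a ^ 2) (hε : 0 < ε) (hεs : 3 * ε ≤ s ^ 2 / 2)
    (hkε : 24 ≤ k * ε) (h : |inner ℝ x c - a| ≤ ε)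
    (hγ1 : 28 / s ^ 4 * ε ≤ 1 - (a ^ 2 + (t - a ^ 2) ^ 2 / (1 - a ^ 2))) :
    ε ^ 2 / 576 * ((1 - ε / 12) * Real.sqrt (1 - (a ^ 2 + (t - a ^ 2) ^ 2 / (1 - a ^ 2))
        - 28 / s ^ 4 * ε)) ^ k ≤ (unifSphere ι).real (nearBoth ε a t c x) := by
  obtain ⟨hs', hγ⟩ := abs_gamma_perturb_le ha0 ha1 ht0 ht1 hs hsa hε.le hεs h
  have hpos : 0 < 1 - inner ℝ x c ^ 2 := lt_of_lt_of_le (by positivity) hs'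
  obtain ⟨e, he, hce, hxe⟩ := exists_orthogonal_decomposition hx hc hpos
  have : Nonempty ι := Fintype.card_pos_iff.mp (by omega)
  set γ := a ^ 2 + (t - a ^ 2) ^ 2 / (1 - a ^ 2) with hγ'
  set a' := inner ℝ x c with ha'
  set s' := Real.sqrt (1 - a' ^ 2) with hs'd
  have hs'2 : s' ^ 2 = 1 - a' ^ 2 := Real.sq_sqrt hpos.le
  have hs'0 : 0 < s' := Real.sqrt_pos.mpr hpos
  have hs'1 : s' ≤ 1 := Real.sqrt_le_one.mpr (by linarith [sq_nonneg a'])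
  have ha'1 : |a'| ≤ 1 := by
    have := abs_real_inner_le_norm x c
    rwa [hx, hc, mul_one] at this
  have hz : ((t - a * a') / s') ^ 2 = (t - a * a') ^ 2 / (1 - a' ^ 2) := by
    rw [div_pow, hs'2]
  have hss : s ^ 2 ≤ 1 := by linarith [sq_nonneg a]
  have i8 := (abs_le.mp hγ).2
  have i9 : 0 ≤ 14 / s ^ 4 * ε := by positivity
  have i10 : 28 / s ^ 4 * ε = 14 / s ^ 4 * ε + 14 / s ^ 4 * ε := by ring
  have hab : a ^ 2 + ((t - a * a') / s') ^ 2 ≤ 1 := by rw [hz]; linarith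
  have hL := prob_plane_near_ge hk hc he hce (a := a) (b := (t - a * a') / s') (δ := ε / 3) hab
    (by linarith) (by linarith) (by linarith)
  have hmono : (unifSphere ι).real {u | |inner ℝ c (u : EuclideanSpace ℝ ι) - a| ≤ ε / 3 ∧
        |inner ℝ e (u : EuclideanSpace ℝ ι) - (t - a * a') / s'| ≤ ε / 3}
      ≤ (unifSphere ι).real (nearBoth ε a t c x) := by
    refine measureReal_mono ?_
    rintro u ⟨hu1, hu2⟩
    have hxu : inner ℝ x (u : EuclideanSpace ℝ ι) = a' * inner ℝ c (u : EuclideanSpace ℝ ι)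
        + s' * inner ℝ e (u : EuclideanSpace ℝ ι) := by
      conv_lhs => rw [hxe]
      rw [inner_add_left, real_inner_smul_left, real_inner_smul_left]
    refine ⟨hu1.trans (by linarith), ?_⟩
    rw [ApproxEq, hxu]
    generalize inner ℝ c (u : EuclideanSpace ℝ ι) = y₀ at *
    generalize inner ℝ e (u : EuclideanSpace ℝ ι) = y₁ at *
    have e1 : a' * y₀ + s' * y₁ - t = a' * (y₀ - a) + s' * (y₁ - (t - a * a') / s') := by
      field_simp; ring
    rw [e1]
    have j1 : |a' * (y₀ - a)| ≤ ε / 3 := abs_mul_le_of_abs_le_one ha'1 hu1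
    have j2 : |s' * (y₁ - (t - a * a') / s')| ≤ ε / 3 :=
      abs_mul_le_of_abs_le_one (by rwa [abs_of_pos hs'0]) hu2
    exact (abs_add_le _ _).trans (by linarith)
  refine le_trans ?_ (hL.trans hmono)
  rw [hz]
  have e1 : (ε / 3) ^ 2 / 64 = ε ^ 2 / 576 := by ring
  have e2 : 1 - ε / 3 / 4 = 1 - ε / 12 := by ring
  rw [e1, e2]
  have : 0 ≤ 1 - ε / 12 := by linarith
  have e3 : 1 - γ - 28 / s ^ 4 * ε ≤ 1 - a ^ 2 - (t - a * a') ^ 2 / (1 - a' ^ 2) := by linarith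
  gcongr

end geometry

/-! ### Blocks of coordinates -/

section blocks

variable {d b : ℕ}

lemma blockIndex_lt (j : Fin d) (hb : 0 < b) : (j : ℕ) * b / d < b := by
  have hd : 0 < d := j.pos
  rw [Nat.div_lt_iff_lt_mul hd, mul_comm b d]
  exact Nat.mul_lt_mul_of_pos_right j.2 hb

/-- Every coordinate lies in exactly one block. -/
def sigmaBlockEquiv (d : ℕ) (hb : 0 < b) : (Σ i, Block d b i) ≃ Fin d where
  toFun p := p.2.1
  invFun j := ⟨⟨(j : ℕ) * b / d, blockIndex_lt j hb⟩, ⟨j, rfl⟩⟩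
  left_inv := by
    rintro ⟨i, j, hj⟩
    have : (⟨(j : ℕ) * b / d, blockIndex_lt j hb⟩ : Fin b) = i := Fin.ext hj
    subst this
    rfl
  right_inv j := rfl

lemma sum_blocks (hb : 0 < b) (F : Fin d → ℝ) : ∑ j, F j = ∑ i, ∑ j : Block d b i, F j.1 := by
  rw [← (sigmaBlockEquiv d hb).sum_comp F, Fintype.sum_sigma]
  rfl

lemma sum_card_block (hb : 0 < b) : ∑ i, Fintype.card (Block d b i) = d := by
  have := Fintype.card_congr (sigmaBlockEquiv (b := b) d hb)
  rw [Fintype.card_sigma, Fintype.card_fin] at this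
  exact this

/-- A block has at least `⌊d / b⌋` coordinates. -/
lemma le_card_block (hb : 0 < b) (i : Fin b) : d / b ≤ Fintype.card (Block d b i) := by
  rcases Nat.eq_zero_or_pos (d / b) with h0 | h0
  · omega
  have hd : 0 < d := Nat.pos_of_ne_zero fun h => by simp [h] at h0
  -- the first coordinate of the block is `j₀ = ⌈i d / b⌉`
  obtain ⟨j₀, hj₀⟩ : ∃ j₀, j₀ = ((i : ℕ) * d + b - 1) / b := ⟨_, rfl⟩
  have h1 : (i : ℕ) * d ≤ j₀ * b := by
    have := Nat.lt_div_mul_add (a := (i : ℕ) * d + b - 1) hb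
    rw [← hj₀] at this
    omega
  have h2 : j₀ * b ≤ (i : ℕ) * d + b - 1 := hj₀ ▸ Nat.div_mul_le_self _ _
  have h3 : d / b * b ≤ d := Nat.div_mul_le_self _ _
  have hi : ((i : ℕ) + 1) * d ≤ b * d := Nat.mul_le_mul_right d i.2
  have h4 : ∀ t < d / b, (i : ℕ) * d ≤ (j₀ + t) * b ∧ (j₀ + t) * b < i * d + d := by
    intro t ht
    have : (t + 1) * b ≤ d / b * b := Nat.mul_le_mul_right b ht
    rw [add_mul] at this ⊢
    constructor <;> omega
  have h5 : ∀ t < d / b, j₀ + t < d := by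
    intro t ht
    have := (h4 t ht).2
    rw [add_mul, one_mul, mul_comm b d] at hi
    exact Nat.lt_of_mul_lt_mul_right (this.trans_le hi)
  let f : Fin (d / b) → Block d b i := fun t => ⟨⟨j₀ + t, h5 t t.2⟩, by
    rw [Nat.div_eq_iff hd]
    have := h4 t t.2
    exact ⟨this.1, by have := this.2; simp only; omega⟩⟩
  have hf : Function.Injective f := by
    intro s t hst
    have : j₀ + (s : ℕ) = j₀ + t := congrArg (fun z : Block d b i => (z.1 : ℕ)) hst
    exact Fin.ext (by omega)
  simpa using Fintype.card_le_of_injective f hf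

/-- A block has at most `⌊d / b⌋ + 1` coordinates. -/
lemma card_block_le (hb : 0 < b) (i : Fin b) : Fintype.card (Block d b i) ≤ d / b + 1 := by
  rcases Nat.eq_zero_or_pos d with rfl | hd
  · have : IsEmpty (Block 0 b i) := ⟨fun j => j.1.elim0⟩
    simp
  -- the first coordinate of the block is `j₀ = ⌈i d / b⌉`
  obtain ⟨j₀, hj₀⟩ : ∃ j₀, j₀ = ((i : ℕ) * d + b - 1) / b := ⟨_, rfl⟩
  have h1 : (i : ℕ) * d ≤ j₀ * b := by
    have := Nat.lt_div_mul_add (a := (i : ℕ) * d + b - 1) hb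
    rw [← hj₀] at this
    omega
  have h2 : ∀ j : Block d b i, j₀ ≤ (j.1 : ℕ) ∧ (j.1 : ℕ) < j₀ + (d / b + 1) := by
    intro j
    have hj := (Nat.div_eq_iff hd).mp j.2
    constructor
    · have h5 : j₀ * b ≤ (i : ℕ) * d + b - 1 := hj₀ ▸ Nat.div_mul_le_self _ _
      by_contra hcon
      push Not at hcon
      have : ((j.1 : ℕ) + 1) * b ≤ j₀ * b := Nat.mul_le_mul_right b hcon
      rw [add_mul] at this
      omega
    · by_contra hcon
      push Not at hcon
      have h5 : (j₀ + (d / b + 1)) * b ≤ j.1 * b := Nat.mul_le_mul_right b hcon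
      have h6 := Nat.lt_div_mul_add (a := d) hb
      rw [add_mul, add_mul] at h5
      omega
  let f : Block d b i → Fin (d / b + 1) := fun j => ⟨(j.1 : ℕ) - j₀, by have := h2 j; omega⟩
  have hf : Function.Injective f := by
    intro s t hst
    have h3 : (s.1 : ℕ) - j₀ = (t.1 : ℕ) - j₀ := congrArg (fun z : Fin (d / b + 1) => (z : ℕ)) hst
    have h4 := h2 s
    have h5 := h2 t
    exact Subtype.ext (Fin.ext (by omega))
  simpa using Fintype.card_le_of_injective f hf

/-- The coordinates of `y` in the `i`-th block. -/
def blockProj (d b : ℕ) (i : Fin b) (y : EuclideanSpace ℝ (Fin d)) :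
    EuclideanSpace ℝ (Block d b i) :=
  WithLp.toLp 2 fun j => y j.1

lemma norm_sq_eq_sum_blockProj (hb : 0 < b) (y : EuclideanSpace ℝ (Fin d)) :
    ‖y‖ ^ 2 = ∑ i, ‖blockProj d b i y‖ ^ 2 := by
  simp_rw [EuclideanSpace.norm_sq_eq]
  exact sum_blocks hb fun j => ‖y j‖ ^ 2

lemma blockVec_apply (s : (i : Fin b) → USphere (Block d b i)) (i : Fin b) (j : Block d b i) :
    blockVec s j.1 = 1 / Real.sqrt b * (s i).1 j := by
  simp only [blockVec]
  rw [Finset.sum_eq_single i, dif_pos j.2]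
  · intro i' _ hi'
    rw [dif_neg]
    intro h
    exact hi' (Fin.ext (h.symm.trans j.2))
  · simp

lemma blockProj_blockVec (s : (i : Fin b) → USphere (Block d b i)) (i : Fin b) :
    blockProj d b i (blockVec s) = (1 / Real.sqrt b) • (s i : EuclideanSpace ℝ (Block d b i)) := by
  ext j
  exact blockVec_apply s i j

lemma inner_eq_sum_blockProj (hb : 0 < b) (x y : EuclideanSpace ℝ (Fin d)) :
    inner ℝ x y = ∑ i, inner ℝ (blockProj d b i x) (blockProj d b i y) := by
  simp only [PiLp.inner_apply]
  exact sum_blocks hb fun j => inner ℝ (x j) (y j)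

lemma norm_blockVec (hb : 0 < b) (s : (i : Fin b) → USphere (Block d b i)) : ‖blockVec s‖ = 1 := by
  have hb' : (0 : ℝ) < b := by exact_mod_cast hb
  rw [← sq_eq_sq₀ (norm_nonneg _) zero_le_one, norm_sq_eq_sum_blockProj hb]
  simp_rw [blockProj_blockVec, norm_smul, norm_usphere, mul_one, Real.norm_eq_abs, sq_abs, div_pow,
    Real.sq_sqrt hb'.le]
  simp [hb'.ne']

/-- Splitting the coordinates of a real vector into blocks. -/
def blockMeasurableEquiv (d : ℕ) (hb : 0 < b) :
    ((i : Fin b) → Block d b i → ℝ) ≃ᵐ (Fin d → ℝ) where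
  toFun g j := g ⟨(j : ℕ) * b / d, blockIndex_lt j hb⟩ ⟨j, rfl⟩
  invFun f i j := f j.1
  left_inv g := by
    funext i ⟨j, hj⟩
    have : (⟨(j : ℕ) * b / d, blockIndex_lt j hb⟩ : Fin b) = i := Fin.ext hj
    subst this
    rfl
  right_inv f := rfl
  measurable_toFun := by
    refine measurable_pi_lambda _ fun j => ?_
    exact (measurable_pi_apply (⟨j, rfl⟩ : Block d b ⟨(j : ℕ) * b / d, blockIndex_lt j hb⟩)).comp
      (measurable_pi_apply (⟨(j : ℕ) * b / d, blockIndex_lt j hb⟩ : Fin b))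
  measurable_invFun := by
    refine measurable_pi_lambda _ fun i => measurable_pi_lambda _ fun j => ?_
    exact measurable_pi_apply j.1

lemma measurePreserving_blockMeasurableEquiv (hb : 0 < b) :
    MeasurePreserving (blockMeasurableEquiv d hb) := by
  refine ⟨(blockMeasurableEquiv d hb).measurable, ?_⟩
  refine (Measure.pi_eq (μ := fun _ : Fin d => (volume : Measure ℝ)) fun s hs => ?_).symm
  rw [MeasurableEquiv.map_apply]
  have e : (blockMeasurableEquiv d hb) ⁻¹' Set.pi Set.univ s
      = Set.pi Set.univ fun i => Set.pi Set.univ fun j : Block d b i => s j.1 := by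
    ext g
    simp only [Set.mem_preimage, Set.mem_univ_pi]
    constructor
    · intro h i j
      have h1 := h j.1
      obtain ⟨j, hj⟩ := j
      have : (⟨(j : ℕ) * b / d, blockIndex_lt j hb⟩ : Fin b) = i := Fin.ext hj
      subst this
      exact h1
    · intro h j
      exact h _ ⟨j, rfl⟩
  rw [e, volume_pi_pi]
  simp_rw [volume_pi_pi]
  rw [← (sigmaBlockEquiv d hb).prod_comp, Fintype.prod_sigma]
  rfl

lemma measurePreserving_blockProj (hb : 0 < b) :
    MeasurePreserving (fun (y : EuclideanSpace ℝ (Fin d)) (i : Fin b) => blockProj d b i y) := by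
  have h1 : MeasurePreserving (@WithLp.ofLp 2 (Fin d → ℝ)) := PiLp.volume_preserving_ofLp _
  have h2 := (measurePreserving_blockMeasurableEquiv (d := d) hb).symm
  have h3 : MeasurePreserving (fun (g : (i : Fin b) → Block d b i → ℝ) (i : Fin b) =>
      (WithLp.toLp 2 (g i) : EuclideanSpace ℝ (Block d b i))) :=
    volume_preserving_pi fun i => PiLp.volume_preserving_toLp _
  exact h3.comp (h2.comp h1)

/-- Volume on `ℝ ^ d` is the product of the volumes on the coordinate spaces of the blocks. -/
lemma volume_blockProj_mem (hb : 0 < b) {S : (i : Fin b) → Set (EuclideanSpace ℝ (Block d b i))}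
    (hS : ∀ i, MeasurableSet (S i)) :
    volume.real {y : EuclideanSpace ℝ (Fin d) | ∀ i, blockProj d b i y ∈ S i}
      = ∏ i, volume.real (S i) := by
  have h := (measurePreserving_blockProj (d := d) hb).measure_preimage
    (MeasurableSet.univ_pi hS).nullMeasurableSet
  rw [volume_pi_pi] at h
  simp only [Measure.real]
  rw [← ENNReal.toReal_prod, ← h]
  congr 2
  ext y
  simp

lemma measurableSet_conePart {ι : Type} [Fintype ι] {I : Set ℝ} (hI : MeasurableSet I)
    (hI0 : I ⊆ Set.Ioi 0) {A : Set (USphere ι)} (hA : MeasurableSet A) :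
    MeasurableSet (conePart I A) := by
  have he : MeasurableEmbedding
      (Subtype.val ∘ (homeomorphUnitSphereProd (EuclideanSpace ℝ ι)).symm) :=
    (MeasurableEmbedding.subtype_coe (measurableSet_singleton _).compl).comp
      (Homeomorph.measurableEmbedding _)
  have e : conePart I A = (Subtype.val ∘ (homeomorphUnitSphereProd (EuclideanSpace ℝ ι)).symm) ''
      (A ×ˢ (Subtype.val ⁻¹' I)) := by
    ext y
    rw [mem_conePart]
    constructor
    · rintro ⟨t, ht, u, hu, rfl⟩
      exact ⟨(u, ⟨t, hI0 ht⟩), ⟨hu, ht⟩, by simp⟩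
    · rintro ⟨⟨u, t⟩, ⟨hu, ht⟩, rfl⟩
      exact ⟨t, ht, u, hu, by simp⟩
  rw [e]
  exact he.measurableSet_image.mpr (hA.prod (measurable_subtype_coe hI))

end blocks

/-! ### Rotations, and the sets covered by a block code -/

section rotation

variable {d : ℕ}

/-- A rotation matrix as an isometry. -/
noncomputable def rotIso (Q : SO d) : EuclideanSpace ℝ (Fin d) ≃ₗᵢ[ℝ] EuclideanSpace ℝ (Fin d) :=
  Unitary.linearIsometryEquiv
    ⟨Matrix.toEuclideanCLM (n := Fin d) (𝕜 := ℝ) (Q : Matrix (Fin d) (Fin d) ℝ),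
      Unitary.map_mem (Matrix.toEuclideanCLM (n := Fin d) (𝕜 := ℝ))
        (Matrix.mem_specialOrthogonalGroup_iff.mp Q.2).1⟩

lemma rotIso_apply (Q : SO d) (x : EuclideanSpace ℝ (Fin d)) :
    rotIso Q x = Matrix.toEuclideanLin (Q : Matrix (Fin d) (Fin d) ℝ) x := rfl

end rotation

section cover

variable {ι : Type} [Fintype ι]

/-- The points of the sphere with inner product `≈ a` with some vector of the list `c`. -/
def coverSet {K : ℕ} (δ a : ℝ) (c : Fin K → USphere ι) : Set (USphere ι) :=
  {u | ∃ k, ApproxEq δ (inner ℝ (u : EuclideanSpace ℝ ι) (c k : EuclideanSpace ℝ ι)) a}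

lemma measurableSet_approxEq {X : Type*} [MeasurableSpace X] {f : X → ℝ} (hf : Measurable f)
    (δ a : ℝ) : MeasurableSet {x | ApproxEq δ (f x) a} :=
  measurableSet_le (f := fun x => |f x - a|) (hf.sub_const a).abs measurable_const

lemma measurableSet_coverSet {K : ℕ} (δ a : ℝ) (c : Fin K → USphere ι) :
    MeasurableSet (coverSet δ a c) := by
  have : coverSet δ a c = ⋃ k, {u : USphere ι | ApproxEq δ
      (inner ℝ (u : EuclideanSpace ℝ ι) (c k : EuclideanSpace ℝ ι)) a} := by
    ext u
    simp [coverSet]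
  rw [this]
  exact MeasurableSet.iUnion fun k => measurableSet_approxEq (by fun_prop) δ a

end cover

/-! ### Vectors matched by a product code -/

section productCode

variable {d b : ℕ}

lemma abs_mul_sub_le {r t a δ : ℝ} (hr0 : 1 - δ ≤ r) (hr1 : r < 1) (hr : 0 ≤ r)
    (ha : |a| ≤ 1) (h : |t - a| ≤ δ) : |r * t - a| ≤ 2 * δ := by
  have e : r * t - a = r * (t - a) - (1 - r) * a := by ring
  rw [e]
  have h1 : |r * (t - a)| ≤ δ := abs_mul_le_of_abs_le_one (by rw [abs_of_nonneg hr]; exact hr1.le) h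
  have h2 : |(1 - r) * a| ≤ δ := by
    rw [mul_comm]
    exact abs_mul_le_of_abs_le_one ha (by rw [abs_of_pos (by linarith)]; linarith)
  exact (abs_sub _ _).trans (by linarith)

/-- Vectors whose blocks have almost equal norms and whose block directions are covered by the
block codes are, after normalisation, matched by the product code. -/
lemma blocks_subset_conePart (hb : 0 < b) {K : ℕ} {δ a : ℝ} (hδ1 : δ < 1)
    (ha : |a| ≤ 1) (c : (i : Fin b) → Fin K → USphere (Block d b i)) :
    {y : EuclideanSpace ℝ (Fin d) | ∀ i, blockProj d b i y ∈
      conePart (Set.Ico ((1 - δ) * (1 / Real.sqrt b)) (1 / Real.sqrt b)) (coverSet δ a (c i))} ⊆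
    conePart (Set.Ioo 0 1) {u : USphere (Fin d) | (u : EuclideanSpace ℝ (Fin d)) ∈
      {y : EuclideanSpace ℝ (Fin d) | ∃ k : Fin b → Fin K,
        ApproxEq (3 * δ) (inner ℝ y (blockVec fun i => c i (k i))) a}} := by
  have hb' : (0 : ℝ) < b := by exact_mod_cast hb
  have hsb : 0 < Real.sqrt b := Real.sqrt_pos.mpr hb'
  have hsb2 : Real.sqrt b ^ 2 = b := Real.sq_sqrt hb'.le
  have : Nonempty (Fin b) := ⟨⟨0, hb⟩⟩
  intro y hy
  have hy' : ∀ i, ∃ r ∈ Set.Ico (1 - δ) 1, ∃ (u : USphere (Block d b i)) (k : Fin K),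
      ApproxEq δ (inner ℝ (u : EuclideanSpace ℝ (Block d b i)) (c i k)) a ∧
      blockProj d b i y = (r / Real.sqrt b) • (u : EuclideanSpace ℝ (Block d b i)) := by
    intro i
    obtain ⟨t, ht, u, ⟨k, hk⟩, h⟩ := mem_conePart.mp (hy i)
    refine ⟨t * Real.sqrt b, ⟨?_, ?_⟩, u, k, hk, ?_⟩
    · have := ht.1
      rwa [mul_one_div, div_le_iff₀ hsb] at this
    · have := ht.2
      rwa [lt_div_iff₀ hsb] at this
    · rw [mul_div_cancel_right₀ _ hsb.ne', h]
  choose r hr u k hk hproj using hy'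
  have hr0 : ∀ i, 0 < r i := fun i => by linarith [(hr i).1]
  have hnorm : ‖y‖ ^ 2 = ∑ i, r i ^ 2 / b := by
    rw [norm_sq_eq_sum_blockProj hb]
    refine Finset.sum_congr rfl fun i _ => ?_
    rw [hproj, norm_smul, norm_usphere, mul_one, Real.norm_eq_abs, sq_abs, div_pow, hsb2]
  have hy1 : ‖y‖ < 1 := by
    rw [← sq_lt_one_iff₀ (norm_nonneg _), hnorm]
    have : ∑ i : Fin b, r i ^ 2 / b < ∑ _i : Fin b, 1 / (b : ℝ) := by
      refine Finset.sum_lt_sum_of_nonempty Finset.univ_nonempty fun i _ => ?_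
      gcongr
      exact (sq_lt_one_iff₀ (hr0 i).le).mpr (hr i).2
    simpa [hb'.ne'] using this
  have hy2 : 1 - δ ≤ ‖y‖ := by
    rw [← sq_le_sq₀ (by linarith) (norm_nonneg _), hnorm]
    have : ∑ _i : Fin b, (1 - δ) ^ 2 / (b : ℝ) ≤ ∑ i : Fin b, r i ^ 2 / b := by
      refine Finset.sum_le_sum fun i _ => ?_
      gcongr
      exact (hr i).1
    refine le_trans (le_of_eq ?_) this
    simp only [Finset.sum_const, Finset.card_univ, Fintype.card_fin, nsmul_eq_mul]
    field_simp
  have hy0 : 0 < ‖y‖ := by linarith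
  refine mem_conePart_Ioo_of_norm (norm_pos_iff.mp hy0) hy1 ⟨k, ?_⟩
  have hv : ‖blockVec fun i => c i (k i)‖ = 1 := norm_blockVec hb _
  have hin : inner ℝ y (blockVec fun i => c i (k i)) = (1 / b) * ∑ i, r i *
      inner ℝ (u i : EuclideanSpace ℝ (Block d b i)) (c i (k i)) := by
    rw [inner_eq_sum_blockProj hb, Finset.mul_sum]
    refine Finset.sum_congr rfl fun i _ => ?_
    rw [hproj, blockProj_blockVec, real_inner_smul_left, inner_smul_right]
    have hbb : 1 / (b : ℝ) = 1 / Real.sqrt b * (1 / Real.sqrt b) := by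
      rw [div_mul_div_comm, one_mul, Real.mul_self_sqrt hb'.le]
    rw [hbb]
    ring
  have h1 : |inner ℝ y (blockVec fun i => c i (k i)) - a| ≤ 2 * δ := by
    have e : inner ℝ y (blockVec fun i => c i (k i)) - a = (1 / b) * ∑ i, (r i *
      inner ℝ (u i : EuclideanSpace ℝ (Block d b i)) (c i (k i)) - a) := by
      rw [hin, Finset.sum_sub_distrib]
      simp only [Finset.sum_const, Finset.card_univ, Fintype.card_fin, nsmul_eq_mul]
      field_simp
    rw [e, abs_mul, abs_of_pos (by positivity), one_div, inv_mul_le_iff₀ hb']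
    refine (Finset.abs_sum_le_sum_abs _ _).trans ?_
    have : ∑ i, |r i * inner ℝ (u i : EuclideanSpace ℝ (Block d b i)) (c i (k i)) - a|
        ≤ ∑ _i : Fin b, 2 * δ :=
      Finset.sum_le_sum fun i _ => abs_mul_sub_le (hr i).1 (hr i).2 (hr0 i).le ha (hk i)
    simpa using this
  have h2 := abs_inner_normalize_sub_le hv hy0 hy1.le
  rw [real_inner_comm, real_inner_comm y] at h2
  have e : inner ℝ (‖y‖⁻¹ • y) (blockVec fun i => c i (k i)) - a
      = (inner ℝ (‖y‖⁻¹ • y) (blockVec fun i => c i (k i))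
          - inner ℝ y (blockVec fun i => c i (k i)))
        + (inner ℝ y (blockVec fun i => c i (k i)) - a) := by ring
  rw [ApproxEq, e]
  exact (abs_add_le _ _).trans (by linarith)

/-- A shell of relative thickness `δ ≥ 1 / n` carries at least half of the volume of the ball of
dimension `n`. -/
lemma one_sub_pow_le_half {δ : ℝ} (hδ1 : δ ≤ 1) {n : ℕ} (hn : 1 ≤ n * δ) :
    (1 - δ) ^ n ≤ 1 / 2 := by
  have i1 : (1 - δ) ^ n ≤ Real.exp (-δ) ^ n :=
    pow_le_pow_left₀ (by linarith) (Real.one_sub_le_exp_neg _) n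
  rw [← Real.exp_nat_mul] at i1
  have i2 : Real.exp (n * -δ) ≤ Real.exp (-1) := Real.exp_le_exp.mpr (by linarith)
  have i3 : Real.exp (-1) ≤ 1 / 2 := by
    rw [Real.exp_neg, ← one_div]
    exact one_div_le_one_div_of_le (by norm_num) (by linarith [Real.exp_one_gt_d9])
  linarith

/-- The product of the balls of radius `1 / √b` in the blocks fills all but a quasi-polynomial
factor of the unit ball of `ℝ ^ d`. By Stirling, a ball of dimension `n ≈ d / b` and radius `1 / √b`
has volume about `(2 π e / (b n)) ^ (n / 2)`, with `b n ≤ d + b`, and these powers multiply to the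
volume of the unit ball up to the factor `exp (-b)`. -/
lemma prod_block_volumes_ge (hb : 0 < b) (hbd : b ≤ d) [∀ i : Fin b, Nonempty (Block d b i)] :
    Real.exp (-b) * ((8 * (d : ℝ)) ^ b)⁻¹ * ballVol (Fin d)
      ≤ ∏ i : Fin b, ((1 / Real.sqrt b) ^ Fintype.card (Block d b i) * ballVol (Block d b i)) := by
  have hd : 0 < d := hb.trans_le hbd
  have : Nonempty (Fin d) := ⟨⟨0, hd⟩⟩
  have hb' : (0 : ℝ) < b := by exact_mod_cast hb
  have hd' : (0 : ℝ) < d := by exact_mod_cast hd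
  set C : ℝ := 2 * Real.pi * Real.exp 1 with hC
  have hC0 : 0 < C := by positivity
  set q : ℝ := C / (d + b) with hq
  have hq0 : 0 < q := by positivity
  have key : ∀ i : Fin b, q ^ ((Fintype.card (Block d b i) : ℝ) / 2) * (8 * (d : ℝ))⁻¹
      ≤ (1 / Real.sqrt b) ^ Fintype.card (Block d b i) * ballVol (Block d b i) := by
    intro i
    have h1 := card_block_le (d := d) hb i
    have h0 : 0 < Fintype.card (Block d b i) := Fintype.card_pos
    have hnd : Fintype.card (Block d b i) ≤ d := by
      have := Fintype.card_subtype_le fun j : Fin d => (j : ℕ) * b / d = (i : ℕ)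
      rwa [Fintype.card_fin] at this
    have hg := ballVol_ge (ι := Block d b i)
    generalize Fintype.card (Block d b i) = n at *
    have hn0 : (0 : ℝ) < n := by exact_mod_cast h0
    have h2 : n * b ≤ d + b := by
      calc n * b ≤ (d / b + 1) * b := Nat.mul_le_mul_right b h1
        _ ≤ d + b := by rw [add_mul, one_mul]; linarith [Nat.div_mul_le_self d b]
    have h2' : (n : ℝ) * b ≤ d + b := by exact_mod_cast h2
    have hnd' : (n : ℝ) ≤ d := by exact_mod_cast hnd
    have e1 : (1 / Real.sqrt b) ^ n = (1 / b : ℝ) ^ ((n : ℝ) / 2) := by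
      rw [one_div, ← Real.sqrt_inv, Real.sqrt_eq_rpow, ← Real.rpow_natCast,
        ← Real.rpow_mul (by positivity), one_div,
        show (2⁻¹ : ℝ) * n = n / 2 by ring, one_div]
    calc q ^ ((n : ℝ) / 2) * (8 * (d : ℝ))⁻¹
        ≤ (1 / b * (C / n)) ^ ((n : ℝ) / 2) * (8 * (n : ℝ))⁻¹ := by
          gcongr
          rw [hq, one_div, inv_mul_eq_div, div_div]
          gcongr
      _ = (1 / Real.sqrt b) ^ n * ((C / n) ^ ((n : ℝ) / 2) / (8 * n)) := by
          rw [Real.mul_rpow (by positivity) (by positivity), e1]; ring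
      _ ≤ _ := by gcongr
  have hprod := Finset.prod_le_prod (s := Finset.univ) (fun i _ => by positivity)
    (fun i (_ : i ∈ Finset.univ) => key i)
  refine le_trans ?_ hprod
  rw [Finset.prod_mul_distrib, ← Real.rpow_sum_of_pos hq0, ← Finset.sum_div, ← Nat.cast_sum,
    sum_card_block hb, Finset.prod_const, Finset.card_univ, Fintype.card_fin, inv_pow]
  have hle := ballVol_le (ι := Fin d)
  rw [Fintype.card_fin] at hle
  -- replacing `d` by `d + b` in the base costs a factor `exp (-b)`
  have e2 : Real.exp (-b) * ballVol (Fin d) ≤ q ^ ((d : ℝ) / 2) := by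
    have e3 : Real.exp (-(b : ℝ)) ≤ (d / (d + b : ℝ)) ^ ((d : ℝ) / 2) := by
      have e5 : 1 - (b : ℝ) / (d + b) = d / (d + b) := by field_simp; ring
      have e4 := exp_neg_two_mul_le (y := (b : ℝ) / (d + b)) (by positivity) (by
        have : (b : ℝ) ≤ d := by exact_mod_cast hbd
        rw [div_le_iff₀ (by positivity)]; linarith)
      rw [e5] at e4
      calc Real.exp (-(b : ℝ)) ≤ Real.exp (-(2 * ((b : ℝ) / (d + b)))) ^ ((d : ℝ) / 2) := by
            rw [← Real.exp_mul]
            apply Real.exp_le_exp.mpr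
            have : (b : ℝ) / (d + b) * d ≤ b := by
              rw [div_mul_eq_mul_div, div_le_iff₀ (by positivity)]
              nlinarith
            linarith
        _ ≤ _ := by gcongr
    calc Real.exp (-b) * ballVol (Fin d)
        ≤ (d / (d + b : ℝ)) ^ ((d : ℝ) / 2) * (C / d) ^ ((d : ℝ) / 2) := by
          gcongr; exact ballVol_pos.le
      _ = q ^ ((d : ℝ) / 2) := by
          rw [← Real.mul_rpow (by positivity) (by positivity), hq]
          congr 1
          field_simp
  calc _ = (Real.exp (-b) * ballVol (Fin d)) * ((8 * (d : ℝ)) ^ b)⁻¹ := by ring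
    _ ≤ _ := by gcongr

/-- The share of the sphere matched by a product code is at least, up to a quasi-polynomial factor,
the product of the shares of the block spheres covered by the block codes. -/
lemma prob_code_match_ge (hb : 0 < b) (hbd : b ≤ d) [∀ i : Fin b, Nonempty (Block d b i)] {K : ℕ}
    {δ a : ℝ} (hδ0 : 0 < δ) (hδ1 : δ < 1) (ha : |a| ≤ 1) (hn : 1 ≤ ((d / b : ℕ) : ℝ) * δ)
    (c : (i : Fin b) → Fin K → USphere (Block d b i))
    (g : EuclideanSpace ℝ (Fin d) ≃ₗᵢ[ℝ] EuclideanSpace ℝ (Fin d)) :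
    Real.exp (-b) * ((16 * (d : ℝ)) ^ b)⁻¹ *
        ∏ i, (unifSphere (Block d b i)).real (coverSet δ a (c i))
      ≤ (unifSphere (Fin d)).real {u | ∃ k : Fin b → Fin K, ApproxEq (3 * δ)
        (inner ℝ (u : EuclideanSpace ℝ (Fin d)) (g (blockVec fun i => c i (k i)))) a} := by
  have hd : 0 < d := hb.trans_le hbd
  have : Nonempty (Fin d) := ⟨⟨0, hd⟩⟩
  have hb' : (0 : ℝ) < b := by exact_mod_cast hb
  set T : Set (EuclideanSpace ℝ (Fin d)) := {y | ∃ k : Fin b → Fin K,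
        ApproxEq (3 * δ) (inner ℝ y (blockVec fun i => c i (k i))) a} with hT
  have hTm : MeasurableSet T := by
    have : T = ⋃ k : Fin b → Fin K, {y : EuclideanSpace ℝ (Fin d) | ApproxEq (3 * δ)
        (inner ℝ y (blockVec fun i => c i (k i))) a} := by
      ext y
      simp [hT]
    rw [this]
    exact MeasurableSet.iUnion fun k => measurableSet_approxEq (by fun_prop) _ a
  -- by rotation invariance `g` may be removed
  have hiso := unifSphere_real_isometry g.symm hTm
  have e1 : {u : USphere (Fin d) | ∃ k : Fin b → Fin K, ApproxEq (3 * δ)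
        (inner ℝ (u : EuclideanSpace ℝ (Fin d)) (g (blockVec fun i => c i (k i)))) a}
      = {u : USphere (Fin d) | g.symm (u : EuclideanSpace ℝ (Fin d)) ∈ T} := by
    ext u
    simp only [hT, Set.mem_ofPred_eq]
    refine exists_congr fun k => ?_
    rw [← LinearIsometryEquiv.inner_map_map g.symm, LinearIsometryEquiv.symm_apply_apply]
  have hTm' : MeasurableSet {u : USphere (Fin d) | (u : EuclideanSpace ℝ (Fin d)) ∈ T} :=
    measurable_subtype_coe hTm
  rw [e1, hiso, unifSphere_real_eq hTm', le_div_iff₀ ballVol_pos]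
  -- the cone over `T` contains a product of cones over the covered sets, in thin shells
  set rb := 1 / Real.sqrt b with hrb
  have hrb0 : 0 < rb := by positivity
  have hr0 : 0 < (1 - δ) * rb := mul_pos (by linarith) hrb0
  have hle := measureReal_mono (blocks_subset_conePart (d := d) hb hδ1 ha c)
    (ne_top_of_le_ne_top (measure_ball_lt_top (μ := volume)
      (x := (0 : EuclideanSpace ℝ (Fin d))) (r := 1)).ne
      (measure_mono (conePart_Ioo_subset_ball _)))
  rw [volume_blockProj_mem hb (fun i => measurableSet_conePart measurableSet_Ico
    (fun t ht => hr0.trans_le ht.1) (measurableSet_coverSet δ a (c i)))] at hle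
  refine le_trans ?_ hle
  have key : ∀ i : Fin b, 1 / 2 * (rb ^ Fintype.card (Block d b i) * ballVol (Block d b i)) *
      (unifSphere (Block d b i)).real (coverSet δ a (c i))
      ≤ volume.real (conePart (Set.Ico ((1 - δ) * rb) rb) (coverSet δ a (c i))) := by
    intro i
    refine le_trans ?_ (volume_conePart_Ico_ge (measurableSet_coverSet δ a (c i)) hr0
      (by nlinarith))
    have h1 : ((d / b : ℕ) : ℝ) ≤ Fintype.card (Block d b i) := by
      exact_mod_cast le_card_block hb i
    have h2 : (1 - δ) ^ Fintype.card (Block d b i) ≤ 1 / 2 := by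
      refine one_sub_pow_le_half hδ1.le (hn.trans ?_)
      gcongr
    rw [mul_pow]
    have h3 : 0 ≤ rb ^ Fintype.card (Block d b i) * (ballVol (Block d b i) *
        (unifSphere (Block d b i)).real (coverSet δ a (c i))) := by
      have := (ballVol_pos (ι := Block d b i)).le
      positivity
    nlinarith
  have hprod := Finset.prod_le_prod (s := Finset.univ) (fun i _ => by
    have := (ballVol_pos (ι := Block d b i)).le
    positivity) (fun i (_ : i ∈ Finset.univ) => key i)
  refine le_trans ?_ hprod
  rw [Finset.prod_mul_distrib, Finset.prod_mul_distrib, Finset.prod_const, Finset.card_univ,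
    Fintype.card_fin]
  have h5 := prod_block_volumes_ge (d := d) hb hbd
  have h6 : (0 : ℝ) ≤ ∏ i, (unifSphere (Block d b i)).real (coverSet δ a (c i)) :=
    Finset.prod_nonneg fun i _ => measureReal_nonneg
  have e2 : ((16 * (d : ℝ)) ^ b)⁻¹ = (1 / 2) ^ b * ((8 * (d : ℝ)) ^ b)⁻¹ := by
    rw [show (16 * (d : ℝ)) = 2 * (8 * d) by ring, mul_pow 2, mul_inv, one_div, inv_pow]
  calc _ = (1 / 2) ^ b * (Real.exp (-b) * ((8 * (d : ℝ)) ^ b)⁻¹ * ballVol (Fin d)) *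
        ∏ i, (unifSphere (Block d b i)).real (coverSet δ a (c i)) := by rw [e2]; ring
    _ ≤ _ := mul_le_mul_of_nonneg_right (mul_le_mul_of_nonneg_left h5 (by positivity)) h6

end productCode

/-! ### Error terms as powers of `2 ^ (d / log d)` -/

section asymptotics

/-- The quantity `d / log d`; all error factors are of the form `2 ^ (O(d / log d))`. -/
noncomputable def nlog (d : ℕ) : ℝ := (d : ℝ) / Real.logb 2 d

lemma tendsto_logb_nat : Tendsto (fun d : ℕ => Real.logb 2 d) atTop atTop :=
  (Real.tendsto_logb_atTop (by norm_num)).comp tendsto_natCast_atTop_atTop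

lemma eventually_le_logb (C : ℝ) : ∀ᶠ d : ℕ in atTop, C ≤ Real.logb 2 d :=
  tendsto_logb_nat.eventually_ge_atTop C

lemma eventually_le_natCast (C : ℝ) : ∀ᶠ d : ℕ in atTop, C ≤ (d : ℝ) :=
  tendsto_natCast_atTop_atTop.eventually_ge_atTop C

lemma eventually_logb_pow_le {c : ℝ} (hc : 0 < c) (p : ℕ) :
    ∀ᶠ d : ℕ in atTop, Real.logb 2 d ^ p ≤ c * d := by
  have h1 : (fun x : ℝ => Real.log x ^ p) =o[atTop] fun x : ℝ => x := by
    simpa using isLittleO_log_rpow_rpow_atTop (s := 1) (p : ℝ) one_pos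
  have h2 := (h1.comp_tendsto (tendsto_natCast_atTop_atTop (R := ℝ))).bound
    (show 0 < c * Real.log 2 ^ p by positivity)
  filter_upwards [h2, eventually_ge_atTop 1] with d hd hd1
  have hd1' : (1 : ℝ) ≤ d := by exact_mod_cast hd1
  simp only [Function.comp_apply, Real.norm_eq_abs] at hd
  rw [Real.logb, div_pow, div_le_iff₀ (by positivity)]
  rw [abs_of_nonneg (by positivity : (0 : ℝ) ≤ d),
    abs_of_nonneg (pow_nonneg (Real.log_nonneg hd1') p)] at hd
  linarith

lemma eps_pos {d : ℕ} (hd : 2 ≤ d) : 0 < eps d := by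
  have : 0 < Real.logb 2 d := Real.logb_pos (by norm_num) (by exact_mod_cast hd)
  rw [eps]; positivity

lemma eventually_eps_le {c : ℝ} (hc : 0 < c) : ∀ᶠ d : ℕ in atTop, eps d ≤ c := by
  filter_upwards [eventually_le_logb (1 / c), eventually_le_logb 1] with d h1 h2
  rw [eps, div_le_iff₀ (by positivity)]
  rw [div_le_iff₀ hc] at h1
  nlinarith

lemma eventually_le_eps_mul (C : ℝ) : ∀ᶠ d : ℕ in atTop, C ≤ eps d * (d - 2) := by
  have hc : (0 : ℝ) < 1 / (2 * (|C| + 1)) := by positivity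
  filter_upwards [eventually_logb_pow_le hc 2, eventually_le_logb 1, eventually_ge_atTop 4]
    with d h1 h2 h3
  have h3' : (4 : ℝ) ≤ d := by exact_mod_cast h3
  rw [eps, one_div_mul_eq_div, le_div_iff₀ (by positivity)]
  have h4 : |C| * Real.logb 2 d ^ 2 ≤ d / 2 := by
    calc |C| * Real.logb 2 d ^ 2 ≤ (|C| + 1) * (1 / (2 * (|C| + 1)) * d) := by
          gcongr
          linarith
      _ = d / 2 := by field_simp
  have h5 : C * Real.logb 2 d ^ 2 ≤ |C| * Real.logb 2 d ^ 2 := by gcongr; exact le_abs_self C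
  linarith

/-- An error `eps d` in the base of a `d`-th power is harmless, since `eps d * d = d / log² d = o(d
/ log d)`. -/
lemma eventually_exp_eps_le (C : ℝ) {ζ : ℝ} (hζ : 0 < ζ) :
    ∀ᶠ d : ℕ in atTop, Real.exp (C * (eps d * d)) ≤ (2 : ℝ) ^ (ζ * nlog d) := by
  have hl2 : 0 < Real.log 2 := Real.log_pos (by norm_num)
  filter_upwards [eventually_le_logb (|C| / (ζ * Real.log 2)), eventually_le_logb 1] with d h1 h2
  rw [Real.rpow_def_of_pos (by norm_num)]
  apply Real.exp_le_exp.mpr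
  have hn : 0 ≤ nlog d := by rw [nlog]; positivity
  rw [div_le_iff₀ (by positivity)] at h1
  have e : C * (eps d * d) = C / Real.logb 2 d * nlog d := by
    rw [eps, nlog]; field_simp
  rw [e, show Real.log 2 * (ζ * nlog d) = (ζ * Real.log 2) * nlog d by ring]
  gcongr
  rw [div_le_iff₀ (by positivity)]
  linarith [le_abs_self C]

lemma natLog_le_logb (d : ℕ) : (Nat.log 2 d : ℝ) ≤ Real.logb 2 d := by
  rw [← Real.natFloor_logb_natCast 2 d]
  rcases Nat.eq_zero_or_pos d with rfl | hd
  · simp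
  · exact Nat.floor_le (Real.logb_nonneg (by norm_num) (by exact_mod_cast hd))

lemma natLog_pos {d : ℕ} (hd : 2 ≤ d) : 0 < Nat.log 2 d := Nat.log_pos (by norm_num) hd

/-- Quasi-polynomial factors are at most `2 ^ (ζ d / log d)`. -/
lemma eventually_pow_natLog_le (p : ℕ) {ζ : ℝ} (hζ : 0 < ζ) :
    ∀ᶠ d : ℕ in atTop, (d : ℝ) ^ (p * Nat.log 2 d) ≤ (2 : ℝ) ^ (ζ * nlog d) := by
  have hc : 0 < ζ / (p + 1) := by positivity
  filter_upwards [eventually_logb_pow_le hc 3, eventually_le_logb 1, eventually_ge_atTop 2]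
    with d h1 h2 h3
  have hd0 : (0 : ℝ) < d := by positivity
  have e : (d : ℝ) = 2 ^ Real.logb 2 d := (Real.rpow_logb (by norm_num) (by norm_num) hd0).symm
  calc (d : ℝ) ^ (p * Nat.log 2 d) = (2 : ℝ) ^ (Real.logb 2 d * (p * Nat.log 2 d : ℕ)) := by
        rw [Real.rpow_mul (by norm_num), ← e, Real.rpow_natCast]
    _ ≤ _ := by
      apply Real.rpow_le_rpow_of_exponent_le (by norm_num)
      rw [nlog, mul_div_assoc', le_div_iff₀ (by positivity), Nat.cast_mul]
      rw [div_mul_eq_mul_div, le_div_iff₀ (by positivity)] at h1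
      have h4 := natLog_le_logb d
      calc Real.logb 2 d * (p * (Nat.log 2 d : ℝ)) * Real.logb 2 d
          ≤ Real.logb 2 d * (p * Real.logb 2 d) * Real.logb 2 d := by gcongr
        _ = Real.logb 2 d ^ 3 * p := by ring
        _ ≤ Real.logb 2 d ^ 3 * (p + 1) := by gcongr; linarith
        _ ≤ _ := h1

lemma eventually_poly_le (C : ℝ) (p : ℕ) {ζ : ℝ} (hζ : 0 < ζ) :
    ∀ᶠ d : ℕ in atTop, C * (d : ℝ) ^ p ≤ (2 : ℝ) ^ (ζ * nlog d) := by
  filter_upwards [eventually_pow_natLog_le (p + 1) hζ, eventually_le_natCast C,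
    eventually_ge_atTop 2] with d h1 h2 h3
  refine le_trans ?_ h1
  have h3' : (1 : ℝ) ≤ d := by exact_mod_cast (by omega : 1 ≤ d)
  calc C * (d : ℝ) ^ p ≤ d * (d : ℝ) ^ p := by gcongr
    _ = (d : ℝ) ^ (p + 1) := by ring
    _ ≤ _ := pow_le_pow_right₀ h3' (Nat.le_mul_of_pos_right _ (natLog_pos h3))

lemma eventually_inv_le_eps_sq (C : ℝ) : ∀ᶠ d : ℕ in atTop, C / d ≤ eps d ^ 2 := by
  have hc : (0 : ℝ) < 1 / (|C| + 1) := by positivity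
  filter_upwards [eventually_logb_pow_le hc 4, eventually_le_logb 1, eventually_ge_atTop 1]
    with d h1 h2 h3
  have hd0 : (0 : ℝ) < d := by positivity
  rw [eps, div_pow, one_pow, ← pow_mul, div_le_div_iff₀ hd0 (by positivity), one_mul]
  calc C * Real.logb 2 d ^ (2 * 2) ≤ (|C| + 1) * (1 / (|C| + 1) * d) := by
        gcongr
        linarith [le_abs_self C]
    _ = d := by field_simp

lemma nlog_nonneg (d : ℕ) : 0 ≤ nlog d := by
  rcases Nat.eq_zero_or_pos d with rfl | hd
  · simp [nlog]
  · exact div_nonneg (by positivity) (Real.logb_nonneg (by norm_num) (by exact_mod_cast hd))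

lemma isLittleO_nlog (A : ℝ) : (fun d => A * nlog d) =o[atTop] fun d : ℕ => (d : ℝ) := by
  apply IsLittleO.const_mul_left
  rw [isLittleO_iff]
  intro c hc
  filter_upwards [eventually_le_logb (1 / c), eventually_le_logb 1] with d h1 h2
  rw [Real.norm_of_nonneg (nlog_nonneg d), Real.norm_of_nonneg (by positivity), nlog,
    div_le_iff₀ (by positivity)]
  rw [div_le_iff₀ hc] at h1
  nlinarith [(by positivity : (0 : ℝ) ≤ d)]

lemma eventually_nlog_le {c : ℝ} (hc : 0 < c) : ∀ᶠ d : ℕ in atTop, nlog d ≤ c * d := by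
  have := (isLittleO_nlog 1).bound hc
  filter_upwards [this] with d hd
  rwa [one_mul, Real.norm_of_nonneg (nlog_nonneg d), Real.norm_of_nonneg (by positivity)] at hd

/-- The upper bounds of the form `(k + 2) / 2 * √(σ + C ε) ^ k` are `2 ^ (ζ d / log d) * √σ ^ d`. -/
lemma eventually_upper_bound (C : ℝ) (hC : 0 ≤ C) {σ₀ ζ : ℝ} (hσ₀ : 0 < σ₀) (hζ : 0 < ζ) :
    ∀ᶠ d : ℕ in atTop, ∀ k : ℕ, d = k + 2 → ∀ σ : ℝ, σ₀ ≤ σ →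
      (k + 2) / 2 * Real.sqrt (σ + C * eps d) ^ k
        ≤ (2 : ℝ) ^ (ζ * nlog d) * Real.sqrt σ ^ d := by
  filter_upwards [eventually_exp_eps_le (C / (2 * σ₀)) (half_pos hζ),
    eventually_poly_le σ₀⁻¹ 1 (half_pos hζ), eventually_ge_atTop 2] with d h1 h2 h3 k hk σ hσ
  have he := eps_pos h3
  have hkd : (k : ℝ) + 2 = d := by rw [hk]; push_cast; ring
  have hkd' : (k : ℝ) ≤ d := by linarith
  have h4 := sqrt_add_pow_le hσ₀ hσ (x := C * eps d) (by positivity) k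
  rw [← hk] at h4
  have h5 : C * eps d * k / (2 * σ₀) ≤ C / (2 * σ₀) * (eps d * d) := by
    rw [show C * eps d * k / (2 * σ₀) = C / (2 * σ₀) * (eps d * k) by ring]
    gcongr
  have h6 : (2 : ℝ) ^ (ζ * nlog d) = 2 ^ (ζ / 2 * nlog d) * 2 ^ (ζ / 2 * nlog d) := by
    rw [← Real.rpow_add (by norm_num)]; congr 1; ring
  calc (k + 2) / 2 * Real.sqrt (σ + C * eps d) ^ k
      ≤ d * (Real.sqrt σ ^ d * (σ₀⁻¹ * Real.exp (C / (2 * σ₀) * (eps d * d)))) := by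
        refine mul_le_mul (by linarith) (h4.trans ?_) (by positivity) (by positivity)
        gcongr
    _ = (σ₀⁻¹ * (d : ℝ) ^ 1) * Real.exp (C / (2 * σ₀) * (eps d * d)) * Real.sqrt σ ^ d := by ring
    _ ≤ 2 ^ (ζ / 2 * nlog d) * 2 ^ (ζ / 2 * nlog d) * Real.sqrt σ ^ d := by gcongr
    _ = _ := by rw [h6]

/-- The lower bounds of the form `ε² / 576 * ((1 - ε / 4) √(σ - C ε)) ^ k` are at least `2 ^ (- ζ d
/ log d) * √σ ^ d`. -/
lemma eventually_lower_bound (C : ℝ) (hC : 0 ≤ C) {σ₀ ζ : ℝ} (hσ₀ : 0 < σ₀) (hζ : 0 < ζ) :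
    ∀ᶠ d : ℕ in atTop, ∀ k : ℕ, d = k + 2 → ∀ σ : ℝ, σ₀ ≤ σ → σ ≤ 1 →
      (2 : ℝ) ^ (-(ζ * nlog d)) * Real.sqrt σ ^ d
        ≤ eps d ^ 2 / 576 * ((1 - eps d / 4) * Real.sqrt (σ - C * eps d)) ^ k := by
  filter_upwards [eventually_exp_eps_le (C / σ₀ + 1) (half_pos hζ),
    eventually_poly_le 1 1 (half_pos hζ), eventually_inv_le_eps_sq 576,
    eventually_eps_le (show 0 < σ₀ / (2 * (C + 1)) by positivity), eventually_eps_le one_pos,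
    eventually_ge_atTop 2] with d h1 h2 h2' h3 h3' hd k hk σ hσ hσ1
  have he := eps_pos hd
  have hd0 : (0 : ℝ) < d := by positivity
  have hkd : (k : ℝ) + 2 = d := by rw [hk]; push_cast; ring
  have hkd' : (k : ℝ) ≤ d := by linarith
  have h4 := sqrt_sub_pow_ge hσ₀ hσ hσ1 (x := C * eps d) (by positivity) (by
    calc C * eps d ≤ (C + 1) * (σ₀ / (2 * (C + 1))) := by gcongr; linarith
      _ = σ₀ / 2 := by field_simp) k
  rw [← hk] at h4
  have h5 : Real.exp (-(eps d * k)) ≤ (1 - eps d / 4) ^ k := by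
    have := exp_neg_two_mul_le (y := eps d / 4) (by positivity) (by linarith)
    calc Real.exp (-(eps d * k)) ≤ Real.exp (k * -(2 * (eps d / 4))) := by
          apply Real.exp_le_exp.mpr
          nlinarith [(by positivity : (0 : ℝ) ≤ k)]
      _ = Real.exp (-(2 * (eps d / 4))) ^ k := Real.exp_nat_mul _ _
      _ ≤ _ := by gcongr
  have h6 : (2 : ℝ) ^ (-(ζ * nlog d)) = (2 ^ (ζ / 2 * nlog d))⁻¹ * (2 ^ (ζ / 2 * nlog d))⁻¹ := by
    rw [← mul_inv, ← Real.rpow_add (by norm_num), ← Real.rpow_neg (by norm_num)]; congr 1; ring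
  have h7 : Real.exp (-((C / σ₀ + 1) * (eps d * d)))
      ≤ Real.exp (-(C * eps d * k / σ₀)) * Real.exp (-(eps d * k)) := by
    rw [← Real.exp_add]
    apply Real.exp_le_exp.mpr
    have : C * eps d * k / σ₀ + eps d * k = (C / σ₀ + 1) * (eps d * k) := by ring
    have h8 : (C / σ₀ + 1) * (eps d * k) ≤ (C / σ₀ + 1) * (eps d * d) := by gcongr
    linarith
  rw [one_mul, pow_one] at h2
  have h9 : (d : ℝ)⁻¹ ≤ eps d ^ 2 / 576 := by
    rw [le_div_iff₀ (by norm_num)]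
    calc (d : ℝ)⁻¹ * 576 = 576 / d := by ring
      _ ≤ _ := h2'
  calc (2 : ℝ) ^ (-(ζ * nlog d)) * Real.sqrt σ ^ d
      ≤ ((d : ℝ)⁻¹ * (Real.exp ((C / σ₀ + 1) * (eps d * d)))⁻¹) * Real.sqrt σ ^ d := by
        rw [h6]; gcongr
    _ ≤ (eps d ^ 2 / 576 * (Real.exp (-(C * eps d * k / σ₀)) * Real.exp (-(eps d * k))))
        * Real.sqrt σ ^ d := by
        rw [← Real.exp_neg]; gcongr
    _ = eps d ^ 2 / 576 * (Real.exp (-(eps d * k)) *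
        (Real.sqrt σ ^ d * Real.exp (-(C * eps d * k / σ₀)))) := by ring
    _ ≤ eps d ^ 2 / 576 * ((1 - eps d / 4) ^ k * Real.sqrt (σ - C * eps d) ^ k) := by
        have : (0 : ℝ) ≤ (1 - eps d / 4) ^ k := (Real.exp_pos _).le.trans h5
        gcongr
    _ = _ := by rw [mul_pow]

end asymptotics

/-! ### Asymptotic volumes of caps and wedges -/

section estimates

lemma sin_cos_bounds {κ α : ℝ} (hκ : 0 < κ) (hα : α ∈ Set.Icc κ (Real.pi / 2 - κ)) :
    Real.sin κ ≤ Real.sin α ∧ Real.sin κ ≤ Real.cos α := by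
  have h1 : Real.sin κ ≤ Real.sin α :=
    Real.sin_le_sin_of_le_of_le_pi_div_two (by linarith [Real.pi_pos]) (by linarith [hα.2]) hα.1
  have h2 : Real.sin κ ≤ Real.sin (Real.pi / 2 - α) :=
    Real.sin_le_sin_of_le_of_le_pi_div_two (by linarith [Real.pi_pos]) (by linarith [hα.1])
      (by linarith [hα.2])
  rw [Real.sin_pi_div_two_sub] at h2
  exact ⟨h1, h2⟩

lemma sin_pos_of_lt {κ : ℝ} (hκ : 0 < κ) (hκ4 : κ < Real.pi / 4) : 0 < Real.sin κ :=
  Real.sin_pos_of_pos_of_lt_pi hκ (by linarith [Real.pi_pos])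

/-- In this form `γ²` is the squared norm of the point of the plane with inner products `cos α` and
`cos θ` with two unit vectors at the angle `α`. -/
lemma gammaSq_eq {α : ℝ} (h0 : 0 < Real.sin α) (θ : ℝ) : gammaSq θ α α
    = Real.cos α ^ 2 + (Real.cos θ - Real.cos α ^ 2) ^ 2 / (1 - Real.cos α ^ 2) := by
  have hs : Real.sin α ^ 2 = 1 - Real.cos α ^ 2 := Real.sin_sq α
  have h : 1 - Real.cos α ^ 2 ≠ 0 := by rw [← hs]; positivity
  rw [gammaSq, hs]
  field_simp
  ring

/-- The cap around a fixed vector has measure `p_α`, whatever the vector. -/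
lemma pCap_eq {d : ℕ} (hd : 0 < d) (α : ℝ) (c : USphere (Fin d)) :
    pCap d α = (unifSphere (Fin d)).real
      {u | ApproxEq (eps d) (inner ℝ (u : EuclideanSpace ℝ (Fin d)) c) (Real.cos α)} := by
  have : Nonempty (Fin d) := ⟨⟨0, hd⟩⟩
  have hT : MeasurableSet {t : ℝ | ApproxEq (eps d) t (Real.cos α)} :=
    measurableSet_approxEq measurable_id _ _
  have hm : MeasurableSet {p : USphere (Fin d) × USphere (Fin d) |
      ApproxEq (eps d) (inner ℝ (p.1 : EuclideanSpace ℝ (Fin d)) p.2) (Real.cos α)} :=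
    measurableSet_approxEq (by fun_prop) _ _
  rw [pCap, prod_real_eq_integral _ _ hm]
  have h : ∀ a : USphere (Fin d), (unifSphere (Fin d)).real (Prod.mk a ⁻¹'
      {p : USphere (Fin d) × USphere (Fin d) |
        ApproxEq (eps d) (inner ℝ (p.1 : EuclideanSpace ℝ (Fin d)) p.2) (Real.cos α)})
      = (unifSphere (Fin d)).real
        {u | ApproxEq (eps d) (inner ℝ (u : EuclideanSpace ℝ (Fin d)) c) (Real.cos α)} := by
    intro a
    have := unifSphere_real_inner_eq a c hT
    simp only [real_inner_comm _ (c : EuclideanSpace ℝ (Fin d))] at this ⊢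
    exact this
  simp_rw [h]
  simp

lemma sqrt_one_sub_cos_sq {α : ℝ} (h : 0 ≤ Real.sin α) :
    Real.sqrt (1 - Real.cos α ^ 2) = Real.sin α := by
  rw [← Real.sin_sq, Real.sqrt_sq h]

/-- A cap of angle `α` has measure `sin α ^ d` up to a factor `2 ^ (ζ d / log d)`. -/
lemma eventually_cap_bounds {κ ζ : ℝ} (hκ : 0 < κ) (hκ4 : κ < Real.pi / 4) (hζ : 0 < ζ) :
    ∀ᶠ d : ℕ in atTop, ∀ α ∈ Set.Icc κ (Real.pi / 2 - κ),
      (2 : ℝ) ^ (-(ζ * nlog d)) * Real.sin α ^ d ≤ pCap d α ∧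
      pCap d α ≤ (2 : ℝ) ^ (ζ * nlog d) * Real.sin α ^ d := by
  have hs := sin_pos_of_lt hκ hκ4
  filter_upwards [eventually_upper_bound 2 zero_le_two (pow_pos hs 2) hζ,
    eventually_lower_bound 0 le_rfl (pow_pos hs 2) hζ, eventually_ge_atTop 3,
    eventually_eps_le one_pos, eventually_le_eps_mul 8] with d h1 h2 hd h3 h4 α hα
  obtain ⟨hb1, hb2⟩ := sin_cos_bounds hκ hα
  obtain ⟨k, rfl⟩ : ∃ k, d = k + 2 := ⟨d - 2, by omega⟩
  have he := eps_pos (d := k + 2) (by omega)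
  have hσ0 : Real.sin κ ^ 2 ≤ 1 - Real.cos α ^ 2 := by rw [← Real.sin_sq]; gcongr
  have hσ1 : 1 - Real.cos α ^ 2 ≤ 1 := by linarith [sq_nonneg (Real.cos α)]
  let c : USphere (Fin (k + 2)) := ⟨EuclideanSpace.single 0 1, by simp⟩
  rw [pCap_eq (by omega) α c]
  simp only [real_inner_comm (c : EuclideanSpace ℝ (Fin (k + 2)))]
  rw [← sqrt_one_sub_cos_sq (hs.le.trans hb1)]
  constructor
  · refine (h2 k rfl _ hσ0 hσ1).trans ?_
    refine le_trans ?_ (prob_cap_ge (k := k) (by simp) c (Real.cos_sq_le_one α) he h3 (by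
      push_cast at h4; linarith))
    rw [zero_mul, sub_zero]
    gcongr
    · exact pow_nonneg (mul_nonneg (by linarith) (Real.sqrt_nonneg _)) k
    · norm_num
  · refine (prob_cap_le (k := k) (by simp) (by omega) c (hs.le.trans hb2) (Real.cos_le_one α)
      he.le).trans ?_
    exact h1 k rfl _ hσ0

/-- Given a vector `x` at angle `≈ α` from `c`, the probability that a random vector is at angle `≈
α` from `c` and at angle `≈ θ` from `x` is `(1 - γ²) ^ (d / 2)` up to a factor `2 ^ (ζ d / log d)`.
-/
lemma eventually_nearBoth_bounds {κ κ' ζ : ℝ} (hκ : 0 < κ) (hκ4 : κ < Real.pi / 4) (hκ' : 0 < κ')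
    (hζ : 0 < ζ) :
    ∀ᶠ d : ℕ in atTop, ∀ θ ∈ Set.Icc κ (Real.pi / 2 - κ), ∀ α ∈ Set.Icc κ (Real.pi / 2 - κ),
      gammaSq θ α α ≤ 1 - κ' → ∀ x c : USphere (Fin d),
      ApproxEq (eps d) (inner ℝ (x : EuclideanSpace ℝ (Fin d)) c) (Real.cos α) →
      (2 : ℝ) ^ (-(ζ * nlog d)) * Real.sqrt (1 - gammaSq θ α α) ^ d
        ≤ (unifSphere (Fin d)).real (nearBoth (eps d) (Real.cos α) (Real.cos θ) c x) ∧
      (unifSphere (Fin d)).real (nearBoth (eps d) (Real.cos α) (Real.cos θ) c x)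
        ≤ (2 : ℝ) ^ (ζ * nlog d) * Real.sqrt (1 - gammaSq θ α α) ^ d := by
  have hs := sin_pos_of_lt hκ hκ4
  set s := Real.sin κ
  have hC : 0 < 28 / s ^ 4 := by positivity
  filter_upwards [eventually_upper_bound (28 / s ^ 4) hC.le hκ' hζ,
    eventually_lower_bound (28 / s ^ 4) hC.le hκ' hζ, eventually_ge_atTop 3,
    eventually_eps_le one_pos, eventually_le_eps_mul 24,
    eventually_eps_le (show 0 < s ^ 2 / 6 by positivity),
    eventually_eps_le (show 0 < κ' / (28 / s ^ 4) by positivity)]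
    with d h1 h2 hd h3 h4 h5 h6 θ hθ α hα hγ x c hxc
  obtain ⟨ha1, ha2⟩ := sin_cos_bounds hκ hα
  obtain ⟨ht1, ht2⟩ := sin_cos_bounds hκ hθ
  obtain ⟨k, rfl⟩ : ∃ k, d = k + 2 := ⟨d - 2, by omega⟩
  have he := eps_pos (d := k + 2) (by omega)
  have hsa : s ^ 2 ≤ 1 - Real.cos α ^ 2 := by rw [← Real.sin_sq]; gcongr
  have hγ0 : 0 ≤ gammaSq θ α α := by
    rw [gammaSq_eq (hs.trans_le ha1), ← Real.sin_sq]; positivity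
  have h6' : 28 / s ^ 4 * eps (k + 2) ≤ κ' := by
    rw [le_div_iff₀ hC] at h6; linarith
  constructor
  · refine (h2 k rfl _ (by linarith : κ' ≤ 1 - gammaSq θ α α) (by linarith)).trans ?_
    rw [gammaSq_eq (hs.trans_le ha1)] at hγ ⊢
    refine le_trans ?_ (prob_nearBoth_ge (k := k) (by simp) (norm_usphere c) (norm_usphere x)
      (hs.le.trans ha2) (Real.cos_le_one α) (hs.le.trans ht2) (Real.cos_le_one θ) hs hsa he
      (by linarith) (by push_cast at h4; linarith) hxc (by linarith))
    have : 0 ≤ 1 - eps (k + 2) / 4 := by linarith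
    gcongr
    norm_num
  · have := h1 k rfl _ (by linarith : κ' ≤ 1 - gammaSq θ α α)
    rw [gammaSq_eq (hs.trans_le ha1)] at this ⊢
    exact (prob_nearBoth_le (k := k) (by simp) (by omega) (norm_usphere c) (norm_usphere x)
      (hs.le.trans ha2) (Real.cos_le_one α) (hs.le.trans ht2) (Real.cos_le_one θ) hs hsa he.le
      (by linarith) hxc).trans this

/-- The vectors of the definition of `wedgeVol` in the orthonormal basis given by the angles `0` and
`π / 2`. -/
lemma planeVec_eq (k : ℕ) (θ : ℝ) : planeVec (k + 2) θ
    = Real.cos θ • planeVec (k + 2) 0 + Real.sin θ • planeVec (k + 2) (Real.pi / 2) := by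
  ext j
  simp only [planeVec, PiLp.add_apply, PiLp.smul_apply, smul_eq_mul]
  by_cases h0 : (j : ℕ) = 0
  · simp [h0]
  · by_cases h1 : (j : ℕ) = 1 <;> simp [h0, h1]

lemma inner_planeVec (k : ℕ) (θ θ' : ℝ) : inner ℝ (planeVec (k + 2) θ) (planeVec (k + 2) θ')
    = Real.cos θ * Real.cos θ' + Real.sin θ * Real.sin θ' := by
  simp [PiLp.inner_apply, planeVec, Fin.sum_univ_succ]
  ring

lemma norm_planeVec (k : ℕ) (θ : ℝ) : ‖planeVec (k + 2) θ‖ = 1 := by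
  have : ‖planeVec (k + 2) θ‖ ^ 2 = 1 := by
    rw [← real_inner_self_eq_norm_sq, inner_planeVec]
    nlinarith [Real.sin_sq_add_cos_sq θ]
  nlinarith [norm_nonneg (planeVec (k + 2) θ)]

/-- If `cos² α ≤ cos θ` then the wedge is dominated by its corner, the point of the plane at
which both constraints are equalities. -/
lemma eventually_wedgeVol_bounds {κ κ' ζ : ℝ} (hκ : 0 < κ) (hκ4 : κ < Real.pi / 4) (hκ' : 0 < κ')
    (hζ : 0 < ζ) :
    ∀ᶠ d : ℕ in atTop, ∀ θ ∈ Set.Icc κ (Real.pi / 2 - κ), ∀ α ∈ Set.Icc κ (Real.pi / 2 - κ),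
      gammaSq θ α α ≤ 1 - κ' → Real.cos α ^ 2 ≤ Real.cos θ →
      (2 : ℝ) ^ (-(ζ * nlog d)) * Real.sqrt (1 - gammaSq θ α α) ^ d ≤ wedgeVol d θ α α ∧
      wedgeVol d θ α α ≤ (2 : ℝ) ^ (ζ * nlog d) * Real.sqrt (1 - gammaSq θ α α) ^ d := by
  have hs := sin_pos_of_lt hκ hκ4
  filter_upwards [eventually_upper_bound 0 le_rfl hκ' hζ,
    eventually_lower_bound 6 (by norm_num) hκ' hζ, eventually_ge_atTop 3,
    eventually_eps_le one_pos, eventually_le_eps_mul 8,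
    eventually_eps_le (show 0 < κ' / 6 by positivity)]
    with d h1 h2 hd h3 h4 h6 θ hθ α hα hγ hcos
  obtain ⟨ha1, ha2⟩ := sin_cos_bounds hκ hα
  obtain ⟨ht1, ht2⟩ := sin_cos_bounds hκ hθ
  obtain ⟨k, rfl⟩ : ∃ k, d = k + 2 := ⟨d - 2, by omega⟩
  have he := eps_pos (d := k + 2) (by omega)
  set e₀ := planeVec (k + 2) 0 with he₀
  set e₁ := planeVec (k + 2) (Real.pi / 2) with he₁
  have n0 : ‖e₀‖ = 1 := norm_planeVec k 0
  have n1 : ‖e₁‖ = 1 := norm_planeVec k _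
  have n01 : inner ℝ e₀ e₁ = 0 := by rw [he₀, he₁, inner_planeVec]; simp
  have hw : ∀ u : EuclideanSpace ℝ (Fin (k + 2)), inner ℝ (planeVec (k + 2) α) u
      = Real.cos α * inner ℝ e₀ u + Real.sin α * inner ℝ e₁ u := by
    intro u
    rw [planeVec_eq, inner_add_left, real_inner_smul_left, real_inner_smul_left]
  have hsin : Real.sin α ^ 2 = 1 - Real.cos α ^ 2 := Real.sin_sq α
  have hsin0 : 0 < Real.sin α := hs.trans_le ha1
  have ha0 : 0 < Real.cos α := hs.trans_le ha2
  have ht0 : 0 < Real.cos θ := hs.trans_le ht2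
  have ha1' : Real.cos α ≤ 1 := Real.cos_le_one α
  have ht1' : Real.cos θ ≤ 1 := Real.cos_le_one θ
  have hγe : gammaSq θ α α * Real.sin α ^ 2
      = Real.cos θ ^ 2 + Real.cos α ^ 2 - 2 * Real.cos θ * Real.cos α * Real.cos α := by
    rw [gammaSq]; field_simp
  have hγ0 : 0 ≤ gammaSq θ α α := by
    rw [gammaSq_eq (hs.trans_le ha1), ← Real.sin_sq]; positivity
  have : Nonempty (Fin (k + 2)) := ⟨0⟩
  set γ := gammaSq θ α α
  set a := Real.cos α
  set t := Real.cos θ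
  set s := Real.sin α
  -- the corner of the wedge is `(t, z)`
  obtain ⟨z, hz⟩ : ∃ z, z * s = a * (1 - t) := ⟨a * (1 - t) / s, by field_simp⟩
  have hz0 : 0 ≤ z := by
    by_contra hcon
    push Not at hcon
    nlinarith [mul_nonneg ha0.le (sub_nonneg.mpr ht1')]
  have hzγ : t ^ 2 + z ^ 2 = γ := by
    have h7 : (t ^ 2 + z ^ 2) * s ^ 2 = γ * s ^ 2 := by
      rw [hγe]
      have : z ^ 2 * s ^ 2 = (a * (1 - t)) ^ 2 := by rw [← hz]; ring
      rw [add_mul, this, hsin]; ring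
    exact mul_right_cancel₀ (by positivity) h7
  have hz1 : z ≤ 1 := by nlinarith
  constructor
  · -- a box of radius `ε` around the corner moved by `(ε, ε)` projects into the wedge
    refine (h2 k rfl _ (by linarith : κ' ≤ 1 - γ) (by linarith)).trans ?_
    have hsq : (t + eps (k + 2)) ^ 2 + (z + eps (k + 2)) ^ 2 ≤ γ + 6 * eps (k + 2) := by
      nlinarith
    refine le_trans ?_ ((prob_plane_near_ge (k := k) (by simp) n0 n1 n01 (a := t + eps (k + 2))
      (b := z + eps (k + 2)) (by linarith) he h3 (by push_cast at h4; linarith)).trans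
      (measureReal_mono ?_))
    · have : 0 ≤ 1 - eps (k + 2) / 4 := by linarith
      have h8 := Real.sqrt_le_sqrt (show 1 - γ - 6 * eps (k + 2)
        ≤ 1 - (t + eps (k + 2)) ^ 2 - (z + eps (k + 2)) ^ 2 by linarith)
      refine mul_le_mul ?_ (pow_le_pow_left₀ (mul_nonneg this (Real.sqrt_nonneg _))
        (mul_le_mul_of_nonneg_left h8 this) k)
        (pow_nonneg (mul_nonneg this (Real.sqrt_nonneg _)) k) (by positivity)
      gcongr
      norm_num
    · rintro u ⟨hu1, hu2⟩
      have i1 := (abs_le.mp hu1).1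
      have i2 := (abs_le.mp hu2).1
      refine ⟨by change t ≤ _; linarith, ?_⟩
      rw [hw]
      change a ≤ _
      have i3 : a * t ≤ a * inner ℝ e₀ (u : EuclideanSpace ℝ (Fin (k + 2))) := by
        gcongr; linarith
      have i4 : s * z ≤ s * inner ℝ e₁ (u : EuclideanSpace ℝ (Fin (k + 2))) := by
        gcongr; linarith
      linarith
  · -- the points of the wedge project to points of norm at least that of the corner
    have h7 := h1 k rfl _ (by linarith : κ' ≤ 1 - γ)
    rw [zero_mul, add_zero] at h7
    refine le_trans (measureReal_mono ?_) ((prob_plane_norm_ge_le (k := k) (by simp) (by omega)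
      n0 n1 n01 γ).trans h7)
    rintro u ⟨hu1, hu2⟩
    rw [hw] at hu2
    change t ≤ inner ℝ e₀ _ at hu1
    change a ≤ _ at hu2
    change γ ≤ _
    generalize inner ℝ e₀ (u : EuclideanSpace ℝ (Fin (k + 2))) = y₀ at *
    generalize inner ℝ e₁ (u : EuclideanSpace ℝ (Fin (k + 2))) = y₁ at *
    -- the corner is a nonnegative combination of the two normals, because `a² ≤ t`
    have j1 : γ * s ^ 2 ≤ (t * y₀ + z * y₁) * s ^ 2 := by
      have k1 : 0 ≤ (t - a ^ 2) * (y₀ - t) := mul_nonneg (by linarith) (by linarith)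
      have k2 : 0 ≤ a * (1 - t) * (a * y₀ + s * y₁ - a) :=
        mul_nonneg (mul_nonneg ha0.le (by linarith)) (by linarith)
      have k3 : (t * y₀ + z * y₁) * s ^ 2 - γ * s ^ 2
          = (t - a ^ 2) * (y₀ - t) + a * (1 - t) * (a * y₀ + s * y₁ - a) := by
        linear_combination (s * y₁) * hz - hγe + t * y₀ * hsin
      linarith
    have j2 : γ ≤ t * y₀ + z * y₁ := le_of_mul_le_mul_right j1 (by positivity)
    have j3 : 0 ≤ (y₀ - t) ^ 2 + (y₁ - z) ^ 2 := by positivity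
    have j4 : (y₀ - t) ^ 2 + (y₁ - z) ^ 2
        = y₀ ^ 2 + y₁ ^ 2 + (t ^ 2 + z ^ 2) - 2 * (t * y₀ + z * y₁) := by ring
    rw [j4, hzγ] at j3
    linarith

/-- Both alternatives of well-definedness bound `γ²` away from `1`; in the second one `θ = α`, and
`γ²` is the given fraction. -/
lemma gammaSq_le_of_wellDefined {κ κ' θ α : ℝ} (hκ : 0 < κ) (hκ4 : κ < Real.pi / 4)
    (hα : α ∈ Set.Icc κ (Real.pi / 2 - κ)) (h : WedgeWellDefined κ' θ α α) :
    gammaSq θ α α ≤ 1 - κ' := by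
  rcases h with h | ⟨rfl, h⟩
  · exact h.2.2
  · have hs := sin_pos_of_lt hκ hκ4
    obtain ⟨h1, h2⟩ := sin_cos_bounds hκ hα
    refine le_trans (le_of_eq ?_) h
    have h3 : 0 < Real.sin θ := hs.trans_le h1
    have h4 : 0 < Real.cos θ := hs.trans_le h2
    rw [gammaSq, div_eq_div_iff (by positivity) (by positivity), Real.sin_sq]
    ring

end estimates

/-! ### Covering the spheres of the blocks -/

section blockCover

/-- The tolerance is large compared to the inverse of the dimension of a block. -/
lemma eventually_le_eps_mul_block (C : ℝ) :
    ∀ᶠ d : ℕ in atTop, C ≤ eps d * (((d / Nat.log 2 d : ℕ) : ℝ) - 2) := by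
  have hC : 0 < |C| + 3 := by positivity
  filter_upwards [eventually_logb_pow_le (c := 1 / (|C| + 3)) (by positivity) 3,
    eventually_le_logb 1, eventually_ge_atTop 2] with d h1 h2 hd
  have hb : 0 < Nat.log 2 d := natLog_pos hd
  have hbl := natLog_le_logb d
  set l := Real.logb 2 d with hl
  set b := Nat.log 2 d
  have h3 : (d : ℝ) ≤ l * (((d / b : ℕ) : ℝ) + 1) := by
    have : d ≤ b * (d / b + 1) := by
      have := Nat.div_add_mod d b
      have := Nat.mod_lt d hb
      rw [mul_add]; omega
    calc (d : ℝ) ≤ b * (((d / b : ℕ) : ℝ) + 1) := by exact_mod_cast this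
      _ ≤ _ := by gcongr
  have h4 : (|C| + 3) * l ^ 3 ≤ d := by
    rw [div_mul_eq_mul_div, one_mul, le_div_iff₀ hC] at h1
    linarith
  have h5 : (|C| + 3) * l ^ 2 ≤ ((d / b : ℕ) : ℝ) + 1 := by
    refine le_of_mul_le_mul_left ?_ (by linarith : 0 < l)
    calc l * ((|C| + 3) * l ^ 2) = (|C| + 3) * l ^ 3 := by ring
      _ ≤ _ := h4.trans h3
  have h6 : 1 ≤ l ^ 2 := one_le_pow₀ h2
  rw [eps, ← hl, one_div, inv_mul_eq_div, le_div_iff₀ (by positivity)]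
  have : C * l ^ 2 ≤ |C| * l ^ 2 := by gcongr; exact le_abs_self C
  linarith

lemma exp_neg_le_one_sub_pow {ε : ℝ} (h0 : 0 ≤ ε) (h1 : ε ≤ 1) {k : ℕ} {t : ℝ} (hk : k ≤ t) :
    Real.exp (-(ε * t)) ≤ (1 - ε / 3 / 4) ^ k := by
  calc Real.exp (-(ε * t)) ≤ Real.exp (k * (-(2 * (ε / 3 / 4)))) := by
        gcongr
        have : ε * k ≤ ε * t := by gcongr
        have : 0 ≤ ε * k := by positivity
        linarith
    _ = Real.exp (-(2 * (ε / 3 / 4))) ^ k := by rw [← Real.exp_nat_mul]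
    _ ≤ _ := by
        gcongr
        exact exp_neg_two_mul_le (by positivity) (by linarith)

/-- With `K ≥ p ^ (-1/b)` random vectors in a block of about `d / b` coordinates, the expected
number of vectors close to a given direction is not much smaller than `1`. -/
lemma block_cover_ge {ι : Type} [Fintype ι] {d b k K : ℕ} (hk : Fintype.card ι = k + 2)
    (hb : 0 < b) (hkb : (k : ℝ) * b ≤ d) {s p P ε a : ℝ} (hs0 : 0 < s) (hs1 : s ≤ 1)
    (hs : Real.sqrt (1 - a ^ 2) = s) (ha : a ^ 2 ≤ 1) (hp : 0 < p) (hP : 0 < P)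
    (hpP : p ≤ P * s ^ d) (hK : (1 / p) ^ (1 / (b : ℝ)) ≤ K) (hε0 : 0 < ε) (hε1 : ε ≤ 1)
    (hkε : 24 ≤ k * ε) (c : USphere ι) :
    (P ^ (1 / (b : ℝ)))⁻¹ * (ε ^ 2 / 2304 * Real.exp (-(ε * (d / b))))
      ≤ K * (unifSphere ι).real
        {u | ApproxEq (ε / 3) (inner ℝ (c : EuclideanSpace ℝ ι) u) a} / 4 := by
  have hb' : (0 : ℝ) < b := by exact_mod_cast hb
  have hkd : (k : ℝ) ≤ d / b := by rwa [le_div_iff₀ hb']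
  have h1 := prob_cap_ge hk c ha (δ := ε / 3) (by positivity) (by linarith) (by linarith)
  rw [hs, mul_pow] at h1
  have h2 := exp_neg_le_one_sub_pow hε0.le hε1 hkd
  have h3 : (P ^ (1 / (b : ℝ)))⁻¹ ≤ K * s ^ k := by
    have h4 : s ^ ((d : ℝ) / b) ≤ s ^ k := by
      rw [← Real.rpow_natCast s k]
      exact Real.rpow_le_rpow_of_exponent_ge hs0 hs1 hkd
    have h5 : (P ^ (1 / (b : ℝ)))⁻¹ = (1 / (P * s ^ d)) ^ (1 / (b : ℝ)) * s ^ ((d : ℝ) / b) := by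
      rw [one_div (P * s ^ d), Real.inv_rpow (by positivity), Real.mul_rpow hP.le (by positivity),
        ← Real.rpow_natCast s d, ← Real.rpow_mul hs0.le, mul_one_div, mul_inv, mul_assoc,
        inv_mul_cancel₀ (by positivity), mul_one]
    rw [h5]
    gcongr
    refine le_trans ?_ hK
    gcongr
  have hsk : 0 < s ^ k := by positivity
  calc (P ^ (1 / (b : ℝ)))⁻¹ * (ε ^ 2 / 2304 * Real.exp (-(ε * (d / b))))
      ≤ (K * s ^ k) * (ε ^ 2 / 2304 * (1 - ε / 3 / 4) ^ k) := by gcongr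
    _ = K * ((ε / 3) ^ 2 / 64 * ((1 - ε / 3 / 4) ^ k * s ^ k)) / 4 := by ring
    _ ≤ _ := by gcongr

/-- The factors lost in passing from the blocks to the whole space are quasi-polynomial. -/
lemma eventually_exp_mul_pow_ge {ζ : ℝ} (hζ : 0 < ζ) :
    ∀ᶠ d : ℕ in atTop, (2 : ℝ) ^ (-(ζ * nlog d)) ≤
      Real.exp (-(Nat.log 2 d : ℕ)) * ((16 * (d : ℝ)) ^ Nat.log 2 d)⁻¹
        * (eps d ^ 2 / 2304) ^ Nat.log 2 d := by
  filter_upwards [eventually_pow_natLog_le 3 hζ, eventually_inv_le_eps_sq 1,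
    eventually_le_natCast 110592] with d h1 h2 h3
  have hd : (0 : ℝ) < d := by linarith
  have he : Real.exp (-(Nat.log 2 d : ℕ)) = Real.exp (-1) ^ Nat.log 2 d := by
    rw [← Real.exp_nat_mul]; simp
  have he1 : (1 : ℝ) / 3 ≤ Real.exp (-1) := by
    rw [Real.exp_neg, one_div]
    exact inv_anti₀ (Real.exp_pos 1) (by linarith [Real.exp_one_lt_d9])
  rw [he, ← inv_pow, ← mul_pow, ← mul_pow, Real.rpow_neg zero_le_two]
  calc ((2 : ℝ) ^ (ζ * nlog d))⁻¹ ≤ ((d : ℝ) ^ (3 * Nat.log 2 d))⁻¹ := by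
        apply inv_anti₀ (by positivity) h1
    _ = (((d : ℝ) ^ 3)⁻¹) ^ Nat.log 2 d := by rw [pow_mul, inv_pow]
    _ ≤ _ := by
        gcongr
        calc ((d : ℝ) ^ 3)⁻¹ = (d : ℝ)⁻¹ * (d : ℝ)⁻¹ * (d : ℝ)⁻¹ := by ring
          _ ≤ (1 / 110592) * (d : ℝ)⁻¹ * (1 / d) := by
            rw [← one_div (d : ℝ)]; gcongr
          _ ≤ (1 / 110592) * (d : ℝ)⁻¹ * eps d ^ 2 := by gcongr
          _ = 1 / 3 * (16 * (d : ℝ))⁻¹ * (eps d ^ 2 / 2304) := by rw [mul_inv]; ring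
          _ ≤ _ := by gcongr

lemma le_blockSize (b : ℕ) (M : ℝ) : M ^ (1 / (b : ℝ)) ≤ blockSize b M := Nat.le_ceil _

/-- Each block has enough vectors to cover a fraction `τ` of its sphere, and `τ ^ b` is not much
smaller than `1`. -/
lemma eventually_block_cover {κ ζ : ℝ} (hκ : 0 < κ) (hκ4 : κ < Real.pi / 4) (hζ : 0 < ζ) :
    ∀ᶠ d : ℕ in atTop, ∀ α ∈ Set.Icc κ (Real.pi / 2 - κ), ∃ τ : ℝ, 0 ≤ τ ∧ τ ≤ 1 / 2 ∧
      (∀ (i : Fin (Nat.log 2 d)) (c : USphere (Block d (Nat.log 2 d) i)),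
        0 < (unifSphere (Block d (Nat.log 2 d) i)).real
          {u | ApproxEq (eps d / 3) (inner ℝ (c : EuclideanSpace ℝ (Block d (Nat.log 2 d) i)) u)
            (Real.cos α)} ∧
        τ ≤ blockSize (Nat.log 2 d) (1 / pCap d α) *
          (unifSphere (Block d (Nat.log 2 d) i)).real
          {u | ApproxEq (eps d / 3) (inner ℝ (c : EuclideanSpace ℝ (Block d (Nat.log 2 d) i)) u)
            (Real.cos α)} / 4) ∧
      (2 : ℝ) ^ (-(ζ * nlog d)) ≤ Real.exp (-(Nat.log 2 d : ℕ))
        * ((16 * (d : ℝ)) ^ Nat.log 2 d)⁻¹ * τ ^ Nat.log 2 d := by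
  have hs := sin_pos_of_lt hκ hκ4
  have hζ3 : 0 < ζ / 3 := by positivity
  filter_upwards [eventually_cap_bounds hκ hκ4 hζ3, eventually_exp_mul_pow_ge hζ3,
    eventually_exp_eps_le 1 hζ3, eventually_eps_le one_pos, eventually_le_eps_mul_block 24,
    eventually_ge_atTop 2] with d h1 h2 h3 h4 h5 hd α hα
  obtain ⟨hb1, hb2⟩ := sin_cos_bounds hκ hα
  obtain ⟨h6, h7⟩ := h1 α hα
  have hb : 0 < Nat.log 2 d := natLog_pos hd
  have he := eps_pos hd
  have hsα : 0 < Real.sin α := hs.trans_le hb1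
  have hp : 0 < pCap d α := lt_of_lt_of_le (by positivity) h6
  set b := Nat.log 2 d
  have hb' : (0 : ℝ) < b := by exact_mod_cast hb
  set P : ℝ := (2 : ℝ) ^ (ζ / 3 * nlog d) with hPdef
  have hP1 : 1 ≤ P := Real.one_le_rpow one_le_two (mul_nonneg hζ3.le (nlog_nonneg d))
  have hP : 0 < P := by linarith
  have hlow : ∀ (i : Fin b) (c : USphere (Block d b i)),
      (P ^ (1 / (b : ℝ)))⁻¹ * (eps d ^ 2 / 2304 * Real.exp (-(eps d * (d / b))))
      ≤ blockSize b (1 / pCap d α) * (unifSphere (Block d b i)).real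
          {u | ApproxEq (eps d / 3) (inner ℝ (c : EuclideanSpace ℝ (Block d b i)) u)
            (Real.cos α)} / 4 := by
    intro i c
    have hn1 : d / b ≤ Fintype.card (Block d b i) := le_card_block hb i
    have hn2 := card_block_le (d := d) hb i
    have hq : (3 : ℝ) ≤ (d / b : ℕ) := by
      by_contra hcon
      push Not at hcon
      nlinarith
    have hq' : 3 ≤ d / b := by exact_mod_cast hq
    obtain ⟨k, hk⟩ : ∃ k, Fintype.card (Block d b i) = k + 2 :=
      ⟨Fintype.card (Block d b i) - 2, by omega⟩
    have hkb : (k : ℝ) * b ≤ d := by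
      have : k * b ≤ d := (Nat.mul_le_mul_right b (by omega : k ≤ d / b)).trans
        (Nat.div_mul_le_self d b)
      exact_mod_cast this
    refine block_cover_ge hk hb hkb hsα (Real.sin_le_one α) (sqrt_one_sub_cos_sq hsα.le)
      (Real.cos_sq_le_one α) hp hP h7 (le_blockSize _ _) he h4 ?_ c
    have : ((d / b : ℕ) : ℝ) - 2 ≤ k := by
      have : d / b ≤ k + 2 := by omega
      have : ((d / b : ℕ) : ℝ) ≤ k + 2 := by exact_mod_cast this
      linarith
    calc (24 : ℝ) ≤ eps d * (((d / b : ℕ) : ℝ) - 2) := h5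
      _ ≤ k * eps d := by rw [mul_comm]; gcongr
  have hpos : 0 < (P ^ (1 / (b : ℝ)))⁻¹ * (eps d ^ 2 / 2304 * Real.exp (-(eps d * (d / b)))) := by
    positivity
  -- `τ` is the left-hand side of `hlow`
  refine ⟨_, hpos.le, ?_, fun i c => ⟨?_, hlow i c⟩, ?_⟩
  · have h8 : (P ^ (1 / (b : ℝ)))⁻¹ ≤ 1 :=
      inv_le_one_of_one_le₀ (Real.one_le_rpow hP1 (by positivity))
    have h9 : Real.exp (-(eps d * (d / b))) ≤ 1 := Real.exp_le_one_iff.mpr (by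
      rw [Left.neg_nonpos_iff]; positivity)
    have h10 : eps d ^ 2 ≤ 1 := pow_le_one₀ he.le h4
    calc _ ≤ (1 : ℝ) * (1 / 2304 * 1) := by gcongr
      _ ≤ _ := by norm_num
  · by_contra hcon
    have h8 := hlow i c
    have h9 := le_antisymm (not_lt.mp hcon) measureReal_nonneg
    rw [h9] at h8
    linarith
  · have h8 : ((P ^ (1 / (b : ℝ)))⁻¹ * (eps d ^ 2 / 2304 * Real.exp (-(eps d * (d / b))))) ^ b
        = P⁻¹ * ((eps d ^ 2 / 2304) ^ b * Real.exp (-(eps d * d))) := by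
      rw [mul_pow, mul_pow, ← Real.exp_nat_mul, inv_pow, ← Real.rpow_natCast (P ^ _) b,
        ← Real.rpow_mul hP.le, one_div_mul_cancel hb'.ne', Real.rpow_one]
      congr 4
      field_simp
    have h9 : P⁻¹ ≤ Real.exp (-(eps d * d)) := by
      rw [Real.exp_neg]
      exact inv_anti₀ (Real.exp_pos _) (by simpa using h3)
    have h10 : (2 : ℝ) ^ (-(ζ / 3 * nlog d)) = P⁻¹ := by rw [hPdef, Real.rpow_neg zero_le_two]
    rw [h10] at h2
    have h11 : (2 : ℝ) ^ (-(ζ * nlog d)) = P⁻¹ * P⁻¹ * P⁻¹ := by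
      rw [← h10, ← Real.rpow_add two_pos, ← Real.rpow_add two_pos]
      congr 1
      ring
    rw [h8, h11]
    calc P⁻¹ * P⁻¹ * P⁻¹ ≤ P⁻¹ * (Real.exp (-(b : ℕ)) * ((16 * (d : ℝ)) ^ b)⁻¹
        * (eps d ^ 2 / 2304) ^ b) * Real.exp (-(eps d * d)) := by gcongr
      _ = _ := by ring

/-- It is very unlikely that the vectors chosen in some block cover less than a fraction `τ` of
its sphere. -/
lemma prob_block_bad_le {d b K : ℕ} (hne : ∀ i : Fin b, Nonempty (Block d b i)) {δ a τ : ℝ}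
    (hτ : τ ≤ 1 / 2)
    (h : ∀ (i : Fin b) (c : USphere (Block d b i)),
      0 < (unifSphere (Block d b i)).real
        {u | ApproxEq δ (inner ℝ (c : EuclideanSpace ℝ (Block d b i)) u) a} ∧
      τ ≤ K * (unifSphere (Block d b i)).real
        {u | ApproxEq δ (inner ℝ (c : EuclideanSpace ℝ (Block d b i)) u) a} / 4) :
    (Measure.pi fun i => Measure.pi fun _ : Fin K => unifSphere (Block d b i)).real
      {c | ∃ i, (unifSphere (Block d b i)).real (coverSet δ a (c i)) < τ} ≤ b * (9 / 10) ^ K := by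
  have key : ∀ i : Fin b, (Measure.pi fun _ : Fin K => unifSphere (Block d b i)).real
      {c | (unifSphere (Block d b i)).real (coverSet δ a c) < τ} ≤ (9 / 10) ^ K := by
    intro i
    have := hne i
    let c₀ : USphere (Block d b i) := ⟨EuclideanSpace.single (Classical.arbitrary _) 1, by simp⟩
    have hT : MeasurableSet {t : ℝ | ApproxEq δ t a} := measurableSet_approxEq measurable_id _ _
    have hR : MeasurableSet {p : USphere (Block d b i) × USphere (Block d b i) |
        ApproxEq δ (inner ℝ (p.1 : EuclideanSpace ℝ (Block d b i))
          (p.2 : EuclideanSpace ℝ (Block d b i))) a} :=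
      measurableSet_approxEq (by fun_prop) _ _
    have e1 : ∀ x : USphere (Block d b i), (unifSphere (Block d b i)).real
        {c | ApproxEq δ (inner ℝ (x : EuclideanSpace ℝ (Block d b i))
          (c : EuclideanSpace ℝ (Block d b i))) a} = (unifSphere (Block d b i)).real
        {u | ApproxEq δ (inner ℝ (c₀ : EuclideanSpace ℝ (Block d b i)) u) a} :=
      fun x => unifSphere_real_inner_eq x c₀ hT
    refine le_trans (measureReal_mono ?_) (prob_cover_lt_le (unifSphere (Block d b i)) hR (h i c₀).1
      e1 (fun c => ?_) K)
    · intro c hc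
      exact lt_of_lt_of_le hc (le_min hτ (h i c₀).2)
    · rw [← e1 c]
      simp only [Set.mem_ofPred_eq, real_inner_comm]
  have hsub : {c : (i : Fin b) → Fin K → USphere (Block d b i) |
      ∃ i, (unifSphere (Block d b i)).real (coverSet δ a (c i)) < τ}
      = ⋃ i, (fun c => c i) ⁻¹' {c : Fin K → USphere (Block d b i) |
        (unifSphere (Block d b i)).real (coverSet δ a c) < τ} := by
    ext c; simp
  rw [hsub]
  refine (measureReal_iUnion_fintype_le _).trans ?_
  calc _ ≤ ∑ _i : Fin b, ((9 : ℝ) / 10) ^ K := by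
        gcongr with i
        refine le_trans ?_ (key i)
        have hp : MeasurePreserving (Function.eval i)
            (Measure.pi fun i => Measure.pi fun _ : Fin K => unifSphere (Block d b i))
            (Measure.pi fun _ : Fin K => unifSphere (Block d b i)) :=
          measurePreserving_eval _ i
        have := hp.measure_preimage_le {c : Fin K → USphere (Block d b i) |
          (unifSphere (Block d b i)).real (coverSet δ a c) < τ}
        exact ENNReal.toReal_mono (measure_ne_top _ _) this
    _ = _ := by simp

/-- Caps are exponentially small, uniformly in the angle. -/
lemma exists_eventually_cap_le {κ : ℝ} (hκ : 0 < κ) (hκ4 : κ < Real.pi / 4) :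
    ∃ c : ℝ, 0 < c ∧ ∀ᶠ d : ℕ in atTop, ∀ α ∈ Set.Icc κ (Real.pi / 2 - κ),
      0 < pCap d α ∧ pCap d α ≤ (2 : ℝ) ^ (-(c * d)) := by
  have hs := sin_pos_of_lt hκ hκ4
  have hc1 : Real.cos κ < 1 := by
    have h1 := Real.sin_sq_add_cos_sq κ
    have : 0 < Real.sin κ ^ 2 := by positivity
    nlinarith [Real.cos_le_one κ]
  have hc0 : 0 < Real.cos κ := Real.cos_pos_of_mem_Ioo ⟨by linarith [Real.pi_pos], by linarith⟩
  set l := -Real.logb 2 (Real.cos κ) with hl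
  have hl0 : 0 < l := by
    have := Real.logb_neg one_lt_two hc0 hc1
    linarith
  have hcl : Real.cos κ = 2 ^ (-l) := by
    rw [hl, neg_neg, Real.rpow_logb two_pos (by norm_num) hc0]
  refine ⟨l / 2, by positivity, ?_⟩
  filter_upwards [eventually_cap_bounds hκ hκ4 one_pos,
    eventually_nlog_le (show 0 < l / 2 by positivity)] with d h1 h2 α hα
  obtain ⟨hb1, -⟩ := sin_cos_bounds hκ hα
  obtain ⟨h3, h4⟩ := h1 α hα
  refine ⟨lt_of_lt_of_le (by have := hs.trans_le hb1; positivity) h3, h4.trans ?_⟩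
  have h5 : Real.sin α ≤ Real.cos κ := by
    rw [← Real.cos_pi_div_two_sub]
    exact Real.cos_le_cos_of_nonneg_of_le_pi hκ.le (by linarith [hα.1, Real.pi_pos])
      (by linarith [hα.2])
  calc (2 : ℝ) ^ (1 * nlog d) * Real.sin α ^ d ≤ 2 ^ (l / 2 * d) * Real.cos κ ^ d := by
        have := hs.le.trans hb1
        rw [one_mul]
        gcongr
        norm_num
    _ = _ := by
        rw [hcl, ← Real.rpow_natCast, ← Real.rpow_mul zero_le_two, ← Real.rpow_add two_pos]
        congr 1
        ring

/-- The blocks have more than linearly many vectors, as `p ^ (-1 / b) = 2 ^ Ω(d / log d)`. Hence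
rounding up their number costs little, and the expected number of vectors of one product code that
match a given vector is at most `3`. -/
lemma eventually_blockSize_bounds {κ : ℝ} (hκ : 0 < κ) (hκ4 : κ < Real.pi / 4) (C : ℝ) :
    ∀ᶠ d : ℕ in atTop, ∀ α ∈ Set.Icc κ (Real.pi / 2 - κ),
      C * d ≤ blockSize (Nat.log 2 d) (1 / pCap d α) ∧
      (blockSize (Nat.log 2 d) (1 / pCap d α) : ℝ) ^ Nat.log 2 d * pCap d α ≤ 3 := by
  obtain ⟨c, hc, h⟩ := exists_eventually_cap_le hκ hκ4
  filter_upwards [h, eventually_poly_le C 1 hc, eventually_poly_le 1 1 hc,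
    eventually_ge_atTop 2] with d h1 h2 h3 hd α hα
  obtain ⟨hp, hpc⟩ := h1 α hα
  have hb : 0 < Nat.log 2 d := natLog_pos hd
  have hbl := natLog_le_logb d
  have hbd : Nat.log 2 d ≤ d := Nat.log_le_self 2 d
  set b := Nat.log 2 d
  set p := pCap d α
  have hb' : (0 : ℝ) < b := by exact_mod_cast hb
  have hbd' : (b : ℝ) ≤ d := by exact_mod_cast hbd
  have hd' : (0 : ℝ) < d := by linarith
  set r := p ^ (1 / (b : ℝ)) with hr
  have hr0 : 0 < r := by positivity
  have hrb : r ^ b = p := by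
    rw [hr, ← Real.rpow_natCast, ← Real.rpow_mul hp.le, one_div_mul_cancel hb'.ne', Real.rpow_one]
  have hMr : (1 / p) ^ (1 / (b : ℝ)) = r⁻¹ := by rw [one_div p, Real.inv_rpow hp.le]
  have hr1 : r ≤ ((2 : ℝ) ^ (c * nlog d))⁻¹ := by
    rw [← Real.rpow_neg zero_le_two]
    calc r ≤ ((2 : ℝ) ^ (-(c * d))) ^ (1 / (b : ℝ)) :=
          Real.rpow_le_rpow hp.le hpc (by positivity)
      _ = 2 ^ (-(c * (d / b))) := by
        rw [← Real.rpow_mul zero_le_two]; congr 1; ring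
      _ ≤ _ := by
        gcongr
        · norm_num
        · exact div_le_div_of_nonneg_left hd'.le hb' hbl
  have hr2 : (2 : ℝ) ^ (c * nlog d) ≤ r⁻¹ := by
    rw [le_inv_comm₀ (by positivity) hr0]; exact hr1
  constructor
  · calc C * d = C * (d : ℝ) ^ 1 := by rw [pow_one]
      _ ≤ r⁻¹ := h2.trans hr2
      _ ≤ _ := by rw [← hMr]; exact le_blockSize _ _
  · have hK : (blockSize b (1 / p) : ℝ) ≤ r⁻¹ + 1 := by
      rw [← hMr]
      exact (Nat.ceil_lt_add_one (by positivity)).le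
    have hrb1 : b * r ≤ 1 := by
      have : (b : ℝ) ≤ r⁻¹ := by
        refine le_trans ?_ hr2
        rw [pow_one, one_mul] at h3
        exact hbd'.trans h3
      calc b * r ≤ r⁻¹ * r := by gcongr
        _ = 1 := inv_mul_cancel₀ hr0.ne'
    calc (blockSize b (1 / p) : ℝ) ^ b * p ≤ (r⁻¹ + 1) ^ b * r ^ b := by rw [hrb]; gcongr
      _ = (r + 1) ^ b := by rw [← mul_pow]; congr 1; field_simp; ring
      _ ≤ Real.exp r ^ b := by gcongr; exact Real.add_one_le_exp r
      _ = Real.exp (b * r) := (Real.exp_nat_mul r b).symm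
      _ ≤ Real.exp 1 := by gcongr
      _ ≤ 3 := by linarith [Real.exp_one_lt_d9]

end blockCover

/-! ### Pairs linked by a common set -/

section pairs

variable {X I : Type*} {m : ℕ}

/-- The pairs of positions of the list `x` whose entries are related by `R` and lie in a common
set `A ι`. -/
def linkedPairs (A : I → Set X) (R : Set (X × X)) (x : Fin m → X) : Set (Fin m × Fin m) :=
  {q | (x q.1, x q.2) ∈ R ∧ ∃ ι, x q.1 ∈ A ι ∧ x q.2 ∈ A ι}

/-- The list `x` behaves as a typical random list: at least `g` entries lie in `G`, at most `a` in
each `A ι`, and every entry in `A ι` has between `h₁` and `h₂` related entries in `A ι`. -/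
structure NiceList (A : I → Set X) (G : Set X) (R : Set (X × X)) (a g h₁ h₂ : ℝ)
    (x : Fin m → X) : Prop where
  good : g ≤ hits G x
  cap : ∀ ι, hits (A ι) x ≤ a
  related : ∀ ι i, x i ∈ A ι →
    h₁ ≤ hits {y | y ∈ A ι ∧ (x i, y) ∈ R} x ∧ hits {y | y ∈ A ι ∧ (x i, y) ∈ R} x ≤ h₂

lemma ncard_eq_sum_indicator (S : Set (Fin m × Fin m)) :
    (S.ncard : ℝ) = ∑ i, ∑ j, S.indicator (fun _ => (1 : ℝ)) (i, j) := by
  classical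
  rw [← Fintype.sum_prod_type', Set.ncard_eq_toFinset_card', Finset.cast_card]
  simp [Set.indicator_apply]

/-- The number of linked pairs, bounded by a union over the sets `A ι`. -/
lemma NiceList.ncard_linkedPairs_le [Fintype I] {A : I → Set X} {G : Set X} {R : Set (X × X)}
    {a g h₁ h₂ : ℝ} {x : Fin m → X} (h : NiceList A G R a g h₁ h₂ x) (hh : 0 ≤ h₂) :
    ((linkedPairs A R x).ncard : ℝ) ≤ Fintype.card I * (a * h₂) := by
  classical
  rw [ncard_eq_sum_indicator]
  calc ∑ i, ∑ j, (linkedPairs A R x).indicator (fun _ => (1 : ℝ)) (i, j)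
      ≤ ∑ i, ∑ j, ∑ ι, (A ι).indicator (fun _ => (1 : ℝ)) (x i) *
          {y | y ∈ A ι ∧ (x i, y) ∈ R}.indicator (fun _ => (1 : ℝ)) (x j) := by
        refine Finset.sum_le_sum fun i _ => Finset.sum_le_sum fun j _ => ?_
        have hnn : ∀ ι, 0 ≤ (A ι).indicator (fun _ => (1 : ℝ)) (x i) *
            {y | y ∈ A ι ∧ (x i, y) ∈ R}.indicator (fun _ => (1 : ℝ)) (x j) := fun ι =>
          mul_nonneg (Set.indicator_nonneg (fun _ _ => zero_le_one) _)
            (Set.indicator_nonneg (fun _ _ => zero_le_one) _)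
        by_cases hq : (i, j) ∈ linkedPairs A R x
        · obtain ⟨hR, ι, h1, h2⟩ := hq
          have hq' : (i, j) ∈ linkedPairs A R x := ⟨hR, ι, h1, h2⟩
          rw [Set.indicator_of_mem hq']
          refine le_trans (le_of_eq ?_)
            (Finset.single_le_sum (fun ι _ => hnn ι) (Finset.mem_univ ι))
          rw [Set.indicator_of_mem h1, Set.indicator_of_mem (show x j ∈ {y | y ∈ A ι ∧ (x i, y) ∈ R}
            from ⟨h2, hR⟩), one_mul]
        · rw [Set.indicator_of_notMem hq]
          exact Finset.sum_nonneg fun ι _ => hnn ι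
    _ = ∑ ι, ∑ i, (A ι).indicator (fun _ => (1 : ℝ)) (x i) *
          hits {y | y ∈ A ι ∧ (x i, y) ∈ R} x := by
        rw [Finset.sum_comm]
        simp_rw [hits, Finset.mul_sum]
        rw [Finset.sum_comm]
        refine (Finset.sum_congr rfl fun i _ => Finset.sum_comm).trans Finset.sum_comm
    _ ≤ ∑ ι, ∑ i, (A ι).indicator (fun _ => (1 : ℝ)) (x i) * h₂ := by
        refine Finset.sum_le_sum fun ι _ => Finset.sum_le_sum fun i _ => ?_
        by_cases hi : x i ∈ A ι
        · exact mul_le_mul_of_nonneg_left (h.related ι i hi).2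
            (Set.indicator_nonneg (fun _ _ => zero_le_one) _)
        · simp [hi]
    _ = ∑ ι, hits (A ι) x * h₂ := by simp_rw [hits, Finset.sum_mul]
    _ ≤ ∑ _ι : I, a * h₂ := by gcongr with ι; exact h.cap ι
    _ = _ := by simp

/-- Every entry in `G` lies in some `A ι`, and a single such set already contains enough partners.
-/
lemma NiceList.le_ncard_linkedPairs {A : I → Set X} {G : Set X} {R : Set (X × X)} {a g h₁ h₂ : ℝ}
    {x : Fin m → X} (h : NiceList A G R a g h₁ h₂ x) (hh : 0 ≤ h₁)
    (hG : ∀ u ∈ G, ∃ ι, u ∈ A ι) :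
    g * h₁ ≤ ((linkedPairs A R x ∩ {q | x q.1 ∈ G}).ncard : ℝ) := by
  rw [ncard_eq_sum_indicator]
  calc g * h₁ ≤ hits G x * h₁ := by gcongr; exact h.good
    _ = ∑ i, G.indicator (fun _ => (1 : ℝ)) (x i) * h₁ := by rw [hits, Finset.sum_mul]
    _ ≤ _ := by
        refine Finset.sum_le_sum fun i _ => ?_
        by_cases hi : x i ∈ G
        · obtain ⟨ι, hι⟩ := hG _ hi
          rw [Set.indicator_of_mem hi, one_mul]
          refine (h.related ι i hι).1.trans (Finset.sum_le_sum fun j _ => ?_)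
          by_cases hj : x j ∈ {y | y ∈ A ι ∧ (x i, y) ∈ R}
          · rw [Set.indicator_of_mem hj, Set.indicator_of_mem]
            exact ⟨⟨hj.2, ι, hι, hj.1⟩, hi⟩
          · rw [Set.indicator_of_notMem hj]
            exact Set.indicator_nonneg (fun _ _ => zero_le_one) _
        · rw [Set.indicator_of_notMem hi, zero_mul]
          exact Finset.sum_nonneg fun j _ => Set.indicator_nonneg (fun _ _ => zero_le_one) _

end pairs

section typical

variable {X I Z : Type*}

lemma measurable_hits_of_measurableSet {W : Type*} [MeasurableSpace W] {m : ℕ} {S : W → Set X}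
    {x : W → Fin m → X} (h : ∀ i, MeasurableSet {w | x w i ∈ S w}) :
    Measurable fun w => hits (S w) (x w) := by
  classical
  refine Finset.measurable_sum _ fun i _ => ?_
  have : (fun w => (S w).indicator (fun _ => (1 : ℝ)) (x w i))
      = {w | x w i ∈ S w}.indicator fun _ => (1 : ℝ) := by
    ext w
    simp [Set.indicator_apply]
  rw [this]
  exact measurable_const.indicator (h i)

variable [Fintype I] [MeasurableSpace X] [MeasurableSpace Z]

/-- A random list fails to be typical with very small probability. -/
lemma prob_not_niceList_le (μ : Measure X) [IsProbabilityMeasure μ] {n : ℕ} {A : I → Set X}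
    (hA : ∀ ι, MeasurableSet (A ι)) {G : Set X} (hG : MeasurableSet G) {R : Set (X × X)}
    (hR : MeasurableSet R) (hirr : ∀ a, (a, a) ∉ R) {p q₁ q₂ ρ : ℝ} (hp : ∀ ι, μ.real (A ι) ≤ p)
    (hq : ∀ ι, ∀ a ∈ A ι, q₁ ≤ μ.real {y | y ∈ A ι ∧ (a, y) ∈ R} ∧
      μ.real {y | y ∈ A ι ∧ (a, y) ∈ R} ≤ q₂) (hq₁ : 0 ≤ q₁) (hρ0 : 0 ≤ ρ) (hρ : ρ ≤ μ.real G) :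
    (Measure.pi fun _ : Fin (n + 1) => μ).real
      {x | ¬ NiceList A G R (4 * ((n + 1 : ℕ) * p)) ((n + 1 : ℕ) * ρ / 4) (n * q₁ / 4)
        (4 * (n * q₂)) x}
      ≤ Real.exp (-((n + 1 : ℕ) * ρ / 4)) + (Fintype.card I * Real.exp (-((n + 1 : ℕ) * p))
        + Fintype.card I * ((n + 1 : ℕ) * (Real.exp (-(n * q₂)) + Real.exp (-(n * q₁ / 4))))) := by
  set P := Measure.pi fun _ : Fin (n + 1) => μ
  have hRel : ∀ ι, MeasurableSet {p : X × X | p.2 ∈ A ι ∧ p ∈ R} := fun ι =>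
    (measurable_snd (hA ι)).inter hR
  have hsub : {x : Fin (n + 1) → X | ¬ NiceList A G R (4 * ((n + 1 : ℕ) * p))
        ((n + 1 : ℕ) * ρ / 4) (n * q₁ / 4) (4 * (n * q₂)) x} ⊆
      {x | hits G x ≤ (n + 1 : ℕ) * ρ / 4} ∪ ((⋃ ι, {x | 4 * ((n + 1 : ℕ) * p) ≤ hits (A ι) x}) ∪
        ⋃ ι, ⋃ i, ({x | x i ∈ A ι ∧ 4 * (n * q₂) ≤ hits {y | (x i, y) ∈
            {p : X × X | p.2 ∈ A ι ∧ p ∈ R}} x} ∪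
          {x | x i ∈ A ι ∧ hits {y | (x i, y) ∈ {p : X × X | p.2 ∈ A ι ∧ p ∈ R}} x
            ≤ n * q₁ / 4})) := by
    intro x hx
    by_contra hcon
    simp only [Set.mem_union, Set.mem_iUnion, Set.mem_ofPred_eq, not_or, not_exists, not_and,
      not_le] at hcon
    exact hx ⟨hcon.1.le, fun ι => (hcon.2.1 ι).le, fun ι i hi =>
      ⟨((hcon.2.2 ι i).2 hi).le, ((hcon.2.2 ι i).1 hi).le⟩⟩
  refine (measureReal_mono hsub).trans ((measureReal_union_le _ _).trans ?_)
  refine add_le_add (prob_hits_le_le μ (n + 1) hG (by positivity) (by gcongr)) ?_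
  refine (measureReal_union_le _ _).trans (add_le_add ?_ ?_)
  · refine (measureReal_iUnion_fintype_le _).trans ?_
    calc _ ≤ ∑ _ι : I, Real.exp (-((n + 1 : ℕ) * p)) := by
          gcongr with ι
          exact prob_hits_ge_le μ (n + 1) (hA ι) (by gcongr; exact hp ι)
      _ = _ := by simp
  · refine (measureReal_iUnion_fintype_le _).trans ?_
    calc _ ≤ ∑ _ι : I, ((n + 1 : ℕ) * (Real.exp (-(n * q₂)) + Real.exp (-(n * q₁ / 4)))) := by
          refine Finset.sum_le_sum fun ι _ => (measureReal_iUnion_fintype_le _).trans ?_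
          calc _ ≤ ∑ _i : Fin (n + 1), (Real.exp (-(n * q₂)) + Real.exp (-(n * q₁ / 4))) := by
                refine Finset.sum_le_sum fun i _ => (measureReal_union_le _ _).trans
                  (add_le_add ?_ ?_)
                · exact prob_hits_related_ge_le μ i (hRel ι) (fun a ha => hirr a ha.2) (hA ι)
                    fun a ha => mul_le_mul_of_nonneg_left (hq ι a ha).2 n.cast_nonneg
                · exact prob_hits_related_le_le μ i (hRel ι) (fun a ha => hirr a ha.2) (hA ι)
                    (by positivity)
                    fun a ha => mul_le_mul_of_nonneg_left (hq ι a ha).1 n.cast_nonneg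
            _ = _ := by simp [mul_add]
      _ = _ := by simp

lemma prob_not_injective (μ : Measure X) [IsProbabilityMeasure μ] [NullSingletonClass μ]
    [MeasurableEq X] (m : ℕ) :
    (Measure.pi fun _ : Fin m => μ).real {x | ¬ Function.Injective x} = 0 := by
  rcases m with - | n
  · have : {x : Fin 0 → X | ¬ Function.Injective x} = ∅ := by
      ext x
      simp [Function.injective_of_subsingleton]
    rw [this, measureReal_empty]
  have hsub : {x : Fin (n + 1) → X | ¬ Function.Injective x} ⊆
      ⋃ i, ⋃ j : Fin n, {x | (x i, fun k => x (i.succAbove k)) ∈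
        {p : X × (Fin n → X) | p.2 j = p.1}} := by
    intro x hx
    simp only [Set.mem_ofPred_eq, Function.Injective, not_forall] at hx
    obtain ⟨i, k, hxe, hne⟩ := hx
    obtain ⟨j, rfl⟩ := Fin.exists_succAbove_eq (Ne.symm hne)
    exact Set.mem_iUnion.mpr ⟨i, Set.mem_iUnion.mpr ⟨j, hxe.symm⟩⟩
  refine le_antisymm ((measureReal_mono hsub).trans ((measureReal_iUnion_fintype_le _).trans
    (Finset.sum_nonpos fun i _ => (measureReal_iUnion_fintype_le _).trans
      (Finset.sum_nonpos fun j _ => ?_)))) measureReal_nonneg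
  refine pi_real_le_of_fix μ i ?_ fun a => ?_
  · exact measurableSet_eq_fun ((measurable_pi_apply j).comp measurable_snd) measurable_fst
  · have hmp : MeasurePreserving (Function.eval j) (Measure.pi fun _ : Fin n => μ) μ :=
      measurePreserving_eval _ j
    have h := hmp.measure_preimage (measurableSet_singleton a).nullMeasurableSet
    have : {x : Fin n → X | (a, x) ∈ {p : X × (Fin n → X) | p.2 j = p.1}}
        = Function.eval j ⁻¹' ({a} : Set X) := by ext; simp
    rw [this, measureReal_def, h]
    simp

/-- A random list is typical for the sets `A ι z` given by an independent random `z`, unless `z`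
itself is bad. -/
lemma prob_niceList_ge (μ : Measure X) [IsProbabilityMeasure μ] [NullSingletonClass μ]
    [MeasurableEq X] (ν : Measure Z) [IsProbabilityMeasure ν] {m : ℕ} {A : I → Z → Set X}
    {G : Z → Set X}
    {R : Set (X × X)} {a g h₁ h₂ δ₀ δ₁ : ℝ}
    (hA : ∀ ι, MeasurableSet {w : X × Z | w.1 ∈ A ι w.2})
    (hG : MeasurableSet {w : X × Z | w.1 ∈ G w.2}) (hR : MeasurableSet R) (hδ₁ : 0 ≤ δ₁)
    {B : Set Z} (hB : ν.real B ≤ δ₀)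
    (h : ∀ z ∉ B, (Measure.pi fun _ : Fin m => μ).real
      {x | ¬ NiceList (fun ι => A ι z) (G z) R a g h₁ h₂ x} ≤ δ₁) {E : Set ((Fin m → X) × Z)}
    (hE : ∀ x z, Function.Injective x → NiceList (fun ι => A ι z) (G z) R a g h₁ h₂ x →
      (x, z) ∈ E) :
    1 - (δ₀ + δ₁) ≤ ((Measure.pi fun _ : Fin m => μ).prod ν).real E := by
  set P := Measure.pi fun _ : Fin m => μ
  set B' := toMeasurable ν B
  let T : Set ((Fin m → X) × Z) :=
    {w | w.2 ∉ B' ∧ ¬ NiceList (fun ι => A ι w.2) (G w.2) R a g h₁ h₂ w.1}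
  have hAi : ∀ ι i, MeasurableSet {w : (Fin m → X) × Z | w.1 i ∈ A ι w.2} := fun ι i =>
    (((measurable_pi_apply i).comp measurable_fst).prodMk measurable_snd :
      Measurable fun w : (Fin m → X) × Z => (w.1 i, w.2)) (hA ι)
  have hGi : ∀ i, MeasurableSet {w : (Fin m → X) × Z | w.1 i ∈ G w.2} := fun i =>
    (((measurable_pi_apply i).comp measurable_fst).prodMk measurable_snd :
      Measurable fun w : (Fin m → X) × Z => (w.1 i, w.2)) hG
  have hrel : ∀ ι i, Measurable fun w : (Fin m → X) × Z =>
      hits {y | y ∈ A ι w.2 ∧ (w.1 i, y) ∈ R} w.1 := fun ι i =>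
    measurable_hits_of_measurableSet fun j => (hAi ι j).inter
      ((((measurable_pi_apply i).comp measurable_fst).prodMk
        ((measurable_pi_apply j).comp measurable_fst) :
        Measurable fun w : (Fin m → X) × Z => (w.1 i, w.1 j)) hR)
  have hN : MeasurableSet
      {w : (Fin m → X) × Z | NiceList (fun ι => A ι w.2) (G w.2) R a g h₁ h₂ w.1} := by
    have he : {w : (Fin m → X) × Z | NiceList (fun ι => A ι w.2) (G w.2) R a g h₁ h₂ w.1}
        = {w | g ≤ hits (G w.2) w.1} ∩ ((⋂ ι, {w | hits (A ι w.2) w.1 ≤ a}) ∩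
          ⋂ ι, ⋂ i, ({w | w.1 i ∈ A ι w.2}ᶜ ∪
            ({w | h₁ ≤ hits {y | y ∈ A ι w.2 ∧ (w.1 i, y) ∈ R} w.1} ∩
              {w | hits {y | y ∈ A ι w.2 ∧ (w.1 i, y) ∈ R} w.1 ≤ h₂}))) := by
      ext w
      simp only [Set.mem_inter_iff, Set.mem_iInter, Set.mem_union, Set.mem_compl_iff,
        Set.mem_ofPred_eq, ← imp_iff_not_or]
      exact ⟨fun hw => ⟨hw.good, hw.cap, hw.related⟩, fun hw => ⟨hw.1, hw.2.1, hw.2.2⟩⟩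
    rw [he]
    refine (measurableSet_le measurable_const (measurable_hits_of_measurableSet hGi)).inter
      ((MeasurableSet.iInter fun ι => measurableSet_le
        (measurable_hits_of_measurableSet (hAi ι)) measurable_const).inter
      (MeasurableSet.iInter fun ι => MeasurableSet.iInter fun i => (hAi ι i).compl.union
        ((measurableSet_le measurable_const (hrel ι i)).inter
          (measurableSet_le (hrel ι i) measurable_const))))
  have hT : MeasurableSet T :=
    (measurable_snd (measurableSet_toMeasurable ν B)).compl.inter hN.compl
  have h1 : (P.prod ν).real T ≤ δ₁ := by
    refine prod_real_le_of_section_symm P ν hT fun z => ?_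
    by_cases hz : z ∈ B'
    · have : (fun x : Fin m → X => (x, z)) ⁻¹' T = ∅ := by
        ext x
        simp [T, hz]
      rw [this, measureReal_empty]
      exact hδ₁
    · refine le_trans (measureReal_mono fun x hx => ?_)
        (h z fun hzB => hz (subset_toMeasurable ν B hzB))
      exact hx.2
  have h2 : (P.prod ν).real (Set.univ ×ˢ B') ≤ δ₀ := by
    rw [measureReal_prod_prod, probReal_univ, one_mul]
    rwa [measureReal_def, measure_toMeasurable]
  have h3 : (P.prod ν).real ({x | ¬ Function.Injective x} ×ˢ Set.univ) = 0 := by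
    rw [measureReal_prod_prod, prob_not_injective, zero_mul]
  have hcov : (Set.univ : Set ((Fin m → X) × Z)) ⊆
      E ∪ ((Set.univ ×ˢ B') ∪ (T ∪ {x | ¬ Function.Injective x} ×ˢ Set.univ)) := by
    rintro ⟨x, z⟩ -
    by_cases hz : z ∈ B'
    · exact Or.inr (Or.inl ⟨trivial, hz⟩)
    by_cases hi : Function.Injective x
    · by_cases hn : NiceList (fun ι => A ι z) (G z) R a g h₁ h₂ x
      · exact Or.inl (hE x z hi hn)
      · exact Or.inr (Or.inr (Or.inl ⟨hz, hn⟩))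
    · exact Or.inr (Or.inr (Or.inr ⟨hi, trivial⟩))
  have h4 := (measureReal_mono (μ := P.prod ν) hcov).trans (measureReal_union_le _ _)
  have h5 := measureReal_union_le (μ := P.prod ν) (Set.univ ×ˢ B')
    (T ∪ {x | ¬ Function.Injective x} ×ˢ Set.univ)
  have h6 := measureReal_union_le (μ := P.prod ν) T ({x | ¬ Function.Injective x} ×ˢ Set.univ)
  rw [probReal_univ] at h4
  linarith

end typical

/-! ### Caps around the vectors of a random product code -/

section code

variable {d b N : ℕ} {M : ℝ}

/-- The vector of the code with a given rotation and given choices from the blocks. -/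
noncomputable def codeVec (D : RPCDesc d b M N) (ι : Fin N × (Fin b → Fin (blockSize b M))) :
    EuclideanSpace ℝ (Fin d) :=
  rotIso (D.1 ι.1) (blockVec fun i => D.2 i (ι.2 i))

lemma norm_codeVec (hb : 0 < b) (D : RPCDesc d b M N)
    (ι : Fin N × (Fin b → Fin (blockSize b M))) : ‖codeVec D ι‖ = 1 := by
  rw [codeVec, LinearIsometryEquiv.norm_map, norm_blockVec hb]

lemma rpcCode_eq_range (D : RPCDesc d b M N) : rpcCode D = Set.range (codeVec D) := by
  ext c
  constructor
  · rintro ⟨n, k, rfl⟩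
    exact ⟨(n, k), rfl⟩
  · rintro ⟨⟨n, k⟩, rfl⟩
    exact ⟨n, k, rfl⟩

lemma measurable_blockVec :
    Measurable fun s : (i : Fin b) → USphere (Block d b i) => blockVec (d := d) s := by
  refine (PiLp.continuous_toLp 2 _).measurable.comp (measurable_pi_lambda _ fun j => ?_)
  refine Finset.measurable_sum _ fun i _ => ?_
  by_cases h : (j : ℕ) * b / d = (i : ℕ)
  · simp only [h, dite_true]
    refine Measurable.const_mul ?_ _
    have h1 : Measurable fun u : USphere (Block d b i) => u.1 ⟨j, h⟩ := by fun_prop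
    exact h1.comp (measurable_pi_apply i)
  · simp only [h, dite_false]
    exact measurable_const

lemma measurable_codeVec (ι : Fin N × (Fin b → Fin (blockSize b M))) :
    Measurable fun D : RPCDesc d b M N => codeVec D ι := by
  have h1 : Measurable fun D : RPCDesc d b M N =>
      blockVec (d := d) fun i => D.2 i (ι.2 i) :=
    measurable_blockVec.comp (measurable_pi_lambda _ fun i =>
      (measurable_pi_apply (ι.2 i)).comp ((measurable_pi_apply i).comp measurable_snd))
  have h2 : ∀ j l, Measurable fun D : RPCDesc d b M N =>
      (D.1 ι.1 : Matrix (Fin d) (Fin d) ℝ) j l := fun j l => by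
    have : Continuous fun Q : SO d => (Q : Matrix (Fin d) (Fin d) ℝ) j l :=
      (continuous_apply l).comp ((continuous_apply j).comp continuous_subtype_val)
    exact this.measurable.comp ((measurable_pi_apply ι.1).comp measurable_fst)
  have h3 : ∀ l, Measurable fun D : RPCDesc d b M N =>
      (blockVec (d := d) fun i => D.2 i (ι.2 i)) l := fun l =>
    (show Measurable fun y : EuclideanSpace ℝ (Fin d) => y l by fun_prop).comp h1
  have h4 : (fun D : RPCDesc d b M N => codeVec D ι) = fun D => WithLp.toLp 2 fun j =>
      ∑ l, (D.1 ι.1 : Matrix (Fin d) (Fin d) ℝ) j l * (blockVec fun i => D.2 i (ι.2 i)) l := by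
    ext D j
    simp [codeVec, rotIso_apply, Matrix.toLpLin_apply, Matrix.mulVec, dotProduct]
  rw [h4]
  exact (PiLp.continuous_toLp 2 _).measurable.comp (measurable_pi_lambda _ fun j =>
    Finset.measurable_sum _ fun l _ => (h2 j l).mul (h3 l))

/-- The cap of the vectors whose inner product with a given code vector is `≈ cos α`. -/
def codeCap (α : ℝ) (ι : Fin N × (Fin b → Fin (blockSize b M))) (D : RPCDesc d b M N) :
    Set (USphere (Fin d)) :=
  {u | ApproxEq (eps d) (inner ℝ (u : EuclideanSpace ℝ (Fin d)) (codeVec D ι)) (Real.cos α)}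

/-- The vectors with at least one and at most `l` matching code vectors. -/
def fewMatches (α l : ℝ) (D : RPCDesc d b M N) : Set (USphere (Fin d)) :=
  {u | (∃ ι, u ∈ codeCap α ι D) ∧ ∑ ι, (codeCap α ι D).indicator (fun _ => (1 : ℝ)) u ≤ l}

/-- The pairs of vectors with inner product `≈ cos θ`. -/
def nearPairs (d : ℕ) (θ : ℝ) : Set (USphere (Fin d) × USphere (Fin d)) :=
  {p | ApproxEq (eps d) (inner ℝ (p.1 : EuclideanSpace ℝ (Fin d)) p.2) (Real.cos θ)}

lemma measurableSet_nearPairs (θ : ℝ) : MeasurableSet (nearPairs d θ) :=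
  measurableSet_approxEq (by fun_prop) _ _

lemma measurableSet_codeCap (α : ℝ) (ι : Fin N × (Fin b → Fin (blockSize b M))) :
    MeasurableSet {w : USphere (Fin d) × RPCDesc d b M N | w.1 ∈ codeCap α ι w.2} := by
  refine measurableSet_approxEq (X := USphere (Fin d) × RPCDesc d b M N) ?_ _ _
  exact Measurable.inner (measurable_subtype_coe.comp measurable_fst)
    ((measurable_codeVec ι).comp measurable_snd)

lemma measurableSet_fewMatches (α l : ℝ) :
    MeasurableSet {w : USphere (Fin d) × RPCDesc d b M N | w.1 ∈ fewMatches α l w.2} := by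
  have he : {w : USphere (Fin d) × RPCDesc d b M N | w.1 ∈ fewMatches α l w.2}
      = (⋃ ι, {w | w.1 ∈ codeCap α ι w.2}) ∩ {w | ∑ ι, {w : USphere (Fin d) × RPCDesc d b M N |
        w.1 ∈ codeCap α ι w.2}.indicator (fun _ => (1 : ℝ)) w ≤ l} := by
    ext w
    have hi : ∀ ι, (codeCap α ι w.2).indicator (fun _ => (1 : ℝ)) w.1
        = {w : USphere (Fin d) × RPCDesc d b M N | w.1 ∈ codeCap α ι w.2}.indicator
          (fun _ => (1 : ℝ)) w := by
      classical
      intro ι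
      simp [Set.indicator_apply]
    simp only [fewMatches, Set.mem_ofPred_eq, Set.mem_inter_iff, Set.mem_iUnion, hi]
  rw [he]
  exact (MeasurableSet.iUnion fun ι => measurableSet_codeCap α ι).inter
    (measurableSet_le (Finset.measurable_sum _ fun ι _ =>
      measurable_const.indicator (measurableSet_codeCap α ι)) measurable_const)

lemma prob_codeCap (hd : 0 < d) (hb : 0 < b) (α : ℝ) (ι : Fin N × (Fin b → Fin (blockSize b M)))
    (D : RPCDesc d b M N) : (unifSphere (Fin d)).real (codeCap α ι D) = pCap d α :=
  (pCap_eq hd α ⟨codeVec D ι, by simp [norm_codeVec hb]⟩).symm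

/-- If the vectors chosen in every block cover at least a share `τ` of the sphere of the block, then
`fewMatches` has measure at least about `τ ^ b`. One of the rotations already supplies the matches,
and by Markov's inequality only a share `J p / l` of the sphere has more than `l` of them, where `J`
is the size of the code and `p` the measure of a cap. -/
lemma prob_fewMatches_ge (hb : 0 < b) (hbd : b ≤ d) (hne : ∀ i : Fin b, Nonempty (Block d b i))
    (he0 : 0 < eps d) (he1 : eps d < 1) (hn : 1 ≤ ((d / b : ℕ) : ℝ) * (eps d / 3)) (hN : 0 < N)
    {α l τ : ℝ} (hl : 0 < l) (hτ : 0 ≤ τ) (D : RPCDesc d b M N)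
    (hD : ∀ i, τ ≤ (unifSphere (Block d b i)).real (coverSet (eps d / 3) (Real.cos α) (D.2 i))) :
    Real.exp (-b) * ((16 * (d : ℝ)) ^ b)⁻¹ * τ ^ b
        - Fintype.card (Fin N × (Fin b → Fin (blockSize b M))) * pCap d α / l
      ≤ (unifSphere (Fin d)).real (fewMatches α l D) := by
  have hd : 0 < d := by omega
  have : Nonempty (Fin d) := ⟨⟨0, hd⟩⟩
  set μ := unifSphere (Fin d)
  let F : USphere (Fin d) → ℝ := fun u => ∑ ι, (codeCap α ι D).indicator (fun _ => (1 : ℝ)) u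
  have hm : ∀ ι, MeasurableSet (codeCap α ι D) := fun ι =>
    measurable_prodMk_right (measurableSet_codeCap α ι)
  have h1 : Real.exp (-b) * ((16 * (d : ℝ)) ^ b)⁻¹ * τ ^ b
      ≤ μ.real {u | ∃ ι, u ∈ codeCap α ι D} := by
    calc Real.exp (-b) * ((16 * (d : ℝ)) ^ b)⁻¹ * τ ^ b
        ≤ Real.exp (-b) * ((16 * (d : ℝ)) ^ b)⁻¹ *
          ∏ i, (unifSphere (Block d b i)).real (coverSet (eps d / 3) (Real.cos α) (D.2 i)) := by
          gcongr
          calc τ ^ b = ∏ _i : Fin b, τ := by simp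
            _ ≤ _ := Finset.prod_le_prod (fun _ _ => hτ) fun i _ => hD i
      _ ≤ _ := prob_code_match_ge hb hbd (by positivity) (by linarith)
          (Real.abs_cos_le_one α) hn D.2 (rotIso (D.1 ⟨0, hN⟩))
      _ ≤ _ := by
          refine measureReal_mono ?_
          rintro u ⟨k, hk⟩
          refine ⟨(⟨0, hN⟩, k), ?_⟩
          rw [mul_div_cancel₀ _ three_ne_zero] at hk
          exact hk
  have hFi : ∀ ι, Integrable ((codeCap α ι D).indicator fun _ => (1 : ℝ)) μ := fun ι =>
    (integrable_const 1).indicator (hm ι)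
  -- Markov's inequality for the number of matches
  have h2 : μ.real {u | l ≤ F u}
      ≤ Fintype.card (Fin N × (Fin b → Fin (blockSize b M))) * pCap d α / l := by
    rw [le_div_iff₀ hl, mul_comm]
    refine (mul_meas_ge_le_integral_of_nonneg (ae_of_all _ fun u => Finset.sum_nonneg fun ι _ =>
      Set.indicator_nonneg (fun _ _ => zero_le_one) _)
      (integrable_finsetSum _ fun ι _ => hFi ι) l).trans (le_of_eq ?_)
    rw [integral_finsetSum _ fun ι _ => hFi ι]
    simp_rw [integral_indicator_const (1 : ℝ) (hm _), μ, prob_codeCap hd hb]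
    simp
  have h3 : {u | ∃ ι, u ∈ codeCap α ι D} ⊆ fewMatches α l D ∪ {u | l ≤ F u} := by
    intro u hu
    rcases le_total (F u) l with h | h
    · exact Or.inl ⟨hu, h⟩
    · exact Or.inr h
  have h4 := (measureReal_mono (μ := μ) h3).trans (measureReal_union_le _ _)
  linarith

variable {m : ℕ}

/-- Membership in `M₁`, in terms of positions of the list. -/
lemma M₁_eq_image (θ α : ℝ) (x : Fin m → USphere (Fin d)) (D : RPCDesc d b M N) :
    M₁ (listSet x) (rpcCode D) θ α
      = (fun q : Fin m × Fin m => ((x q.1 : EuclideanSpace ℝ (Fin d)),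
          (x q.2 : EuclideanSpace ℝ (Fin d)))) ''
        linkedPairs (fun ι => codeCap α ι D) (nearPairs d θ) x := by
  ext ⟨y, z⟩
  rw [rpcCode_eq_range]
  constructor
  · rintro ⟨⟨i, rfl⟩, ⟨j, rfl⟩, h, c, ⟨⟨ι, rfl⟩, h1⟩, -, h2⟩
    exact ⟨(i, j), ⟨h, ι, h1, h2⟩, rfl⟩
  · rintro ⟨⟨i, j⟩, ⟨h, ι, h1, h2⟩, he⟩
    obtain ⟨rfl, rfl⟩ := Prod.mk.inj he
    exact ⟨⟨i, rfl⟩, ⟨j, rfl⟩, h, codeVec D ι, ⟨⟨ι, rfl⟩, h1⟩, ⟨ι, rfl⟩, h2⟩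

lemma ncard_relR_le (α : ℝ) (u : USphere (Fin d)) (D : RPCDesc d b M N) :
    ((relR (rpcCode D) α u).ncard : ℝ) ≤ ∑ ι, (codeCap α ι D).indicator (fun _ => (1 : ℝ)) u := by
  classical
  have he : relR (rpcCode D) α u = codeVec D '' {ι | u ∈ codeCap α ι D} := by
    ext c
    rw [rpcCode_eq_range]
    constructor
    · rintro ⟨⟨ι, rfl⟩, h⟩
      exact ⟨ι, h, rfl⟩
    · rintro ⟨ι, h, rfl⟩
      exact ⟨⟨ι, rfl⟩, h⟩
  have h2 : ({ι | u ∈ codeCap α ι D}.ncard : ℝ)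
      = ∑ ι, (codeCap α ι D).indicator (fun _ => (1 : ℝ)) u := by
    rw [Set.ncard_eq_toFinset_card', Finset.cast_card]
    simp [Set.indicator_apply]
  rw [he, ← h2]
  exact_mod_cast Set.ncard_image_le (Set.toFinite _)

/-- For a typical list, the sizes of `M₁` and `M₁star` are both controlled. -/
lemma ncard_bounds_of_niceList {θ α a g h₁ h₂ : ℝ} {x : Fin m → USphere (Fin d)}
    (hx : Function.Injective x) {D : RPCDesc d b M N}
    (h : NiceList (fun ι => codeCap α ι D) (fewMatches α ((2 : ℝ) ^ ((d : ℝ) / Real.logb 2 d)) D)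
      (nearPairs d θ) a g h₁ h₂ x) (hh₁ : 0 ≤ h₁) (hh₂ : 0 ≤ h₂) :
    g * h₁ ≤ (M₁star (listSet x) (rpcCode D) θ α).ncard ∧
    ((M₁star (listSet x) (rpcCode D) θ α).ncard : ℝ) ≤ (M₁ (listSet x) (rpcCode D) θ α).ncard ∧
    ((M₁ (listSet x) (rpcCode D) θ α).ncard : ℝ)
      ≤ Fintype.card (Fin N × (Fin b → Fin (blockSize b M))) * (a * h₂) := by
  have hfin : (M₁ (listSet x) (rpcCode D) θ α).Finite := by
    rw [M₁_eq_image]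
    exact (Set.toFinite _).image _
  have hsub : M₁star (listSet x) (rpcCode D) θ α ⊆ M₁ (listSet x) (rpcCode D) θ α :=
    fun q hq => hq.1
  refine ⟨?_, ?_, ?_⟩
  · refine (h.le_ncard_linkedPairs hh₁ fun u hu => hu.1).trans ?_
    have hinj : Function.Injective fun q : Fin m × Fin m =>
        ((x q.1 : EuclideanSpace ℝ (Fin d)), (x q.2 : EuclideanSpace ℝ (Fin d))) := by
      rintro ⟨i, j⟩ ⟨i', j'⟩ he
      obtain ⟨h1, h2⟩ := Prod.mk.inj he
      exact Prod.ext (hx (Subtype.ext h1)) (hx (Subtype.ext h2))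
    rw [← Set.ncard_image_of_injective _ hinj]
    refine Nat.cast_le.mpr (Set.ncard_le_ncard ?_ (hfin.subset hsub))
    rintro _ ⟨q, ⟨hq1, hq2⟩, rfl⟩
    refine ⟨?_, (ncard_relR_le α (x q.1) D).trans hq2.2⟩
    rw [M₁_eq_image]
    exact ⟨q, hq1, rfl⟩
  · exact Nat.cast_le.mpr (Set.ncard_le_ncard hsub hfin)
  · refine le_trans ?_ (h.ncard_linkedPairs_le hh₂)
    rw [M₁_eq_image]
    exact Nat.cast_le.mpr (Set.ncard_image_le (Set.toFinite _))

end code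

/-! ### The laws of the list and of the code -/

section law

/-- A single point is contained in the set of vectors whose projection to a plane through this point
has norm at least `1`. -/
lemma unifSphere_singleton {d : ℕ} (hd : 3 ≤ d) (a : USphere (Fin d)) :
    unifSphere (Fin d) {a} = 0 := by
  obtain ⟨k, rfl⟩ : ∃ k, d = k + 2 := ⟨d - 2, by omega⟩
  have hk : Fintype.card (Fin (k + 2)) = k + 2 := Fintype.card_fin _
  have : Nonempty (Fin (k + 2)) := ⟨0⟩
  obtain ⟨e, he, hae⟩ := exists_orthogonal_unit hk a
  have h := prob_plane_norm_ge_le hk (by omega) (norm_usphere a) he hae 1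
  rw [sub_self, Real.sqrt_zero, zero_pow (by omega), mul_zero] at h
  have h2 : (unifSphere (Fin (k + 2))).real {a} ≤ 0 := by
    refine le_trans (measureReal_mono ?_) h
    rintro u rfl
    change (1 : ℝ) ≤ _
    rw [real_inner_self_eq_norm_sq, norm_usphere]
    nlinarith [sq_nonneg (inner ℝ e (u : EuclideanSpace ℝ (Fin (k + 2))))]
  exact (measureReal_eq_zero_iff).mp (le_antisymm h2 measureReal_nonneg)

instance (d : ℕ) : IsProbabilityMeasure (unifSO d) := ⟨by
  have := Measure.haarMeasure_self (K₀ := (⊤ : TopologicalSpace.PositiveCompacts (SO d)))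
  simpa [unifSO] using this⟩

end law

/-! ### The sizes of `M₁` and `M₁star` -/

section sizes

lemma isProbabilityMeasure_rpcLaw {d b : ℕ} (hb : 0 < b) (hbd : b ≤ d) (M : ℝ) (N : ℕ) :
    IsProbabilityMeasure (rpcLaw d b M N) := by
  have hne : ∀ i : Fin b, Nonempty (Block d b i) := fun i =>
    Fintype.card_pos_iff.mp ((Nat.div_pos hbd hb).trans_le (le_card_block hb i))
  rw [rpcLaw]
  infer_instance

lemma isProbabilityMeasure_jointLaw {d : ℕ} (hd : 2 ≤ d) (m N : ℕ) (α : ℝ) :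
    IsProbabilityMeasure (jointLaw d m N α) := by
  have := isProbabilityMeasure_rpcLaw (natLog_pos hd) (Nat.log_le_self 2 d) (1 / pCap d α) N
  have hned : Nonempty (Fin d) := ⟨⟨0, by omega⟩⟩
  rw [jointLaw]
  infer_instance

/-- The two sizes are as expected, up to the deviations allowed for a typical list, unless some
block is badly covered or the list is not typical. -/
lemma prob_sizes_ge {d n N : ℕ} {θ α τ ρ q₁ q₂ : ℝ} (hd : 3 ≤ d) (he : eps d < 1)
    (hn : 1 ≤ ((d / Nat.log 2 d : ℕ) : ℝ) * (eps d / 3)) (hN : 0 < N) (hθ : eps d < 1 - Real.cos θ)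
    (hq : ∀ x c : USphere (Fin d),
      ApproxEq (eps d) (inner ℝ (x : EuclideanSpace ℝ (Fin d)) c) (Real.cos α) →
      q₁ ≤ (unifSphere (Fin d)).real (nearBoth (eps d) (Real.cos α) (Real.cos θ) c x) ∧
      (unifSphere (Fin d)).real (nearBoth (eps d) (Real.cos α) (Real.cos θ) c x) ≤ q₂)
    (hq₁ : 0 ≤ q₁) (hq₂ : 0 ≤ q₂) (hτ0 : 0 ≤ τ) (hτ1 : τ ≤ 1 / 2)
    (hτ : ∀ (i : Fin (Nat.log 2 d)) (c : USphere (Block d (Nat.log 2 d) i)),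
        0 < (unifSphere (Block d (Nat.log 2 d) i)).real
          {u | ApproxEq (eps d / 3) (inner ℝ (c : EuclideanSpace ℝ (Block d (Nat.log 2 d) i)) u)
            (Real.cos α)} ∧
        τ ≤ blockSize (Nat.log 2 d) (1 / pCap d α) *
          (unifSphere (Block d (Nat.log 2 d) i)).real
          {u | ApproxEq (eps d / 3) (inner ℝ (c : EuclideanSpace ℝ (Block d (Nat.log 2 d) i)) u)
            (Real.cos α)} / 4)
    {J : ℕ} (hJ : J = Fintype.card
      (Fin N × (Fin (Nat.log 2 d) → Fin (blockSize (Nat.log 2 d) (1 / pCap d α)))))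
    (hρ0 : 0 ≤ ρ)
    (hρ : ρ ≤ Real.exp (-(Nat.log 2 d : ℕ)) * ((16 * (d : ℝ)) ^ Nat.log 2 d)⁻¹ * τ ^ Nat.log 2 d
      - J * pCap d α / (2 : ℝ) ^ nlog d) :
    1 - (Nat.log 2 d * (9 / 10) ^ blockSize (Nat.log 2 d) (1 / pCap d α) +
        (Real.exp (-((n + 1 : ℕ) * ρ / 4)) + (J * Real.exp (-((n + 1 : ℕ) * pCap d α))
        + J * ((n + 1 : ℕ) * (Real.exp (-(n * q₂)) + Real.exp (-(n * q₁ / 4)))))))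
      ≤ (jointLaw d (n + 1) N α).real {ω |
        (n + 1 : ℕ) * ρ / 4 * (n * q₁ / 4)
          ≤ (M₁star (listSet ω.1) (rpcCode ω.2) θ α).ncard ∧
        ((M₁star (listSet ω.1) (rpcCode ω.2) θ α).ncard : ℝ)
          ≤ (M₁ (listSet ω.1) (rpcCode ω.2) θ α).ncard ∧
        ((M₁ (listSet ω.1) (rpcCode ω.2) θ α).ncard : ℝ)
          ≤ J * (4 * ((n + 1 : ℕ) * pCap d α) * (4 * (n * q₂)))} := by
  have hb : 0 < Nat.log 2 d := natLog_pos (by omega)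
  have hbd : Nat.log 2 d ≤ d := Nat.log_le_self 2 d
  have he0 : 0 < eps d := eps_pos (by omega)
  set b := Nat.log 2 d
  have hne : ∀ i : Fin b, Nonempty (Block d b i) := fun i =>
    Fintype.card_pos_iff.mp ((Nat.div_pos hbd hb).trans_le (le_card_block hb i))
  have hned : Nonempty (Fin d) := ⟨⟨0, by omega⟩⟩
  have hnull : NullSingletonClass (unifSphere (Fin d)) := ⟨unifSphere_singleton hd⟩
  have hrpc := isProbabilityMeasure_rpcLaw hb hbd (1 / pCap d α) N
  set K := blockSize b (1 / pCap d α)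
  have hB : (rpcLaw d b (1 / pCap d α) N).real {D | ∃ i, (unifSphere (Block d b i)).real
      (coverSet (eps d / 3) (Real.cos α) (D.2 i)) < τ} ≤ b * (9 / 10) ^ K := by
    have he : {D : RPCDesc d b (1 / pCap d α) N | ∃ i, (unifSphere (Block d b i)).real
        (coverSet (eps d / 3) (Real.cos α) (D.2 i)) < τ} = Set.univ ×ˢ {c | ∃ i,
        (unifSphere (Block d b i)).real (coverSet (eps d / 3) (Real.cos α) (c i)) < τ} := by
      ext D
      simp
    rw [he, rpcLaw, measureReal_prod_prod, probReal_univ, one_mul]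
    exact prob_block_bad_le hne hτ1 hτ
  have hp0 : 0 ≤ pCap d α := measureReal_nonneg
  refine prob_niceList_ge (unifSphere (Fin d)) (rpcLaw d b (1 / pCap d α) N)
    (A := fun ι D => codeCap α ι D)
    (G := fun D => fewMatches α ((2 : ℝ) ^ nlog d) D) (R := nearPairs d θ)
    (a := 4 * ((n + 1 : ℕ) * pCap d α)) (g := (n + 1 : ℕ) * ρ / 4) (h₁ := n * q₁ / 4)
    (h₂ := 4 * (n * q₂))
    (fun ι => measurableSet_codeCap α ι) (measurableSet_fewMatches α _)
    (measurableSet_nearPairs θ) (by positivity) hB (fun D hD => ?_) (fun x D hx hN => ?_)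
  · simp only [Set.mem_ofPred_eq, not_exists, not_lt] at hD
    rw [hJ]
    refine prob_not_niceList_le (unifSphere (Fin d)) (A := fun ι => codeCap α ι D)
      (G := fewMatches α ((2 : ℝ) ^ nlog d) D)
      (fun ι => measurable_prodMk_right (measurableSet_codeCap α ι))
      (measurable_prodMk_right (measurableSet_fewMatches α _)) (measurableSet_nearPairs θ)
      (fun a ha => ?_) (fun ι => (prob_codeCap (by omega) hb α ι D).le) (fun ι x hx => ?_)
      hq₁ hρ0 ?_
    · have ha' : |inner ℝ (a : EuclideanSpace ℝ (Fin d)) a - Real.cos θ| ≤ eps d := ha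
      rw [real_inner_self_eq_norm_sq, norm_usphere, one_pow] at ha'
      linarith [le_abs_self (1 - Real.cos θ)]
    · have h1 := hq x ⟨codeVec D ι, by simp [norm_codeVec hb]⟩ hx
      have h2 : {y | y ∈ codeCap α ι D ∧ (x, y) ∈ nearPairs d θ}
          = nearBoth (eps d) (Real.cos α) (Real.cos θ) (codeVec D ι) x := by
        ext y
        simp only [codeCap, nearPairs, nearBoth, Set.mem_ofPred_eq,
          real_inner_comm (codeVec D ι)]
      rw [h2]
      exact h1
    · rw [hJ] at hρ
      exact hρ.trans (prob_fewMatches_ge hb hbd hne he0 he hn hN (by positivity) hτ0 D hD)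
  · rw [hJ]
    exact ncard_bounds_of_niceList hx hN (by positivity) (by positivity)

lemma exp_neg_le_two_rpow {y : ℝ} (hy : 0 ≤ y) : Real.exp (-y) ≤ (2 : ℝ) ^ (-y) := by
  rw [Real.rpow_def_of_pos two_pos]
  gcongr
  have h1 := Real.log_two_lt_d9
  nlinarith

/-- The probability that some block is badly covered is negligible. -/
lemma natLog_mul_pow_le {d K : ℕ} (hd : 1 ≤ d) (hK : 40 * (d : ℝ) ≤ K) :
    Nat.log 2 d * (9 / 10 : ℝ) ^ K ≤ (2 : ℝ) ^ (-(2 * d : ℝ)) := by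
  have h1 : (9 / 10 : ℝ) ^ K ≤ (2 : ℝ) ^ (-(4 * d : ℝ)) := by
    calc (9 / 10 : ℝ) ^ K ≤ Real.exp (-(1 / 10)) ^ K := by
          gcongr
          linarith [Real.add_one_le_exp (-(1 / 10) : ℝ)]
      _ = Real.exp (K * -(1 / 10)) := (Real.exp_nat_mul _ _).symm
      _ ≤ Real.exp (-(4 * d : ℝ)) := by gcongr; linarith
      _ ≤ _ := exp_neg_le_two_rpow (by positivity)
  have h2 : (Nat.log 2 d : ℝ) ≤ (2 : ℝ) ^ (2 * d : ℝ) := by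
    calc (Nat.log 2 d : ℝ) ≤ (2 : ℝ) ^ (d : ℕ) := by
          exact_mod_cast (Nat.log_le_self 2 d).trans d.lt_two_pow_self.le
      _ = (2 : ℝ) ^ (d : ℝ) := (Real.rpow_natCast _ _).symm
      _ ≤ _ := by
          gcongr
          · norm_num
          · linarith [(Nat.cast_nonneg d : (0 : ℝ) ≤ d)]
  calc (Nat.log 2 d : ℝ) * (9 / 10 : ℝ) ^ K
      ≤ (2 : ℝ) ^ (2 * d : ℝ) * (2 : ℝ) ^ (-(4 * d : ℝ)) := by gcongr
    _ = _ := by rw [← Real.rpow_add two_pos]; congr 1; ring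

/-- The failure probability of a random list is negligible if the exponents, which come from the
expected numbers of hits, are at least `y`, a large multiple of the dimension. -/
lemma failure_le {J N m C y d e₁ e₂ e₃ e₄ : ℝ} (hd : 1 ≤ d) (hC : 0 ≤ C) (hJ1 : 1 ≤ J)
    (hm1 : 1 ≤ m) (hJ : J ≤ 3 * N * m) (hN0 : 0 ≤ N) (hN : N ≤ (2 : ℝ) ^ d)
    (hm : m ≤ (2 : ℝ) ^ (C * d))
    (hy : (2 * C + 10) * d ≤ y) (h₁ : y ≤ e₁) (h₂ : y ≤ e₂) (h₃ : y ≤ e₃) (h₄ : y ≤ e₄) :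
    Real.exp (-e₁) + (J * Real.exp (-e₂) + J * (m * (Real.exp (-e₃) + Real.exp (-e₄))))
      ≤ (2 : ℝ) ^ (-(2 * d)) := by
  set E := Real.exp (-y) with hE
  have hE0 : 0 < E := Real.exp_pos _
  have hJm : 1 ≤ J * m := one_le_mul_of_one_le_of_one_le hJ1 hm1
  have hJm' : J ≤ J * m := le_mul_of_one_le_right (by linarith) hm1
  have hE1 : E ≤ (2 : ℝ) ^ (-((2 * C + 10) * d)) :=
    (Real.exp_le_exp.mpr (neg_le_neg hy)).trans (exp_neg_le_two_rpow (by positivity))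
  have h12 : (12 : ℝ) ≤ (2 : ℝ) ^ (4 * d) := by
    calc (12 : ℝ) ≤ (2 : ℝ) ^ (4 : ℝ) := by norm_num
      _ ≤ _ := by
        gcongr
        · norm_num
        · linarith
  have hexp : ∀ {e}, y ≤ e → Real.exp (-e) ≤ E := fun h => Real.exp_le_exp.mpr (neg_le_neg h)
  have g₁ := hexp h₁
  have g₂ := hexp h₂
  have g₃ := hexp h₃
  have g₄ := hexp h₄
  calc _ ≤ E + (J * E + J * (m * (E + E))) := by gcongr
    _ = (1 + J + 2 * (J * m)) * E := by ring
    _ ≤ (4 * (J * m)) * E := by gcongr; linarith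
    _ ≤ (4 * ((3 * N * m) * m)) * E := by gcongr
    _ = 12 * N * m * m * E := by ring
    _ ≤ (2 : ℝ) ^ (4 * d) * (2 : ℝ) ^ d * (2 : ℝ) ^ (C * d) * (2 : ℝ) ^ (C * d)
        * (2 : ℝ) ^ (-((2 * C + 10) * d)) := by gcongr
    _ = (2 : ℝ) ^ (-(5 * d)) := by
        simp only [← Real.rpow_add two_pos]; congr 1; ring
    _ ≤ _ := by
        gcongr
        · norm_num
        · norm_num

/-- The lower bound of `prob_sizes_ge` with `ρ = T⁻¹ / 2` and `q₁ = T⁻¹ V`: the constants multiply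
to `64`, which a third factor `T` absorbs. -/
lemma size_lower_le {m n T V : ℝ} (hm : 0 ≤ m) (hV : 0 ≤ V) (hT : 64 ≤ T) (hmn : m ≤ 2 * n) :
    (T ^ 3)⁻¹ * (m ^ 2 * V) ≤ m * (T⁻¹ / 2) / 4 * (n * (T⁻¹ * V) / 4) := by
  have hT0 : 0 < T := by linarith
  have h1 : T⁻¹ ≤ (64 : ℝ)⁻¹ := inv_anti₀ (by norm_num) hT
  calc (T ^ 3)⁻¹ * (m ^ 2 * V) = m ^ 2 * V * T⁻¹ * T⁻¹ * T⁻¹ := by ring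
    _ ≤ m ^ 2 * V * T⁻¹ * T⁻¹ * (64 : ℝ)⁻¹ := by gcongr
    _ = m * (T⁻¹ / 2) / 4 * (T⁻¹ * V / 8) * m := by ring
    _ ≤ m * (T⁻¹ / 2) / 4 * (T⁻¹ * V / 8) * (2 * n) := by gcongr
    _ = _ := by ring

/-- The upper bound of `prob_sizes_ge` with `q₂ = T V`: the factors `J p ≤ 3 N ≤ 3 T` and `q₂` give
`T²`, and the constants multiply to `48`, which a third factor `T` absorbs. -/
lemma le_size_upper {m n p J N T V : ℝ} (hm : 0 ≤ m) (hV : 0 ≤ V) (hT : 64 ≤ T) (hn : 0 ≤ n)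
    (hnm : n ≤ m) (hJp : J * p ≤ 3 * N) (hNT : N ≤ T) :
    J * (4 * (m * p) * (4 * (n * (T * V)))) ≤ T ^ 3 * (m ^ 2 * V) := by
  have hT0 : 0 < T := by linarith
  have h1 : J * p ≤ 3 * T := hJp.trans (by linarith)
  calc J * (4 * (m * p) * (4 * (n * (T * V)))) = J * p * (16 * m * n * (T * V)) := by ring
    _ ≤ 3 * T * (16 * m * m * (T * V)) := by gcongr
    _ = 48 * (T ^ 2 * (m ^ 2 * V)) := by ring
    _ ≤ T * (T ^ 2 * (m ^ 2 * V)) := by gcongr; linarith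
    _ = _ := by ring

/-- Both sizes are `m² (1 - γ²) ^ (d / 2)` up to a factor `2 ^ (3 d / log d)`. -/
lemma eventually_sizes {κ κ' C₁ c η : ℝ} (hκ : 0 < κ) (hκ4 : κ < Real.pi / 4) (hκ' : 0 < κ')
    (hc : 0 < c) (hη : 0 < η) :
    ∀ᶠ d : ℕ in atTop, ∀ (θ α : ℝ) (m N : ℕ),
      θ ∈ Set.Icc κ (Real.pi / 2 - κ) → α ∈ Set.Icc κ (Real.pi / 2 - κ) →
      gammaSq θ α α ≤ 1 - κ' → (m : ℝ) ≤ (2 : ℝ) ^ (C₁ * d) → 1 ≤ N →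
      (N : ℝ) ≤ (2 : ℝ) ^ ((1 - η) * nlog d) →
      (2 : ℝ) ^ (c * d) ≤ m * Real.sqrt (1 - gammaSq θ α α) ^ d →
      1 - (2 : ℝ) ^ (-(d : ℝ)) ≤ (jointLaw d m N α).real {ω |
        (2 : ℝ) ^ (-(3 * nlog d)) * ((m : ℝ) ^ 2 * Real.sqrt (1 - gammaSq θ α α) ^ d)
          ≤ (M₁star (listSet ω.1) (rpcCode ω.2) θ α).ncard ∧
        ((M₁star (listSet ω.1) (rpcCode ω.2) θ α).ncard : ℝ)
          ≤ (M₁ (listSet ω.1) (rpcCode ω.2) θ α).ncard ∧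
        ((M₁ (listSet ω.1) (rpcCode ω.2) θ α).ncard : ℝ)
          ≤ (2 : ℝ) ^ (3 * nlog d) * ((m : ℝ) ^ 2 * Real.sqrt (1 - gammaSq θ α α) ^ d)} := by
  have hs := sin_pos_of_lt hκ hκ4
  -- `ζ < η`: the share of vectors with too many matches, about `N / 2 ^ (d / log d)`, has to be
  -- small compared to the share `2 ^ (- ζ d / log d)` of vectors with a match
  set ζ := min 1 (η / 2) with hζdef
  have hζ : 0 < ζ := lt_min one_pos (by positivity)
  have hζ1 : ζ ≤ 1 := min_le_left _ _
  have hζη : ζ ≤ η / 2 := min_le_right _ _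
  have hcos : 0 < 1 - Real.cos κ := by
    have h1 := Real.sin_sq_add_cos_sq κ
    have : 0 < Real.sin κ ^ 2 := by positivity
    nlinarith [Real.cos_le_one κ]
  filter_upwards [eventually_cap_bounds hκ hκ4 one_pos,
    eventually_nearBoth_bounds hκ hκ4 hκ' one_pos, eventually_block_cover hκ hκ4 hζ,
    eventually_blockSize_bounds hκ hκ4 40, eventually_ge_atTop 3,
    eventually_eps_le (show (0 : ℝ) < 1 / 2 by norm_num),
    eventually_eps_le (show 0 < (1 - Real.cos κ) / 2 by positivity),
    eventually_le_eps_mul_block 3, eventually_poly_le 64 0 one_pos,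
    eventually_poly_le 6 0 (show 0 < η / 2 by positivity),
    eventually_nlog_le (show 0 < c / 2 by positivity), eventually_nlog_le one_pos,
    eventually_poly_le (8 * (2 * |C₁| + 10)) 1 (show 0 < c / 2 by positivity)]
    with d hcap hnear hcov hK hd he1 he2 hblk hT64 hη6 hDc hD1 hpoly θ α m N hθ hα hγ hm hN1 hN hmV
  obtain ⟨τ, hτ0, hτ1, hτ, hτρ⟩ := hcov α hα
  obtain ⟨hK40, hKp⟩ := hK α hα
  obtain ⟨hp1, -⟩ := hcap α hα
  obtain ⟨ha1, ha2⟩ := sin_cos_bounds hκ hα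
  have hb : 0 < Nat.log 2 d := natLog_pos (by omega)
  have he0 : 0 < eps d := eps_pos (by omega)
  have hd1 : (1 : ℝ) ≤ d := by exact_mod_cast (by omega : 1 ≤ d)
  have hsα : 0 < Real.sin α := hs.trans_le ha1
  rw [pow_zero, mul_one, one_mul] at hT64
  rw [pow_zero, mul_one] at hη6
  rw [one_mul] at hp1 hD1
  set p := pCap d α
  set K := blockSize (Nat.log 2 d) (1 / p)
  set V := Real.sqrt (1 - gammaSq θ α α) ^ d with hV
  set T : ℝ := (2 : ℝ) ^ nlog d with hT
  have hT0 : 0 < T := by positivity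
  have hTi : (2 : ℝ) ^ (-nlog d) = T⁻¹ := Real.rpow_neg zero_le_two _
  have hT3 : (2 : ℝ) ^ (3 * nlog d) = T ^ 3 := by
    rw [mul_comm, Real.rpow_mul zero_le_two]; norm_cast
  have hT3i : (2 : ℝ) ^ (-(3 * nlog d)) = (T ^ 3)⁻¹ := by rw [Real.rpow_neg zero_le_two, hT3]
  have hV0 : 0 < V := pow_pos (Real.sqrt_pos.mpr (by linarith)) d
  have hVs : V ≤ Real.sin α ^ d := by
    refine pow_le_pow_left₀ (Real.sqrt_nonneg _) ?_ d
    rw [← sqrt_one_sub_cos_sq hsα.le]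
    refine Real.sqrt_le_sqrt ?_
    rw [gammaSq_eq hsα, ← Real.sin_sq]
    have : 0 ≤ (Real.cos θ - Real.cos α ^ 2) ^ 2 / Real.sin α ^ 2 := by positivity
    linarith [Real.sin_sq_add_cos_sq α]
  have hV1 : V ≤ 1 := hVs.trans (pow_le_one₀ hsα.le (Real.sin_le_one α))
  set q₁ := T⁻¹ * V with hq₁
  set q₂ := T * V with hq₂
  have hq10 : 0 < q₁ := by positivity
  have hq20 : 0 < q₂ := by positivity
  have hT1 : 1 ≤ T := by linarith
  have hTi1 : T⁻¹ ≤ 1 := inv_le_one_of_one_le₀ hT1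
  have hqq : q₁ ≤ q₂ := mul_le_mul_of_nonneg_right (hTi1.trans hT1) hV0.le
  have hqp : q₁ ≤ p := by
    refine le_trans ?_ hp1
    rw [hTi]
    exact mul_le_mul_of_nonneg_left hVs (inv_nonneg.mpr hT0.le)
  -- all expected numbers of hits are at least `m * q₁ / 8`
  have hmq : 8 * (2 * |C₁| + 10) * d ≤ m * q₁ := by
    calc 8 * (2 * |C₁| + 10) * d = 8 * (2 * |C₁| + 10) * (d : ℝ) ^ 1 := by rw [pow_one]
      _ ≤ (2 : ℝ) ^ (c / 2 * nlog d) := hpoly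
      _ ≤ (2 : ℝ) ^ (-nlog d + c * d) := by
        gcongr
        · norm_num
        · have : c / 2 * nlog d ≤ c / 2 * d := by gcongr
          linarith
      _ = T⁻¹ * (2 : ℝ) ^ (c * d) := by rw [Real.rpow_add two_pos, hTi]
      _ ≤ T⁻¹ * (m * V) := by gcongr
      _ = m * q₁ := by rw [hq₁]; ring
  have hCd : 0 ≤ |C₁| * d := by positivity
  have hm80 : (80 : ℝ) ≤ m := by
    have : (m : ℝ) * q₁ ≤ m * 1 := by
      gcongr
      exact mul_le_one₀ hTi1 hV0.le hV1
    linarith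
  obtain ⟨n, rfl⟩ : ∃ n, m = n + 1 := ⟨m - 1, by
    have : 80 ≤ m := by exact_mod_cast hm80
    omega⟩
  have hmn : ((n + 1 : ℕ) : ℝ) ≤ 2 * n := by push_cast at hm80 ⊢; linarith
  have hnm : (n : ℝ) ≤ (n + 1 : ℕ) := by push_cast; linarith
  have hn0 : (0 : ℝ) ≤ n := n.cast_nonneg
  obtain ⟨J, hJ⟩ : ∃ J : ℕ, J = Fintype.card (Fin N × (Fin (Nat.log 2 d) → Fin K)) := ⟨_, rfl⟩
  have hJ' : (J : ℝ) = N * (K : ℝ) ^ Nat.log 2 d := by rw [hJ]; simp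
  have hK1 : (1 : ℝ) ≤ K := by linarith
  have hN1' : (1 : ℝ) ≤ N := by exact_mod_cast hN1
  have hJ1 : (1 : ℝ) ≤ J := by
    rw [hJ']
    exact one_le_mul_of_one_le_of_one_le hN1' (one_le_pow₀ hK1)
  have hJp : J * p ≤ 3 * N := by
    calc J * p = N * ((K : ℝ) ^ Nat.log 2 d * p) := by rw [hJ']; ring
      _ ≤ N * 3 := by gcongr
      _ = _ := mul_comm _ _
  have hNT : (N : ℝ) ≤ T := by
    refine hN.trans ?_
    rw [hT]
    gcongr
    · norm_num
    · have := mul_nonneg hη.le (nlog_nonneg d)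
      linarith
  have hTd : T ≤ (2 : ℝ) ^ (d : ℝ) := by
    rw [hT]
    gcongr
    norm_num
  obtain ⟨m, hmdef⟩ : ∃ m : ℝ, ((n + 1 : ℕ) : ℝ) = m := ⟨_, rfl⟩
  rw [hmdef] at hm hmV hmq hm80 hmn hnm ⊢
  -- at least half of the vectors with a match have few matches
  have hρ : T⁻¹ / 2 ≤ Real.exp (-(Nat.log 2 d : ℕ)) * ((16 * (d : ℝ)) ^ Nat.log 2 d)⁻¹
      * τ ^ Nat.log 2 d - J * p / T := by
    have h1 : (2 : ℝ) ^ (-(ζ * nlog d)) / 2 ≤ (2 : ℝ) ^ (-(ζ * nlog d)) - J * p / T := by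
      have h2 : J * p / T ≤ 3 * (2 : ℝ) ^ (-(η * nlog d)) := by
        rw [div_le_iff₀ hT0]
        refine hJp.trans ?_
        rw [mul_assoc, hT, ← Real.rpow_add two_pos]
        gcongr
        refine hN.trans (le_of_eq ?_)
        congr 1
        ring
      have h3 : 6 * (2 : ℝ) ^ (-(η * nlog d)) ≤ (2 : ℝ) ^ (-(ζ * nlog d)) := by
        calc 6 * (2 : ℝ) ^ (-(η * nlog d))
            ≤ (2 : ℝ) ^ (η / 2 * nlog d) * (2 : ℝ) ^ (-(η * nlog d)) := by gcongr
          _ = (2 : ℝ) ^ (-(η / 2 * nlog d)) := by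
            rw [← Real.rpow_add two_pos]; congr 1; ring
          _ ≤ _ := by
            have := nlog_nonneg d
            gcongr
            norm_num
      linarith
    have h4 : T⁻¹ ≤ (2 : ℝ) ^ (-(ζ * nlog d)) := by
      rw [← hTi]
      gcongr
      · norm_num
      · exact mul_le_of_le_one_left (nlog_nonneg d) hζ1
    linarith
  have hθe : eps d < 1 - Real.cos θ := by
    have : Real.cos θ ≤ Real.cos κ := Real.cos_le_cos_of_nonneg_of_le_pi hκ.le
      (by linarith [hθ.2, Real.pi_pos]) hθ.1
    linarith
  have hq : ∀ x c : USphere (Fin d),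
      ApproxEq (eps d) (inner ℝ (x : EuclideanSpace ℝ (Fin d)) c) (Real.cos α) →
      q₁ ≤ (unifSphere (Fin d)).real (nearBoth (eps d) (Real.cos α) (Real.cos θ) c x) ∧
      (unifSphere (Fin d)).real (nearBoth (eps d) (Real.cos α) (Real.cos θ) c x) ≤ q₂ := by
    intro x c hxc
    have := hnear θ hθ α hα hγ x c hxc
    rw [one_mul, hTi] at this
    exact this
  have key := prob_sizes_ge (n := n) hd (by linarith) (by linarith) (by omega) hθe hq hq10.le
    hq20.le hτ0 hτ1 hτ hJ (by positivity) hρ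
  have := isProbabilityMeasure_jointLaw (show 2 ≤ d by omega) (n + 1) N α
  refine le_trans ?_ (key.trans (measureReal_mono ?_))
  · have h1 := natLog_mul_pow_le (by omega) hK40
    have hmq0 : 0 ≤ m * q₁ := by positivity
    have hy : (2 * |C₁| + 10) * d ≤ m * q₁ / 8 := by linarith
    have h2 := failure_le (J := J) (N := N) (m := m) (C := |C₁|) (y := m * q₁ / 8) (d := d)
      (e₁ := m * (T⁻¹ / 2) / 4) (e₂ := m * p) (e₃ := n * q₂) (e₄ := n * q₁ / 4) hd1
      (abs_nonneg _) hJ1 (by linarith) ?_ N.cast_nonneg (hNT.trans hTd) ?_ hy ?_ ?_ ?_ ?_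
    · rw [hmdef]
      have h3 : (2 : ℝ) ^ (-(2 * d : ℝ)) ≤ (2 : ℝ) ^ (-(d : ℝ)) / 2 := by
        rw [le_div_iff₀ two_pos]
        calc (2 : ℝ) ^ (-(2 * d : ℝ)) * 2 = (2 : ℝ) ^ (-(2 * d : ℝ)) * (2 : ℝ) ^ (1 : ℝ) := by
              rw [Real.rpow_one]
          _ = (2 : ℝ) ^ (-(2 * d : ℝ) + 1) := (Real.rpow_add two_pos _ _).symm
          _ ≤ _ := by
              gcongr
              · norm_num
              · linarith
      linarith
    · calc (J : ℝ) ≤ J * (m * q₁) := le_mul_of_one_le_right (by linarith) (by linarith)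
        _ ≤ J * (m * p) := by gcongr
        _ = J * p * m := by ring
        _ ≤ 3 * N * m := by gcongr
    · refine hm.trans ?_
      gcongr
      · norm_num
      · exact le_abs_self C₁
    · calc m * q₁ / 8 ≤ m * (T⁻¹ * 1) / 8 := by rw [hq₁]; gcongr
        _ = _ := by ring
    · calc m * q₁ / 8 ≤ m * q₁ := by linarith
        _ ≤ _ := by gcongr
    · calc m * q₁ / 8 ≤ 2 * n * q₁ / 8 := by gcongr
        _ ≤ n * q₁ := by
          have : 0 ≤ n * q₁ := by positivity
          linarith
        _ ≤ _ := by gcongr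
    · calc m * q₁ / 8 ≤ 2 * n * q₁ / 8 := by gcongr
        _ = _ := by ring
  · rintro ω ⟨hω1, hω2, hω3⟩
    rw [hmdef] at hω1 hω3
    refine ⟨le_trans ?_ hω1, hω2, hω3.trans ?_⟩
    · rw [hT3i]
      exact size_lower_le (by linarith) hV0.le (by linarith) hmn
    · rw [hT3]
      exact le_size_upper (by linarith) hV0.le (by linarith) hn0 hnm hJp hNT

end sizes

end Sieving

theorem mainTheorem7 (κ κ' c₁ C₁ c₂ η : ℝ) (hκ : 0 < κ) (hκ4 : κ < Real.pi / 4)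
    (hκ' : 0 < κ') (hc₁ : 0 < c₁) (hc₂ : 0 < c₂) (hη : 0 < η) :
    ∃ c : ℝ, 0 < c ∧ ∃ f : ℕ → ℝ, f =o[atTop] (fun d : ℕ => (d : ℝ)) ∧
      ∀ᶠ d : ℕ in atTop, ∀ (θ α : ℝ) (m N : ℕ),
        θ ∈ Set.Icc κ (Real.pi / 2 - κ) → α ∈ Set.Icc κ (Real.pi / 2 - κ) →
        WedgeWellDefined κ' θ α α → WedgeWellDefined κ' α α θ →
        (2 : ℝ) ^ (c₁ * d) ≤ m → (m : ℝ) ≤ (2 : ℝ) ^ (C₁ * d) →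
        1 ≤ N → (N : ℝ) ≤ (2 : ℝ) ^ ((1 - η) * (d / Real.logb 2 d)) →
        (Real.cos α ^ 2 ≤ Real.cos θ →
          (2 : ℝ) ^ (c₂ * d) ≤ m * wedgeVol d θ α α →
          1 - (2 : ℝ) ^ (-(c * d)) ≤
            (jointLaw d m N α).real (sizeEvent d m N θ α (f d) (wedgeVol d θ α α))) ∧
        ((2 : ℝ) ^ (c₂ * d) ≤ m * (1 - gammaSq θ α α) ^ ((d : ℝ) / 2) →
          1 - (2 : ℝ) ^ (-(c * d)) ≤
            (jointLaw d m N α).real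
              (sizeEvent d m N θ α (f d) ((1 - gammaSq θ α α) ^ ((d : ℝ) / 2)))) := by
  -- three multiples of `d / log d` are lost in `eventually_sizes`, and one more in replacing `V` by
  -- the volume of the wedge
  refine ⟨1, one_pos, fun d => 4 * nlog d, isLittleO_nlog 4, ?_⟩
  filter_upwards [eventually_sizes (C₁ := C₁) hκ hκ4 hκ' (half_pos hc₂) hη,
    eventually_wedgeVol_bounds hκ hκ4 hκ' one_pos, eventually_nlog_le (half_pos hc₂),
    eventually_ge_atTop 2] with d hsize hwedge hD hd θ α m N hθ hα hw _ _ hm hN1 hN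
  have hγ := gammaSq_le_of_wellDefined hκ hκ4 hα hw
  have hD0 := nlog_nonneg d
  set V := Real.sqrt (1 - gammaSq θ α α) ^ d with hVdef
  have hV0 : 0 ≤ V := by positivity
  have hV : (1 - gammaSq θ α α) ^ ((d : ℝ) / 2) = V := by
    rw [hVdef, ← Real.rpow_natCast (Real.sqrt _) d, Real.sqrt_eq_rpow,
      ← Real.rpow_mul (by linarith)]
    congr 1
    ring
  -- `W` is either the volume of the wedge or `V` itself
  have main : ∀ W : ℝ, (2 : ℝ) ^ (-(1 * nlog d)) * V ≤ W → W ≤ (2 : ℝ) ^ (1 * nlog d) * V →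
      (2 : ℝ) ^ (c₂ * d) ≤ m * W → 1 - (2 : ℝ) ^ (-(1 * (d : ℝ))) ≤
        (jointLaw d m N α).real (sizeEvent d m N θ α (4 * nlog d) W) := by
    intro W hW1 hW2 hmW
    have hmV : (2 : ℝ) ^ (c₂ / 2 * d) ≤ m * V := by
      calc (2 : ℝ) ^ (c₂ / 2 * d) ≤ (2 : ℝ) ^ (-(1 * nlog d) + c₂ * d) := by
            gcongr
            · norm_num
            · linarith
        _ = (2 : ℝ) ^ (-(1 * nlog d)) * (2 : ℝ) ^ (c₂ * d) := Real.rpow_add two_pos _ _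
        _ ≤ (2 : ℝ) ^ (-(1 * nlog d)) * (m * ((2 : ℝ) ^ (1 * nlog d) * V)) := by
            gcongr
            exact hmW.trans (by gcongr)
        _ = m * V := by
            rw [Real.rpow_neg zero_le_two]
            field_simp
    have := isProbabilityMeasure_jointLaw hd m N α
    rw [one_mul]
    refine (hsize θ α m N hθ hα hγ hm hN1 hN hmV).trans (measureReal_mono ?_)
    rintro ω ⟨h1, h2, h3⟩
    have hlow : (2 : ℝ) ^ (-(4 * nlog d)) * ((m : ℝ) ^ 2 * W)
        ≤ (2 : ℝ) ^ (-(3 * nlog d)) * ((m : ℝ) ^ 2 * V) := by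
      calc (2 : ℝ) ^ (-(4 * nlog d)) * ((m : ℝ) ^ 2 * W)
          ≤ (2 : ℝ) ^ (-(4 * nlog d)) * ((m : ℝ) ^ 2 * ((2 : ℝ) ^ (1 * nlog d) * V)) := by gcongr
        _ = (2 : ℝ) ^ (-(4 * nlog d) + 1 * nlog d) * ((m : ℝ) ^ 2 * V) := by
            rw [Real.rpow_add two_pos]; ring
        _ = _ := by ring_nf
    have hupp : (2 : ℝ) ^ (3 * nlog d) * ((m : ℝ) ^ 2 * V)
        ≤ (2 : ℝ) ^ (4 * nlog d) * ((m : ℝ) ^ 2 * W) := by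
      calc (2 : ℝ) ^ (3 * nlog d) * ((m : ℝ) ^ 2 * V)
          = (2 : ℝ) ^ (4 * nlog d + -(1 * nlog d)) * ((m : ℝ) ^ 2 * V) := by ring_nf
        _ = (2 : ℝ) ^ (4 * nlog d) * ((m : ℝ) ^ 2 * ((2 : ℝ) ^ (-(1 * nlog d)) * V)) := by
            rw [Real.rpow_add two_pos]; ring
        _ ≤ _ := by gcongr
    exact ⟨⟨hlow.trans (h1.trans h2), h3.trans hupp⟩, ⟨hlow.trans h1, (h2.trans h3).trans hupp⟩⟩
  refine ⟨fun hcos => ?_, ?_⟩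
  · obtain ⟨h1, h2⟩ := hwedge θ hθ α hα hγ hcos
    exact main _ h1 h2
  · rw [hV]
    refine main V (mul_le_of_le_one_left hV0 ?_) (le_mul_of_one_le_left hV0 ?_)
    · exact Real.rpow_le_one_of_one_le_of_nonpos one_le_two (by linarith)
    · exact Real.one_le_rpow one_le_two (by linarith)
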